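/- **Proposition 3.1.** Let $n,N\ge 1$ and $k>n+1$ be integers and let $\chi$ be a Dirichlet character modulo $N$ (complex valued). Write $$Sp_n(\mathbb Z)=\left\{\begin{pmatrix}A&B\\C&D\end{pmatrix}: A\,{}^tB=B\,{}^tA,\ C\,{}^tD=D\,{}^tC,\ A\,{}^tD-B\,{}^tC=I\right\}$$ ($n\times n$ integral blocks), and let $\Gamma_0(N)$, $\Gamma(N)$, $\Gamma_\infty$, $\Gamma_\infty^+$ be the subgroups of $Sp_n(\mathbb Z)$ given by $N\mid C$; by congruence to $I$ modulo $N$; by $C=0$; and by $C=0$, $\det D=1$, respectively. For $\delta=\begin{pmatrix}A&B\\C&D\end{pmatrix}\in Sp_n(\mathbb Z)$ and a function $F$ on the Siegel upper half-space $\mathfrak h_{(n)}=\{\tau=X+iY: X,Y\in\mathbb R^{n,n}\text{ symmetric},\ Y>0\}$ put $(F|\delta)(\tau)=\det(C\tau+D)^{-k}F\big((A\tau+B)(C\tau+D)^{-1}\big)$ and $\chi(\delta)=\chi(\det D)$. Set $$\mathbb E^*=\sum_{\delta^*}1|\delta^*,$$ where $\delta^*$ runs over representatives of the cosets $\Gamma_\infty^+\delta^*$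 whose union is $\Gamma_\infty^+\Gamma(N)$. For $\gamma\in Sp_n(\mathbb Z)$ let $$\Gamma_\gamma=\{\beta\in\Gamma_0(N):\Gamma_\infty\Gamma(N)\gamma\beta=\Gamma_\infty\Gamma(N)\gamma\},\qquad \Gamma^+_\gamma=\{\beta\in\Gamma_0(N):\Gamma^+_\infty\Gamma(N)\gamma\beta=\Gamma^+_\infty\Gamma(N)\gamma\},$$ and define $$\mathbb E_\gamma=\frac1{[\Gamma_\gamma:\Gamma(N)]}\sum_{\delta,\delta'}\overline\chi(\delta\delta')\,\mathbb E^*|\gamma\delta'\delta,$$ where $\delta$ runs over representatives of $\Gamma^+_\gamma\backslash\Gamma_0(N)$ and $\delta'$ over representatives of $\Gamma(N)\backslash\Gamma^+_\gamma$. Let $\tau\to i\infty$ mean that the least eigenvalue of $\operatorname{Im}\tau$ tends to infinity, with no condition on $\operatorname{Re}\tau$. Suppose that $\alpha,\gamma\in Sp_n(\mathbb Z)$ and that $\mathbb E_\gamma$ is not identically zero on $\mathfrak h_{(n)}$. (a) If $\alpha\notin\Gamma_\infty\gamma\Gamma_0(N)$, then $\displaystyle\lim_{\tau\to i\infty}\mathbb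 E_\gamma(\tau)|\alpha^{-1}=0$. (b) If $\alpha=\beta\gamma\delta'$ for some $\beta\in\Gamma_\infty$ and $\delta'\in\Gamma_0(N)$, then $$\lim_{\tau\to i\infty}\mathbb E_\gamma(\tau)|\alpha^{-1}=\begin{cases}2&\text{if }N\le 2,\\ \overline\chi(\delta'\beta)&\text{otherwise.}\end{cases}$$ -/

import Mathlib

open Matrix Filter Topology
open scoped Pointwise

namespace SiegelEisenstein

/-- `Sp_n(ℤ)`, the integral matrices `(A B; C D)` in `n × n` blocks with `A Bᵀ = B Aᵀ`,
`C Dᵀ = D Cᵀ` and `A Dᵀ - B Cᵀ = I` (see `mem_symplecticGroup_iff`). -/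
abbrev Sp (n : ℕ) : Type := Matrix.symplecticGroup (Fin n) ℤ

theorem mem_symplecticGroup_iff {n : ℕ} (A B C D : Matrix (Fin n) (Fin n) ℤ) :
    fromBlocks A B C D ∈ Matrix.symplecticGroup (Fin n) ℤ ↔
      A * Bᵀ = B * Aᵀ ∧ C * Dᵀ = D * Cᵀ ∧ A * Dᵀ - B * Cᵀ = 1 := by
  rw [← SymplecticGroup.transpose_mem_iff, fromBlocks_transpose,
    SymplecticGroup.fromBlocks_mem_iff]
  simp only [transpose_transpose]

variable {n : ℕ}

/-- The block `A` of `γ = (A B; C D)`. -/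
def blkA (γ : Sp n) : Matrix (Fin n) (Fin n) ℤ := γ.1.toBlocks₁₁

/-- The block `B` of `γ = (A B; C D)`. -/
def blkB (γ : Sp n) : Matrix (Fin n) (Fin n) ℤ := γ.1.toBlocks₁₂

/-- The block `C` of `γ = (A B; C D)`. -/
def blkC (γ : Sp n) : Matrix (Fin n) (Fin n) ℤ := γ.1.toBlocks₂₁

/-- The block `D` of `γ = (A B; C D)`. -/
def blkD (γ : Sp n) : Matrix (Fin n) (Fin n) ℤ := γ.1.toBlocks₂₂

theorem blkC_mul (γ δ : Sp n) : blkC (γ * δ) = blkC γ * blkA δ + blkD γ * blkC δ := by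
  ext i j
  simp [blkA, blkC, blkD, toBlocks₁₁, toBlocks₂₁, toBlocks₂₂, Matrix.mul_apply]

theorem blkD_mul (γ δ : Sp n) : blkD (γ * δ) = blkC γ * blkB δ + blkD γ * blkD δ := by
  ext i j
  simp [blkB, blkC, blkD, toBlocks₁₂, toBlocks₂₁, toBlocks₂₂, Matrix.mul_apply]

theorem blkC_one : blkC (1 : Sp n) = 0 := by
  ext i j
  simp [blkC, toBlocks₂₁]

theorem blkD_one : blkD (1 : Sp n) = 1 := by
  ext i j
  simp [blkD, toBlocks₂₂, Matrix.one_apply]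

theorem blkC_inv (γ : Sp n) : blkC γ⁻¹ = -(blkC γ)ᵀ := by
  have h : (γ⁻¹ : Sp n).1
      = (-J (Fin n) ℤ) * γ.1ᵀ * J (Fin n) ℤ := rfl
  unfold blkC
  rw [h, ← fromBlocks_toBlocks γ.1]
  simp [J, fromBlocks_transpose, fromBlocks_neg, fromBlocks_multiply]

/-- `Γ(N) = {γ ∈ Sp_n(ℤ) : γ ≡ I (mod N)}`. -/
def Gam (n N : ℕ) : Subgroup (Sp n) :=
  MonoidHom.ker
    (((Int.castRingHom (ZMod N)).mapMatrix : Matrix (Fin n ⊕ Fin n) (Fin n ⊕ Fin n) ℤ →+* _)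
      |>.toMonoidHom.comp (Matrix.symplecticGroup (Fin n) ℤ).subtype)

/-- `Γ₀(N)`: the elements of `Sp_n(ℤ)` with `N ∣ C`. -/
def Gam0 (n N : ℕ) : Subgroup (Sp n) where
  carrier := {γ | ∀ i j, (N : ℤ) ∣ blkC γ i j}
  one_mem' := by intro i j; simp [blkC_one]
  mul_mem' := by
    intro γ δ hγ hδ i j
    rw [blkC_mul, Matrix.add_apply, Matrix.mul_apply, Matrix.mul_apply]
    exact dvd_add (Finset.dvd_sum fun l _ => (hγ i l).mul_right _)
      (Finset.dvd_sum fun l _ => (hδ l j).mul_left _)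
  inv_mem' := by
    intro γ hγ i j
    rw [blkC_inv, Matrix.neg_apply, Matrix.transpose_apply]
    exact (hγ j i).neg_right

/-- `Γ_∞`: the elements of `Sp_n(ℤ)` with `C = 0`. -/
def GamInf (n : ℕ) : Subgroup (Sp n) where
  carrier := {γ | blkC γ = 0}
  one_mem' := blkC_one
  mul_mem' := by
    intro γ δ hγ hδ
    simp only [Set.mem_ofPred_eq] at hγ hδ ⊢
    rw [blkC_mul, hγ, hδ, Matrix.zero_mul, Matrix.mul_zero, add_zero]
  inv_mem' := by
    intro γ hγ
    simp only [Set.mem_ofPred_eq] at hγ ⊢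
    rw [blkC_inv, hγ, transpose_zero, neg_zero]

/-- `Γ_∞⁺`: the elements of `Γ_∞` with `det D = 1`. -/
def GamInfPlus (n : ℕ) : Subgroup (Sp n) where
  carrier := {γ | γ ∈ GamInf n ∧ (blkD γ).det = 1}
  one_mem' := ⟨one_mem _, by rw [blkD_one, det_one]⟩
  mul_mem' := by
    rintro γ δ ⟨hγ, hγ'⟩ ⟨hδ, hδ'⟩
    have h : blkC γ = 0 := hγ
    refine ⟨mul_mem hγ hδ, ?_⟩
    rw [blkD_mul, h, Matrix.zero_mul, zero_add, det_mul, hγ', hδ', one_mul]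
  inv_mem' := by
    rintro γ ⟨hγ, hγ'⟩
    have h : blkC γ = 0 := hγ
    refine ⟨inv_mem hγ, ?_⟩
    have e : blkD (γ * γ⁻¹) = 1 := by rw [mul_inv_cancel, blkD_one]
    rw [blkD_mul, h, Matrix.zero_mul, zero_add] at e
    have e' := congrArg Matrix.det e
    rwa [det_mul, hγ', one_mul, det_one] at e'

/-- For a subgroup `P` of `Sp_n(ℤ)`, the group
`{β ∈ Γ₀(N) : P Γ(N) γ β = P Γ(N) γ}` (an equality of subsets of `Sp_n(ℤ)`). -/
def cosetStab (N : ℕ) (P : Subgroup (Sp n)) (γ : Sp n) : Subgroup (Sp n) where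
  carrier := {β | β ∈ Gam0 n N ∧
    (P : Set (Sp n)) * (Gam n N : Set (Sp n)) * {γ * β}
      = (P : Set (Sp n)) * (Gam n N : Set (Sp n)) * {γ}}
  one_mem' := ⟨one_mem _, by rw [mul_one]⟩
  mul_mem' := by
    rintro β β' ⟨h, e⟩ ⟨h', e'⟩
    refine ⟨mul_mem h h', ?_⟩
    rw [← mul_assoc γ β β', ← Set.singleton_mul_singleton, ← mul_assoc, e, mul_assoc,
      Set.singleton_mul_singleton, e']
  inv_mem' := by
    rintro β ⟨h, e⟩
    refine ⟨inv_mem h, ?_⟩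
    rw [← Set.singleton_mul_singleton, ← mul_assoc, ← e, mul_assoc, Set.singleton_mul_singleton,
      mul_inv_cancel_right, e]

/-- `Γ_γ = {β ∈ Γ₀(N) : Γ_∞ Γ(N) γ β = Γ_∞ Γ(N) γ}`. -/
def Stab (N : ℕ) (γ : Sp n) : Subgroup (Sp n) := cosetStab N (GamInf n) γ

/-- `Γ_γ⁺ = {β ∈ Γ₀(N) : Γ_∞⁺ Γ(N) γ β = Γ_∞⁺ Γ(N) γ}`. -/
def StabPlus (N : ℕ) (γ : Sp n) : Subgroup (Sp n) := cosetStab N (GamInfPlus n) γ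

/-- The Siegel upper half-space of degree `n`: complex symmetric matrices with positive definite
imaginary part. -/
def halfSpace (n : ℕ) : Set (Matrix (Fin n) (Fin n) ℂ) :=
  {τ | τ.IsSymm ∧ (τ.map Complex.im).PosDef}

/-- `τ → i∞`: the filter on the half-space along which the least eigenvalue of the imaginary part
tends to infinity, with no restriction on the real part. -/
def atIInfty (n : ℕ) : Filter (Matrix (Fin n) (Fin n) ℂ) :=
  ⨅ c : ℝ, 𝓟 {τ | τ ∈ halfSpace n ∧ (τ.map Complex.im - c • 1).PosSemidef}

/-- An integral matrix, viewed as a complex one. -/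
def toC (M : Matrix (Fin n) (Fin n) ℤ) : Matrix (Fin n) (Fin n) ℂ := M.map (Int.cast : ℤ → ℂ)

/-- `Cτ + D`. -/
def denom (γ : Sp n) (τ : Matrix (Fin n) (Fin n) ℂ) : Matrix (Fin n) (Fin n) ℂ :=
  toC (blkC γ) * τ + toC (blkD γ)

/-- `Aτ + B`. -/
def num (γ : Sp n) (τ : Matrix (Fin n) (Fin n) ℂ) : Matrix (Fin n) (Fin n) ℂ :=
  toC (blkA γ) * τ + toC (blkB γ)

/-- The weight `k` slash operator
`(F|γ)(τ) = det(Cτ + D)⁻ᵏ F((Aτ + B)(Cτ + D)⁻¹)`. Functions on the half-space are represented by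
functions on all complex matrices, of which only the values on the half-space matter: the
half-space is stable under `τ ↦ (Aτ + B)(Cτ + D)⁻¹`, and `Cτ + D` is invertible on it. -/
noncomputable def slash (k : ℕ) (F : Matrix (Fin n) (Fin n) ℂ → ℂ) (γ : Sp n)
    (τ : Matrix (Fin n) (Fin n) ℂ) : ℂ :=
  (denom γ τ).det ^ (-(k : ℤ)) * F (num γ τ * (denom γ τ)⁻¹)

/-- The right cosets `Γ_∞⁺ δ` contained in `Γ_∞⁺ Γ(N)`. -/
def starCosets (n N : ℕ) : Set (Quotient (QuotientGroup.rightRel (GamInfPlus n))) :=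
  (fun δ : Sp n => (Quotient.mk'' δ : Quotient (QuotientGroup.rightRel (GamInfPlus n)))) ''
    ((GamInfPlus n : Set (Sp n)) * (Gam n N : Set (Sp n)))

/-- `𝔼*(τ) = ∑_{δ*} 1(τ)|δ*`, the Eisenstein series for `Γ(N)`, where `δ*` runs over
representatives of the cosets in `Γ_∞⁺ \ Γ_∞⁺ Γ(N)`. -/
noncomputable def eisStar (N k : ℕ) (τ : Matrix (Fin n) (Fin n) ℂ) : ℂ :=
  ∑' q : starCosets n N, slash k (fun _ => 1) q.1.out τ

/-- `χ(δ)`, meaning `χ(det D)`. -/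
noncomputable def chi {N : ℕ} (χ : DirichletCharacter ℂ N) (δ : Sp n) : ℂ :=
  χ (((blkD δ).det : ℤ) : ZMod N)

/-- `𝔼'_γ = ∑_{δ, δ'} χ̄(δδ') 𝔼*|γδ'δ`, where `δ` runs over representatives of
`Γ_γ⁺ \ Γ₀(N)` and `δ'` over representatives of `Γ(N) \ Γ_γ⁺` (finite sets). -/
noncomputable def eisPrime {N : ℕ} (k : ℕ) (χ : DirichletCharacter ℂ N) (γ : Sp n)
    (τ : Matrix (Fin n) (Fin n) ℂ) : ℂ :=
  ∑' q : Quotient (QuotientGroup.rightRel ((StabPlus N γ).subgroupOf (Gam0 n N))),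
    ∑' q' : Quotient (QuotientGroup.rightRel ((Gam n N).subgroupOf (StabPlus N γ))),
      (starRingEnd ℂ) (chi χ ((q.out : Sp n) * (q'.out : Sp n))) *
        slash k (eisStar N k) (γ * (q'.out : Sp n) * (q.out : Sp n)) τ

/-- The Siegel Eisenstein series `𝔼_γ = [Γ_γ : Γ(N)]⁻¹ 𝔼'_γ` of weight `k` and character `χ`
on `Γ₀(N)`. -/
noncomputable def eis {N : ℕ} (k : ℕ) (χ : DirichletCharacter ℂ N) (γ : Sp n)
    (τ : Matrix (Fin n) (Fin n) ℂ) : ℂ :=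
  (((Gam n N).relIndex (Stab N γ) : ℕ) : ℂ)⁻¹ * eisPrime k χ γ τ

end SiegelEisenstein

/-! Since Γ(N) is normal, `𝔼_γ|α⁻¹` is a multiple of the finite sum, over x in Γ₀(N)/Γ(N), of χ̄(x)
times the series of det(Cτ+D)⁻ᵏ over the Γ_∞⁺-cosets in Γ_∞⁺Γ(N)γxα⁻¹ (`slash_eis`). As τ → i∞ a
term with C ≠ 0 tends to 0, and a term with C = 0 is the constant det(D)ᵏ. Once limit and sum are
exchanged (`tendsto_cosetSum`), only those x with γxα⁻¹ ∈ Γ(N)Γ_∞ matter. There are none if α ∉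
Γ_∞γΓ₀(N), which is (a). If α = βγδ', they are the x = yδ' with y ∈ Γ_γ; modulo Γ(N) there are [Γ_γ
: Γ(N)] of them, and all contribute equally (`sum_twist_mul_cosetLimit`).

The contributions are equal because 𝔼_γ does not vanish: if γb = pgγ with b ∈ Γ₀(N), p ∈ Γ_∞, g ∈
Γ(N), then substituting bx for x multiplies the sum by χ̄(b)det(D_p)ᵏ, so this factor is 1
(`conj_chi_mul_eq_one`). For N ≤ 2 the matrix diag(-1,1,…,1) gives an element of Γ(N); hence k is
even and both signs of det D occur in the constant term, which explains the value 2. For N > 2 only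
one sign occurs and the limit is χ̄(δ')det(D_β)ᵏ. Rewriting the last factor as χ̄(β) requires one b
∈ Γ_∞ with det D_b = -1 whose p also has det D_p = -1 (`exists_det_neg_one_mul_eq`). It comes from a
reflection modulo N adapted to the symmetric matrix D⁻¹C (after a translation making D invertible),
built over each ℤ/pᵉ, glued, and lifted to ℤ.

The exchange is dominated convergence. The series has period N in Re τ, so Re τ may be taken
bounded, and there |det(Cτ+D)| is at least a constant times |det(Ci+D)|. It remains that
∑|det(Ci+D)|⁻ᵏ converges for k > n+1 (`summable_absDet`). Right multiplication by some (1 0; t 1)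
with 0 ≤ t ≤ n reduces this to det C ≠ 0, where |det(Ci+D)| = |det C||det(C⁻¹D+i)|. Finitely many
C⁻¹D have a common denominator M, so they are S/M with S integral symmetric, and |det C| is at least
the size of the column space of S modulo M. The sum then splits into one over residues of S
(`sum_card_colSpace_le`) and one over a shifted lattice (`exists_tsum_detAddI_le`). Both are bounded
uniformly by induction on n, bordering a symmetric matrix by one row and column. -/

namespace SiegelEisenstein

set_option linter.unusedSectionVars false

/-! ### Bordered symmetric matrices. -/

section Border

variable {n : ℕ} {α : Type*}

/-- The matrix with corner entry `s`, the vector `v` along the rest of the first row and column,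
and `S` as the remaining block. -/
def border (s : α) (v : Fin n → α) (S : Matrix (Fin n) (Fin n) α) :
    Matrix (Fin (n + 1)) (Fin (n + 1)) α :=
  Matrix.of (Fin.cons (Fin.cons s v) (fun i => Fin.cons (v i) (S i)))

@[simp] theorem border_zero_zero (s : α) (v : Fin n → α) (S : Matrix (Fin n) (Fin n) α) :
    border s v S 0 0 = s := rfl

@[simp] theorem border_zero_succ (s : α) (v : Fin n → α) (S : Matrix (Fin n) (Fin n) α)
    (j : Fin n) : border s v S 0 j.succ = v j := rfl

@[simp] theorem border_succ_zero (s : α) (v : Fin n → α) (S : Matrix (Fin n) (Fin n) α)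
    (i : Fin n) : border s v S i.succ 0 = v i := rfl

@[simp] theorem border_succ_succ (s : α) (v : Fin n → α) (S : Matrix (Fin n) (Fin n) α)
    (i j : Fin n) : border s v S i.succ j.succ = S i j := rfl

theorem border_isSymm {s : α} {v : Fin n → α} {S : Matrix (Fin n) (Fin n) α} (hS : S.IsSymm) :
    (border s v S).IsSymm := by
  ext i j
  refine Fin.cases ?_ (fun i => ?_) i <;> refine Fin.cases ?_ (fun j => ?_) j <;>
    simp [Matrix.transpose_apply, hS.apply]

theorem border_mulVec_cons [CommSemiring α] (s t : α) (v w : Fin n → α)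
    (S : Matrix (Fin n) (Fin n) α) :
    border s v S *ᵥ (Fin.cons t w : Fin (n + 1) → α)
      = Fin.cons (s * t + v ⬝ᵥ w) (t • v + S *ᵥ w) := by
  ext i
  refine Fin.cases ?_ (fun i => ?_) i <;>
    simp [Matrix.mulVec, dotProduct, Fin.sum_univ_succ, mul_comm]

/-- Symmetric matrices of size `n`. -/
abbrev SymMat (n : ℕ) (α : Type*) : Type _ := {S : Matrix (Fin n) (Fin n) α // S.IsSymm}

/-- A symmetric matrix of size `n + 1` is given by its lower block, its first row and its
corner. -/
def symMatSuccEquiv (n : ℕ) (α : Type*) :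
    SymMat n α × (Fin n → α) × α ≃ SymMat (n + 1) α where
  toFun x := ⟨border x.2.2 x.2.1 x.1.1, border_isSymm x.1.2⟩
  invFun S := ⟨⟨fun i j => S.1 i.succ j.succ, by ext i j; exact S.2.apply _ _⟩,
    fun j => S.1 0 j.succ, S.1 0 0⟩
  left_inv x := rfl
  right_inv S := by
    ext i j
    refine Fin.cases ?_ (fun i => ?_) i <;> refine Fin.cases ?_ (fun j => ?_) j <;> try rfl
    exact S.2.apply _ _

theorem symMatSuccEquiv_apply_val {n : ℕ} {α : Type*} (x : SymMat n α × (Fin n → α) × α) :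
    (symMatSuccEquiv n α x).1 = border x.2.2 x.2.1 x.1.1 := rfl

end Border

/-! ### Counting in finite abelian groups. -/

section Finite

variable {A B : Type*} [AddCommGroup A] [AddCommGroup B] [Finite A] [Finite B]

theorem card_eq_card_map_mul_card_inf_ker (f : A →+ B) (H : AddSubgroup A) :
    Nat.card H = Nat.card (H.map f) * Nat.card (H ⊓ f.ker : AddSubgroup A) := by
  have h1 := AddSubgroup.card_eq_card_quotient_mul_card_addSubgroup (f.comp H.subtype).ker
  rw [h1]
  congr 1
  · rw [Nat.card_congr (QuotientAddGroup.quotientKerEquivRange (f.comp H.subtype)).toEquiv,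
      AddMonoidHom.range_comp, AddSubgroup.range_subtype]
  · refine Nat.card_congr ⟨fun x => ⟨x.1.1, x.1.2, x.2⟩, fun x => ⟨⟨x.1, x.2.1⟩, x.2.2⟩,
      fun x => rfl, fun x => rfl⟩

/-- `P` contains all the cosets of `H` through multiples of `x`. -/
theorem card_mul_addOrderOf_le {H P : AddSubgroup A} (hHP : H ≤ P) {x : A} (hx : x ∈ P) :
    Nat.card H * addOrderOf (QuotientAddGroup.mk x : A ⧸ H) ≤ Nat.card P := by
  rw [card_eq_card_map_mul_card_inf_ker (QuotientAddGroup.mk' H) P, QuotientAddGroup.ker_mk',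
    inf_eq_right.2 hHP, mul_comm]
  refine Nat.mul_le_mul_right _ ?_
  rw [← Nat.card_zmultiples]
  refine Nat.card_mono (Set.toFinite _) ?_
  have : AddSubgroup.zmultiples (QuotientAddGroup.mk x : A ⧸ H) ≤ P.map (QuotientAddGroup.mk' H) := by
    rw [AddSubgroup.zmultiples_le]
    exact ⟨x, hx, rfl⟩
  exact this

/-- A preimage under multiplication by `q`, whose kernel is the `q`-torsion. -/
theorem card_nsmul_mem_le (q : ℕ) (H : AddSubgroup A) :
    Nat.card {x : A // q • x ∈ H} ≤ Nat.card {x : A // q • x = 0} * Nat.card H := by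
  have h := card_eq_card_map_mul_card_inf_ker (nsmulAddMonoidHom (α := A) q)
    (H.comap (nsmulAddMonoidHom q))
  have e1 : Nat.card (H.comap (nsmulAddMonoidHom (α := A) q)) = Nat.card {x : A // q • x ∈ H} := rfl
  rw [e1] at h
  rw [h, mul_comm]
  refine Nat.mul_le_mul ?_ ?_
  · refine Nat.card_mono (Set.toFinite {x : A | q • x = 0}) ?_
    intro x hx
    exact hx.2
  · exact Nat.card_mono (Set.toFinite _) (AddSubgroup.map_comap_le _ _)

theorem card_le_of_sub_mem {p : A → Prop} {d : A → Prop} (h : ∀ x y, p x → p y → d (x - y)) :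
    Nat.card {x // p x} ≤ Nat.card {x // d x} := by
  by_cases hne : Nonempty {x // p x}
  · obtain ⟨y, hy⟩ := hne
    refine Nat.card_le_card_of_injective (fun x => ⟨x.1 - y, h _ _ x.2 hy⟩) ?_
    intro a b hab
    simpa [Subtype.ext_iff] using hab
  · rw [not_nonempty_iff] at hne
    simp

end Finite

/-- The value `ζ(2)`, as a bound for sums over finite fibres. -/
noncomputable def zetaTwo : ℝ := ∑' j : ℕ, 1 / (j : ℝ) ^ 2

theorem summable_one_div_sq : Summable fun j : ℕ => 1 / (j : ℝ) ^ 2 :=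
  Real.summable_one_div_nat_pow.2 (by norm_num)

theorem zetaTwo_nonneg : 0 ≤ zetaTwo := tsum_nonneg fun _ => by positivity

/-- Serves to group a sum by the value of an order: a fibre count that leaves `j⁻²` to spare costs
one factor `ζ(2)`. The term `j = 0` of `zetaTwo` is `1 / 0 = 0`. -/
theorem sum_le_of_fiber_card {X : Type*} [Fintype X] (g : X → ℕ) (hg : ∀ x, 1 ≤ g x)
    (f : ℕ → ℝ) (K : ℝ) (hK : 0 ≤ K)
    (h : ∀ j, 1 ≤ j → (Nat.card {x // g x = j} : ℝ) * f j ≤ K * (1 / (j : ℝ) ^ 2)) :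
    ∑ x, f (g x) ≤ K * zetaTwo := by
  classical
  rw [← Finset.sum_fiberwise_of_maps_to (t := Finset.univ.image g) (g := g)
    (fun x _ => Finset.mem_image_of_mem _ (Finset.mem_univ x))]
  calc ∑ j ∈ Finset.univ.image g, ∑ x with g x = j, f (g x)
      ≤ ∑ j ∈ Finset.univ.image g, K * (1 / (j : ℝ) ^ 2) := by
        refine Finset.sum_le_sum fun j hj => ?_
        obtain ⟨x, -, rfl⟩ := Finset.mem_image.1 hj
        refine le_trans (le_of_eq ?_) (h _ (hg x))
        rw [Finset.sum_congr rfl (fun y hy => by rw [(Finset.mem_filter.1 hy).2]),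
          Finset.sum_const, nsmul_eq_mul, Nat.card_eq_fintype_card, Fintype.card_subtype]
    _ = K * ∑ j ∈ Finset.univ.image g, 1 / (j : ℝ) ^ 2 := by rw [Finset.mul_sum]
    _ ≤ K * zetaTwo :=
        mul_le_mul_of_nonneg_left
          (summable_one_div_sq.sum_le_tsum _ (fun _ _ => by positivity)) hK

/-! ### The sum over symmetric matrices modulo `M`. -/

section Arithmetic

variable {n M : ℕ} [NeZero M]

/-- The column space of a matrix modulo `M`. -/
def colSpace (S : Matrix (Fin n) (Fin n) (ZMod M)) : AddSubgroup (Fin n → ZMod M) :=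
  S.mulVecLin.toAddMonoidHom.range

/-- The kernel of a matrix modulo `M`. -/
def nullSpace (S : Matrix (Fin n) (Fin n) (ZMod M)) : AddSubgroup (Fin n → ZMod M) :=
  S.mulVecLin.toAddMonoidHom.ker

theorem mem_colSpace {S : Matrix (Fin n) (Fin n) (ZMod M)} {u : Fin n → ZMod M} :
    u ∈ colSpace S ↔ ∃ w, S *ᵥ w = u := Iff.rfl

theorem mem_nullSpace {S : Matrix (Fin n) (Fin n) (ZMod M)} {u : Fin n → ZMod M} :
    u ∈ nullSpace S ↔ S *ᵥ u = 0 := Iff.rfl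

theorem card_colSpace_pos (S : Matrix (Fin n) (Fin n) (ZMod M)) : 0 < Nat.card (colSpace S) :=
  Nat.card_pos

theorem symm_dotProduct {R : Type*} [CommRing R] {S : Matrix (Fin n) (Fin n) R} (hS : S.IsSymm)
    (u w : Fin n → R) : (S *ᵥ u) ⬝ᵥ w = u ⬝ᵥ (S *ᵥ w) := by
  rw [dotProduct_mulVec, ← mulVec_transpose, hS.eq]

/-- The annihilator of the kernel of a symmetric matrix modulo `M` is its column space. -/
theorem mem_colSpace_of_forall {S : Matrix (Fin n) (Fin n) (ZMod M)} (hS : S.IsSymm)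
    {u : Fin n → ZMod M} (hu : ∀ w ∈ nullSpace S, u ⬝ᵥ w = 0) : u ∈ colSpace S := by
  classical
  let P : AddSubgroup (Fin n → ZMod M) :=
    { carrier := {u | ∀ w ∈ nullSpace S, u ⬝ᵥ w = 0}
      zero_mem' := fun w _ => zero_dotProduct w
      add_mem' := fun {a b} ha hb w hw => by rw [add_dotProduct, ha w hw, hb w hw, add_zero]
      neg_mem' := fun {a} ha w hw => by rw [neg_dotProduct, ha w hw, neg_zero] }
  have hle : colSpace S ≤ P := by
    rintro _ ⟨w, rfl⟩ z hz
    change (S *ᵥ w) ⬝ᵥ z = 0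
    rw [symm_dotProduct hS, mem_nullSpace.1 hz, dotProduct_zero]
  have hc1 : Nat.card ((Fin n → ZMod M) ⧸ nullSpace S) = Nat.card (colSpace S) :=
    Nat.card_congr (QuotientAddGroup.quotientKerEquivRange S.mulVecLin.toAddMonoidHom).toEquiv
  -- `u ↦ stdAddChar (u ⬝ᵥ ·)` embeds `P` in the character group of `(ℤ/M)ⁿ` modulo the kernel of
  -- `S`, and a finite abelian group has as many characters as elements. With `hc1` this forces
  -- `colSpace S = P`.
  have hc2 : Nat.card P ≤ Nat.card ((Fin n → ZMod M) ⧸ nullSpace S) := by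
    have : Fintype ((Fin n → ZMod M) ⧸ nullSpace S) := Fintype.ofFinite _
    rw [Nat.card_eq_fintype_card (α := (Fin n → ZMod M) ⧸ nullSpace S),
      ← AddChar.card_eq, ← Nat.card_eq_fintype_card]
    let D : P → (Fin n → ZMod M) →+ ZMod M := fun u =>
      { toFun := fun w => u.1 ⬝ᵥ w, map_zero' := dotProduct_zero _, map_add' := dotProduct_add _ }
    refine Nat.card_le_card_of_injective (fun u =>
      (ZMod.stdAddChar (N := M)).compAddMonoidHom
        (QuotientAddGroup.lift (nullSpace S) (D u) (fun w hw => u.2 w hw))) ?_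
    intro a b hab
    ext i
    have := DFunLike.congr_fun hab (QuotientAddGroup.mk (Pi.single i 1))
    have : a.1 ⬝ᵥ Pi.single i 1 = b.1 ⬝ᵥ Pi.single i 1 := ZMod.injective_stdAddChar this
    simpa using this
  have : colSpace S = P := AddSubgroup.eq_of_le_of_card_ge hle (hc2.trans hc1.le)
  rw [this]
  exact hu

theorem card_nsmul_eq_zero_le {q : ℕ} (hq : 0 < q) :
    Nat.card {x : ZMod M // q • x = 0} ≤ q := by
  classical
  have := IsAddCyclic.card_nsmul_eq_zero_le (α := ZMod M) hq
  rwa [Nat.card_eq_fintype_card, Fintype.card_subtype]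

theorem card_pi_nsmul_eq_zero_le {q : ℕ} (hq : 0 < q) :
    Nat.card {x : Fin n → ZMod M // q • x = 0} ≤ q ^ n := by
  calc Nat.card {x : Fin n → ZMod M // q • x = 0}
      ≤ Nat.card (Fin n → {x : ZMod M // q • x = 0}) := by
        refine Nat.card_le_card_of_injective
          (fun x i => ⟨x.1 i, congrFun x.2 i⟩) ?_
        intro a b hab
        ext i
        exact congrArg Subtype.val (congrFun hab i)
    _ = Nat.card {x : ZMod M // q • x = 0} ^ n := by
        rw [Nat.card_fun]; simp
    _ ≤ q ^ n := Nat.pow_le_pow_left (card_nsmul_eq_zero_le hq) n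

/-- The order of `v` modulo the column space of `S`. -/
noncomputable def rowOrder (S : Matrix (Fin n) (Fin n) (ZMod M)) (v : Fin n → ZMod M) : ℕ :=
  addOrderOf (QuotientAddGroup.mk v : (Fin n → ZMod M) ⧸ colSpace S)

theorem rowOrder_pos (S : Matrix (Fin n) (Fin n) (ZMod M)) (v : Fin n → ZMod M) :
    0 < rowOrder S v := addOrderOf_pos _

theorem rowOrder_nsmul_mem (S : Matrix (Fin n) (Fin n) (ZMod M)) (v : Fin n → ZMod M) :
    rowOrder S v • v ∈ colSpace S := by
  rw [← QuotientAddGroup.eq_zero_iff, QuotientAddGroup.mk_nsmul]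
  exact addOrderOf_nsmul_eq_zero _

/-- A vector which `S` maps to `-q v`, where `q` is the order of `v` modulo the columns of `S`. -/
noncomputable def rowLift (S : Matrix (Fin n) (Fin n) (ZMod M)) (v : Fin n → ZMod M) :
    Fin n → ZMod M :=
  (mem_colSpace.1 (neg_mem (rowOrder_nsmul_mem S v))).choose

theorem mulVec_rowLift (S : Matrix (Fin n) (Fin n) (ZMod M)) (v : Fin n → ZMod M) :
    S *ᵥ rowLift S v = -(rowOrder S v • v) :=
  (mem_colSpace.1 (neg_mem (rowOrder_nsmul_mem S v))).choose_spec

/-- The values on the kernel of `S` of the linear form given by `v`. -/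
def rowValues (S : Matrix (Fin n) (Fin n) (ZMod M)) (v : Fin n → ZMod M) :
    AddSubgroup (ZMod M) :=
  (nullSpace S).map
    ({ toFun := fun w => v ⬝ᵥ w, map_zero' := dotProduct_zero _, map_add' := dotProduct_add _ } :
      (Fin n → ZMod M) →+ ZMod M)

theorem mem_rowValues {S : Matrix (Fin n) (Fin n) (ZMod M)} {v : Fin n → ZMod M} {x : ZMod M} :
    x ∈ rowValues S v ↔ ∃ w, S *ᵥ w = 0 ∧ v ⬝ᵥ w = x := Iff.rfl

/-- The order of the group `rowValues S v` kills every `v ⬝ᵥ w` with `S w = 0`; that multiple of `v`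
annihilates the kernel of `S`, so by duality it lies in the column space. -/
theorem rowOrder_le_card_rowValues {S : Matrix (Fin n) (Fin n) (ZMod M)} (hS : S.IsSymm)
    (v : Fin n → ZMod M) : rowOrder S v ≤ Nat.card (rowValues S v) := by
  refine Nat.le_of_dvd Nat.card_pos ?_
  rw [rowOrder, addOrderOf_dvd_iff_nsmul_eq_zero, ← QuotientAddGroup.mk_nsmul,
    QuotientAddGroup.eq_zero_iff]
  refine mem_colSpace_of_forall hS fun w hw => ?_
  rw [smul_dotProduct]
  have h : v ⬝ᵥ w ∈ rowValues S v := mem_rowValues.2 ⟨w, hw, rfl⟩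
  have := card_nsmul_eq_zero' (G := rowValues S v) (x := ⟨_, h⟩)
  exact congrArg Subtype.val this

theorem nsmul_eq_zero_of_mem_rowValues {S : Matrix (Fin n) (Fin n) (ZMod M)} (hS : S.IsSymm)
    {v : Fin n → ZMod M} {x : ZMod M} (hx : x ∈ rowValues S v) : rowOrder S v • x = 0 := by
  obtain ⟨w, hw, rfl⟩ := mem_rowValues.1 hx
  obtain ⟨z, hz⟩ := mem_colSpace.1 (rowOrder_nsmul_mem S v)
  rw [← smul_dotProduct, ← hz, symm_dotProduct hS, hw, dotProduct_zero]

/-- The order of the corner of a bordered matrix relative to the rest. -/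
noncomputable def cornerOrder (S : Matrix (Fin n) (Fin n) (ZMod M)) (v : Fin n → ZMod M)
    (s : ZMod M) : ℕ :=
  addOrderOf (QuotientAddGroup.mk (v ⬝ᵥ rowLift S v + rowOrder S v • s) : ZMod M ⧸ rowValues S v)

theorem cornerOrder_pos (S : Matrix (Fin n) (Fin n) (ZMod M)) (v : Fin n → ZMod M) (s : ZMod M) :
    0 < cornerOrder S v s := addOrderOf_pos _

/-- Drop the first coordinate. The image contains the columns of `S` and also `v`, which gives the
first two factors. The kernel contains, in the corner, `rowValues S v` (take `t = 0` and `S w = 0`)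
and the value from `t = rowOrder S v`, `w = rowLift S v`, whose order modulo `rowValues S v` is
`cornerOrder S v s`. -/
theorem card_colSpace_border_ge {S : Matrix (Fin n) (Fin n) (ZMod M)} (hS : S.IsSymm)
    (v : Fin n → ZMod M) (s : ZMod M) :
    Nat.card (colSpace S) * rowOrder S v * (rowOrder S v * cornerOrder S v s)
      ≤ Nat.card (colSpace (border s v S)) := by
  let tl : (Fin (n + 1) → ZMod M) →+ (Fin n → ZMod M) :=
    { toFun := fun x i => x i.succ, map_zero' := rfl, map_add' := fun _ _ => rfl }
  have hmem : ∀ t w, (Fin.cons (s * t + v ⬝ᵥ w) (t • v + S *ᵥ w) : Fin (n + 1) → ZMod M)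
      ∈ colSpace (border s v S) := fun t w => ⟨Fin.cons t w, border_mulVec_cons s t v w S⟩
  rw [card_eq_card_map_mul_card_inf_ker tl (colSpace (border s v S))]
  refine Nat.mul_le_mul ?_ ?_
  · refine card_mul_addOrderOf_le ?_ ?_
    · rintro _ ⟨w, rfl⟩
      refine ⟨_, hmem 0 w, ?_⟩
      ext i
      simp [tl]
    · refine ⟨_, hmem 1 0, ?_⟩
      ext i
      simp [tl]
  · let P : AddSubgroup (ZMod M) := (colSpace (border s v S) ⊓ tl.ker).map
      (Pi.evalAddMonoidHom (fun _ : Fin (n + 1) => ZMod M) 0)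
    have hP : Nat.card P ≤ Nat.card (colSpace (border s v S) ⊓ tl.ker :
        AddSubgroup (Fin (n + 1) → ZMod M)) :=
      Nat.card_le_card_of_surjective _ (AddMonoidHom.addSubgroupMap_surjective _ _)
    refine le_trans ?_ hP
    refine le_trans (Nat.mul_le_mul_right _ (rowOrder_le_card_rowValues hS v))
      (card_mul_addOrderOf_le ?_ ?_)
    · intro x hx
      obtain ⟨w, hw, rfl⟩ := mem_rowValues.1 hx
      refine ⟨_, ⟨hmem 0 w, ?_⟩, ?_⟩
      · ext i
        simp [tl, hw]
      · simp
    · refine ⟨_, ⟨hmem (rowOrder S v : ZMod M) (rowLift S v), ?_⟩, ?_⟩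
      · ext i
        simp [tl, mulVec_rowLift]
      · simp [mul_comm, add_comm]

theorem card_rowOrder_eq_le (S : Matrix (Fin n) (Fin n) (ZMod M)) {q : ℕ} (hq : 0 < q) :
    Nat.card {v // rowOrder S v = q} ≤ q ^ n * Nat.card (colSpace S) := by
  calc Nat.card {v // rowOrder S v = q} ≤ Nat.card {v // q • v ∈ colSpace S} := by
        refine Nat.card_mono (Set.toFinite {v | q • v ∈ colSpace S}) ?_
        rintro v rfl
        exact rowOrder_nsmul_mem S v
    _ ≤ _ := card_nsmul_mem_le q _
    _ ≤ _ := Nat.mul_le_mul_right _ (card_pi_nsmul_eq_zero_le hq)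

/-- Two corners of order `q'` differ by an element killed by `rowOrder * q' * rowOrder`: one factor
`rowOrder` is the coefficient of `s` in `cornerOrder`, the other kills `rowValues S v`. -/
theorem card_cornerOrder_eq_le {S : Matrix (Fin n) (Fin n) (ZMod M)} (hS : S.IsSymm)
    (v : Fin n → ZMod M) {q' : ℕ} (hq : 0 < q') :
    Nat.card {s // cornerOrder S v s = q'} ≤ rowOrder S v * (q' * rowOrder S v) := by
  refine le_trans (card_le_of_sub_mem
    (d := fun s => (rowOrder S v * (q' * rowOrder S v)) • s = 0) ?_)
    (card_nsmul_eq_zero_le (Nat.mul_pos (rowOrder_pos S v) (Nat.mul_pos hq (rowOrder_pos S v))))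
  have key : ∀ s, cornerOrder S v s = q' →
      q' • (v ⬝ᵥ rowLift S v + rowOrder S v • s) ∈ rowValues S v := by
    rintro s rfl
    rw [← QuotientAddGroup.eq_zero_iff, QuotientAddGroup.mk_nsmul]
    exact addOrderOf_nsmul_eq_zero _
  intro x y hx hy
  have h := nsmul_eq_zero_of_mem_rowValues hS (sub_mem (key x hx) (key y hy))
  rw [← h, mul_smul, mul_smul, ← smul_sub q', add_sub_add_left_eq_sub, ← smul_sub]

/-- The local factor sum `∑_S |im S|⁻ᵏ` over symmetric matrices modulo `M` is bounded
independently of `M`. -/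
theorem sum_card_colSpace_le (n k : ℕ) (hk : n + 2 ≤ k) (M : ℕ) [NeZero M] :
    ∑ S : SymMat n (ZMod M), ((Nat.card (colSpace S.1) : ℝ)⁻¹) ^ k ≤ zetaTwo ^ (2 * n) := by
  classical
  induction n generalizing k with
  | zero =>
    have : Subsingleton (SymMat 0 (ZMod M)) := ⟨fun a b => Subtype.ext (Subsingleton.elim _ _)⟩
    have h1 : Fintype.card (SymMat 0 (ZMod M)) ≤ 1 := Fintype.card_le_one_iff_subsingleton.2 this
    calc ∑ S : SymMat 0 (ZMod M), ((Nat.card (colSpace S.1) : ℝ)⁻¹) ^ k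
        ≤ ∑ S : SymMat 0 (ZMod M), 1 := by
          refine Finset.sum_le_sum fun S _ => pow_le_one₀ (by positivity) ?_
          refine inv_le_one_of_one_le₀ ?_
          exact_mod_cast card_colSpace_pos S.1
      _ ≤ zetaTwo ^ (2 * 0) := by
          simp only [Finset.sum_const, Finset.card_univ, nsmul_eq_mul, mul_one, mul_zero, pow_zero]
          exact_mod_cast h1
  | succ n ih =>
    -- Let `c`, `q`, `j` be the column count of the block, the row order and the corner order. The
    -- bordered count is at least `c q² j`, while at most `q² j` corners and `qⁿ c` rows have the
    -- given order. Summing over corners leaves `ζ(2) c^{-(k+1)} q^{-2k}` (as `k ≥ 2`), then over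
    -- rows `ζ(2)² c^{-k}` (as `2k ≥ n + 2`). One power of `c` is spent, so the exponent drops by
    -- one together with `n`.
    obtain ⟨k, rfl⟩ : ∃ k', k = k' + 1 := ⟨k - 1, by omega⟩
    rw [← (symMatSuccEquiv n (ZMod M)).sum_comp, Fintype.sum_prod_type]
    have key : ∀ S : SymMat n (ZMod M),
        ∑ x : (Fin n → ZMod M) × ZMod M,
          ((Nat.card (colSpace (border x.2 x.1 S.1)) : ℝ)⁻¹) ^ (k + 1)
        ≤ zetaTwo ^ 2 * ((Nat.card (colSpace S.1) : ℝ)⁻¹) ^ k := by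
      intro S
      have hc : (1 : ℝ) ≤ (Nat.card (colSpace S.1) : ℝ) := by exact_mod_cast card_colSpace_pos S.1
      set c : ℝ := (Nat.card (colSpace S.1) : ℝ) with hcdef
      have hc0 : 0 < c := by linarith
      rw [Fintype.sum_prod_type]
      have inner : ∀ v : Fin n → ZMod M,
          ∑ s, ((Nat.card (colSpace (border s v S.1)) : ℝ)⁻¹) ^ (k + 1)
          ≤ zetaTwo * (c⁻¹ ^ (k + 1) * (rowOrder S.1 v : ℝ)⁻¹ ^ (2 * k)) := by
        intro v
        have hq : (1 : ℝ) ≤ (rowOrder S.1 v : ℝ) := by exact_mod_cast rowOrder_pos S.1 v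
        set q : ℝ := (rowOrder S.1 v : ℝ) with hqdef
        have hq0 : 0 < q := by linarith
        rw [mul_comm]
        refine le_trans (Finset.sum_le_sum
          (g := fun s => (fun j : ℕ => (c * q * (q * j))⁻¹ ^ (k + 1)) (cornerOrder S.1 v s))
          fun s _ => ?_)
          (sum_le_of_fiber_card (cornerOrder S.1 v) (cornerOrder_pos S.1 v)
            (fun j : ℕ => (c * q * (q * j))⁻¹ ^ (k + 1)) (c⁻¹ ^ (k + 1) * q⁻¹ ^ (2 * k)) (by positivity) ?_)
        · have h0 : (0 : ℝ) < cornerOrder S.1 v s := by exact_mod_cast cornerOrder_pos S.1 v s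
          refine pow_le_pow_left₀ (by positivity) (inv_anti₀ (by positivity) ?_) _
          have := card_colSpace_border_ge S.2 v s
          rw [hcdef, hqdef]
          exact_mod_cast this
        · intro j hj
          have hj' : (1 : ℝ) ≤ j := by exact_mod_cast hj
          have hj0 : (0 : ℝ) < j := by linarith
          have h1 : (Nat.card {s // cornerOrder S.1 v s = j} : ℝ) ≤ q * (j * q) := by
            rw [hqdef]; exact_mod_cast card_cornerOrder_eq_le S.2 v hj
          refine le_trans (mul_le_mul_of_nonneg_right h1 (by positivity)) ?_
          obtain ⟨l, rfl⟩ : ∃ l, k = l + 2 := ⟨k - 2, by omega⟩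
          have e : q * (j * q) * (c * q * (q * j))⁻¹ ^ (l + 2 + 1)
              = c⁻¹ ^ (l + 2 + 1) * q⁻¹ ^ (2 * (l + 2)) * (1 / (j : ℝ) ^ 2) * (j : ℝ)⁻¹ ^ l := by
            simp only [inv_pow]
            field_simp
            ring
          rw [e]
          exact mul_le_of_le_one_right (by positivity)
            (pow_le_one₀ (by positivity) (inv_le_one_of_one_le₀ hj'))
      refine (Finset.sum_le_sum fun v _ => inner v).trans ?_
      rw [← Finset.mul_sum, ← Finset.mul_sum, pow_two, mul_assoc]
      refine mul_le_mul_of_nonneg_left ?_ zetaTwo_nonneg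
      have h2 := sum_le_of_fiber_card (rowOrder S.1) (rowOrder_pos S.1)
        (fun j => (j : ℝ)⁻¹ ^ (2 * k)) c hc0.le (by
          intro j hj
          have hj' : (1 : ℝ) ≤ j := by exact_mod_cast hj
          have hj0 : (0 : ℝ) < j := by linarith
          have h1 : (Nat.card {v // rowOrder S.1 v = j} : ℝ) ≤ j ^ n * c := by
            rw [hcdef]; exact_mod_cast card_rowOrder_eq_le S.1 hj
          refine le_trans (mul_le_mul_of_nonneg_right h1 (by positivity)) ?_
          obtain ⟨l, hl⟩ : ∃ l, 2 * k = n + 2 + l := ⟨2 * k - n - 2, by omega⟩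
          have e : (j : ℝ) ^ n * c * (j : ℝ)⁻¹ ^ (n + 2 + l)
              = c * (1 / (j : ℝ) ^ 2) * (j : ℝ)⁻¹ ^ l := by
            rw [pow_add, pow_add, inv_pow, inv_pow]; field_simp
          rw [hl, e]
          exact mul_le_of_le_one_right (by positivity)
            (pow_le_one₀ (by positivity) (inv_le_one_of_one_le₀ hj')))
      refine (mul_le_mul_of_nonneg_left h2 (by positivity)).trans (le_of_eq ?_)
      rw [pow_succ]
      field_simp
    refine (Finset.sum_le_sum fun S _ => key S).trans ?_
    rw [← Finset.mul_sum]
    refine (mul_le_mul_of_nonneg_left (ih k (by omega)) (sq_nonneg _)).trans (le_of_eq ?_)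
    ring

end Arithmetic

section Border

variable {n : ℕ}

/-- The Schur complement of `S`, with the corner moved to the last place. -/
theorem det_border {K : Type*} [Field K] (s : K) (v : Fin n → K) (S : Matrix (Fin n) (Fin n) K)
    (hS : IsUnit S.det) : (border s v S).det = S.det * (s - v ⬝ᵥ (S⁻¹ *ᵥ v)) := by
  let e : Fin (n + 1) ≃ Fin n ⊕ PUnit.{1} := (finSuccEquiv n).trans (Equiv.optionEquivSumPUnit _)
  have h : border s v S = (fromBlocks S (Matrix.of fun i (_ : PUnit.{1}) => v i)
      (Matrix.of fun (_ : PUnit.{1}) i => v i) (Matrix.of fun _ _ => s)).submatrix e e := by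
    ext i j
    refine Fin.cases ?_ (fun i => ?_) i <;> refine Fin.cases ?_ (fun j => ?_) j <;> simp [e]
  have := S.invertibleOfIsUnitDet hS
  rw [h, det_submatrix_equiv_self, det_fromBlocks₁₁, invOf_eq_nonsing_inv, Matrix.mul_assoc]
  congr 1
  rw [det_unique]
  rfl

end Border

/-! ### The determinant of `X + i` for real symmetric `X`. -/

section RealSymmetric

variable {n : ℕ}

theorem exists_eq_transpose_mul_self {A : Matrix (Fin n) (Fin n) ℝ} (hA : A.PosSemidef) :
    ∃ B : Matrix (Fin n) (Fin n) ℝ, A = Bᵀ * B := by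
  open scoped MatrixOrder in
  obtain ⟨B, hB⟩ := CStarAlgebra.nonneg_iff_eq_star_mul_self.mp hA.nonneg
  exact ⟨B, by rw [hB, star_eq_conjTranspose, conjTranspose_eq_transpose_of_trivial]⟩

/-- `det (X + i)` for a real matrix `X`. -/
noncomputable def detAddI (X : Matrix (Fin n) (Fin n) ℝ) : ℂ :=
  (X.map Complex.ofRealHom + Complex.I • (1 : Matrix (Fin n) (Fin n) ℂ)).det

theorem posDef_one_add_sq {X : Matrix (Fin n) (Fin n) ℝ} (hX : X.IsSymm) :
    (1 + X * X).PosDef := by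
  refine Matrix.PosDef.one.add_posSemidef ?_
  have := posSemidef_conjTranspose_mul_self X
  rwa [conjTranspose_eq_transpose_of_trivial, hX.eq] at this

theorem mul_add_I_sub_I (X : Matrix (Fin n) (Fin n) ℝ) :
    (X.map Complex.ofRealHom + Complex.I • (1 : Matrix (Fin n) (Fin n) ℂ))
      * (X.map Complex.ofRealHom - Complex.I • (1 : Matrix (Fin n) (Fin n) ℂ))
      = (1 + X * X).map Complex.ofRealHom := by
  rw [Matrix.add_mul, Matrix.mul_sub, Matrix.mul_sub, ← Matrix.map_mul,
    Matrix.map_add _ (by simp), Matrix.map_one _ (by simp) (by simp)]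
  simp only [Matrix.smul_mul, Matrix.mul_smul, Matrix.one_mul, Matrix.mul_one, smul_smul,
    Complex.I_mul_I, neg_smul, one_smul]
  abel

theorem norm_detAddI_sq (X : Matrix (Fin n) (Fin n) ℝ) :
    ‖detAddI X‖ ^ 2 = |(1 + X * X).det| := by
  have h := congrArg Matrix.det (mul_add_I_sub_I X)
  have h2 : (X.map Complex.ofRealHom - Complex.I • (1 : Matrix (Fin n) (Fin n) ℂ)).det
      = star (detAddI X) := by
    rw [detAddI, ← starRingEnd_apply, RingHom.map_det]
    congr 1
    ext i j
    by_cases hij : i = j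
    · subst hij
      simp [RingHom.mapMatrix_apply, sub_eq_add_neg]
    · simp [RingHom.mapMatrix_apply, hij]
  rw [det_mul, h2] at h
  have h3 := congrArg norm h
  rw [norm_mul, norm_star] at h3
  rw [pow_two]
  refine h3.trans ?_
  rw [← RingHom.mapMatrix_apply, ← RingHom.map_det]
  exact Complex.norm_real _

theorem norm_detAddI_pos {X : Matrix (Fin n) (Fin n) ℝ} (hX : X.IsSymm) : 0 < ‖detAddI X‖ := by
  have h := norm_detAddI_sq X
  have := abs_pos.2 (posDef_one_add_sq hX).det_pos.ne'
  rw [← h] at this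
  exact (norm_nonneg _).lt_of_ne fun h0 => by simp [← h0] at this

/-- The positive definite matrix `(1 + X²)⁻¹`. -/
noncomputable def invSq (X : Matrix (Fin n) (Fin n) ℝ) : Matrix (Fin n) (Fin n) ℝ :=
  (1 + X * X)⁻¹

theorem posDef_invSq {X : Matrix (Fin n) (Fin n) ℝ} (hX : X.IsSymm) : (invSq X).PosDef :=
  (posDef_one_add_sq hX).inv

theorem det_invSq {X : Matrix (Fin n) (Fin n) ℝ} (hX : X.IsSymm) :
    (invSq X).det = (‖detAddI X‖ ^ 2)⁻¹ := by
  rw [norm_detAddI_sq, abs_of_pos (posDef_one_add_sq hX).det_pos, invSq, det_nonsing_inv,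
    Ring.inverse_eq_inv']

/-- With `y = (1 + X²)⁻¹u` one has `u·u - u·y = |Xy|² + |X²y|²`. -/
theorem dotProduct_invSq_le {X : Matrix (Fin n) (Fin n) ℝ} (hX : X.IsSymm) (u : Fin n → ℝ) :
    u ⬝ᵥ (invSq X *ᵥ u) ≤ u ⬝ᵥ u := by
  set y := invSq X *ᵥ u with hy
  have hu : u = (1 + X * X) *ᵥ y := by
    rw [hy, mulVec_mulVec, invSq, mul_nonsing_inv _ (posDef_one_add_sq hX).det_pos.ne'.isUnit,
      one_mulVec]
  have e : u = y + X *ᵥ (X *ᵥ y) := by rw [mulVec_mulVec, hu, add_mulVec, one_mulVec]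
  have h1 : u ⬝ᵥ u - u ⬝ᵥ y
      = (X *ᵥ y) ⬝ᵥ (X *ᵥ y) + (X *ᵥ (X *ᵥ y)) ⬝ᵥ (X *ᵥ (X *ᵥ y)) := by
    rw [← dotProduct_sub]
    nth_rewrite 2 [e]
    rw [add_sub_cancel_left, e, add_dotProduct, ← symm_dotProduct hX y]
  have h2 : ∀ w : Fin n → ℝ, 0 ≤ w ⬝ᵥ w := fun w =>
    Finset.sum_nonneg fun i _ => mul_self_nonneg _
  have := h2 (X *ᵥ y)
  have := h2 (X *ᵥ (X *ᵥ y))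
  linarith

/-- Schur complement with `(X + i)⁻¹ = (X - i)(1 + X²)⁻¹`. The corner `x` enters only through the
real part, and the imaginary part is at least `1`, so the sum over `x` becomes one-dimensional. -/
theorem detAddI_border {X : Matrix (Fin n) (Fin n) ℝ} (hX : X.IsSymm) (x : ℝ) (y : Fin n → ℝ) :
    detAddI (border x y X) = detAddI X *
      (((x - y ⬝ᵥ ((X * invSq X) *ᵥ y) : ℝ) : ℂ)
        + ((1 + y ⬝ᵥ (invSq X *ᵥ y) : ℝ) : ℂ) * Complex.I) := by
  have hQ := (posDef_one_add_sq hX).det_pos.ne'.isUnit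
  set P := X.map Complex.ofRealHom + Complex.I • (1 : Matrix (Fin n) (Fin n) ℂ) with hP
  have hdet : IsUnit P.det := by
    have := norm_detAddI_pos hX
    exact (norm_pos_iff.1 this).isUnit
  have hb : (border x y X).map Complex.ofRealHom
      + Complex.I • (1 : Matrix (Fin (n + 1)) (Fin (n + 1)) ℂ)
      = border ((x : ℂ) + Complex.I) (fun i => (y i : ℂ)) P := by
    ext i j
    refine Fin.cases ?_ (fun i => ?_) i <;> refine Fin.cases ?_ (fun j => ?_) j <;>
      simp [hP, Matrix.one_apply, Fin.succ_ne_zero, (Fin.succ_ne_zero _).symm]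
  have hinv : P⁻¹ = (X * invSq X).map Complex.ofRealHom
      - Complex.I • (invSq X).map Complex.ofRealHom := by
    refine inv_eq_right_inv ?_
    have : (X * invSq X).map Complex.ofRealHom - Complex.I • (invSq X).map Complex.ofRealHom
        = (X.map Complex.ofRealHom - Complex.I • (1 : Matrix (Fin n) (Fin n) ℂ))
          * (invSq X).map Complex.ofRealHom := by
      rw [Matrix.sub_mul, Matrix.map_mul, Matrix.smul_mul, Matrix.one_mul]
    rw [this, ← Matrix.mul_assoc, mul_add_I_sub_I, ← Matrix.map_mul, invSq,
      mul_nonsing_inv _ hQ, Matrix.map_one _ (by simp) (by simp)]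
  have hcast : ∀ Z : Matrix (Fin n) (Fin n) ℝ,
      (fun i => (y i : ℂ)) ⬝ᵥ (Z.map Complex.ofRealHom *ᵥ (fun i => (y i : ℂ)))
        = ((y ⬝ᵥ (Z *ᵥ y) : ℝ) : ℂ) := by
    intro Z
    simp [dotProduct, mulVec]
  rw [detAddI, hb, det_border _ _ _ hdet, hinv, sub_mulVec, smul_mulVec, dotProduct_sub,
    dotProduct_smul, hcast, hcast]
  change detAddI X * _ = _
  congr 1
  push_cast
  rw [smul_eq_mul]
  ring

end RealSymmetric

/-! ### Lattice sums bounded uniformly in the shift. -/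

section Archimedean

open MeasureTheory
open scoped ENNReal

/-- Comparison with a telescoping series: `(j + w)(j + 1 + w) ≤ 2(j + w)² ≤ 4(j² + w²)` because `w ≥
1`. -/
theorem tsum_nat_inv_sq_add_sq_le {w : ℝ} (hw : 1 ≤ w) :
    ∑' j : ℕ, ENNReal.ofReal (((j : ℝ) ^ 2 + w ^ 2)⁻¹) ≤ ENNReal.ofReal (4 / w) := by
  refine ENNReal.tsum_le_of_sum_range_le fun m => ?_
  rw [← ENNReal.ofReal_sum_of_nonneg fun _ _ => by positivity]
  refine ENNReal.ofReal_le_ofReal ?_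
  calc ∑ j ∈ Finset.range m, ((j : ℝ) ^ 2 + w ^ 2)⁻¹
      ≤ ∑ j ∈ Finset.range m, (4 / ((j : ℝ) + w) - 4 / (((j + 1 : ℕ) : ℝ) + w)) := by
        refine Finset.sum_le_sum fun j _ => ?_
        have hj : (0 : ℝ) ≤ j := Nat.cast_nonneg j
        push_cast
        rw [div_sub_div _ _ (by positivity) (by positivity), inv_eq_one_div,
          div_le_div_iff₀ (by positivity) (by positivity)]
        nlinarith [sq_nonneg ((j : ℝ) - w)]
    _ = 4 / w - 4 / ((m : ℝ) + w) := by
        rw [Finset.sum_range_sub' (fun j : ℕ => 4 / ((j : ℝ) + w))]; simp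
    _ ≤ 4 / w := by
        have : (0 : ℝ) ≤ 4 / ((m : ℝ) + w) := by positivity
        linarith

theorem tsum_int_inv_sq_add_sq_le {w : ℝ} (hw : 1 ≤ w) (c : ℝ) :
    ∑' x : ℤ, ENNReal.ofReal ((((x : ℝ) - c) ^ 2 + w ^ 2)⁻¹) ≤ ENNReal.ofReal (8 / w) := by
  -- Counting up from `⌈c⌉` and down from `⌊c⌋`, the `j`-th integer is at distance at least `j` from
  -- `c`. An integral `c` is counted twice, which is harmless for an upper bound.
  let f : ℕ ⊕ ℕ → ℤ := Sum.elim (fun j => ⌈c⌉ + j) (fun j => ⌊c⌋ - j)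
  have hf : Function.Surjective f := by
    intro x
    rcases le_total c x with h | h
    · have := Int.ceil_le.2 h
      exact ⟨Sum.inl (x - ⌈c⌉).toNat, by simp [f]; omega⟩
    · have := Int.le_floor.2 h
      exact ⟨Sum.inr (⌊c⌋ - x).toNat, by simp [f]; omega⟩
  refine (ENNReal.tsum_le_tsum_comp_of_surjective hf _).trans ?_
  rw [ENNReal.summable.tsum_sum ENNReal.summable]
  have e : ENNReal.ofReal (8 / w) = ENNReal.ofReal (4 / w) + ENNReal.ofReal (4 / w) := by
    rw [← ENNReal.ofReal_add (by positivity) (by positivity)]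
    congr 1
    ring
  rw [e]
  refine add_le_add ((ENNReal.tsum_le_tsum fun j => ?_).trans (tsum_nat_inv_sq_add_sq_le hw))
    ((ENNReal.tsum_le_tsum fun j => ?_).trans (tsum_nat_inv_sq_add_sq_le hw)) <;>
  · refine ENNReal.ofReal_le_ofReal (inv_anti₀ (by positivity) ?_)
    have hj : (0 : ℝ) ≤ j := Nat.cast_nonneg j
    have h1 := Int.le_ceil c
    have h2 := Int.floor_le c
    simp only [f, Sum.elim_inl, Sum.elim_inr]
    push_cast
    nlinarith

/-- The norm is at least `w`, which handles `k` of the powers; the remaining two are summed over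
`x`. -/
theorem tsum_int_norm_inv_pow_le {w : ℝ} (hw : 1 ≤ w) (c : ℝ) (k : ℕ) :
    ∑' x : ℤ, ENNReal.ofReal (‖((x - c : ℝ) : ℂ) + (w : ℂ) * Complex.I‖⁻¹ ^ (k + 2))
      ≤ ENNReal.ofReal (8 * w⁻¹ ^ (k + 1)) := by
  have hw0 : 0 < w := by linarith
  have e : ENNReal.ofReal (8 * w⁻¹ ^ (k + 1))
      = ENNReal.ofReal (w⁻¹ ^ k) * ENNReal.ofReal (8 / w) := by
    rw [← ENNReal.ofReal_mul (by positivity)]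
    congr 1
    rw [pow_succ, div_eq_mul_inv]
    ring
  rw [e]
  refine le_trans ?_ (mul_le_mul_right (tsum_int_inv_sq_add_sq_le hw c) _)
  rw [← ENNReal.tsum_mul_left]
  refine ENNReal.tsum_le_tsum fun x => ?_
  rw [← ENNReal.ofReal_mul (by positivity)]
  refine ENNReal.ofReal_le_ofReal ?_
  have h1 : ‖((x - c : ℝ) : ℂ) + (w : ℂ) * Complex.I‖ ^ 2 = ((x : ℝ) - c) ^ 2 + w ^ 2 := by
    rw [← Complex.normSq_eq_norm_sq, Complex.normSq_add_mul_I]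
  have h2 : w ≤ ‖((x - c : ℝ) : ℂ) + (w : ℂ) * Complex.I‖ := by
    refine le_of_sq_le_sq ?_ (norm_nonneg _)
    rw [h1]
    nlinarith [sq_nonneg ((x : ℝ) - c)]
  rw [pow_add, inv_pow _ 2, h1]
  exact mul_le_mul_of_nonneg_right (pow_le_pow_left₀ (by positivity) (inv_anti₀ hw0 h2) k)
    (by positivity)

/-- A sum over a shifted integral lattice is bounded by an integral, if the values on each
lattice cube are at least a fixed proportion of the value at the corner. -/
theorem tsum_le_lintegral {n : ℕ} (f : (Fin n → ℝ) → ℝ≥0∞) (K : ℝ≥0∞) (hK : K ≠ ⊤)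
    (h : Fin n → ℝ)
    (hf : ∀ y u : Fin n → ℝ, (∀ i, 0 ≤ u i ∧ u i ≤ 1) → f y ≤ K * f (y + u)) :
    ∑' v : Fin n → ℤ, f (fun i => h i + v i) ≤ K * ∫⁻ y, f y := by
  let E : (Fin n → ℤ) → Set (Fin n → ℝ) := fun v =>
    Set.pi Set.univ fun i => Set.Ico (h i + v i) (h i + v i + 1)
  have hE : ∀ v, MeasurableSet (E v) := fun v =>
    MeasurableSet.univ_pi fun i => measurableSet_Ico
  have hvol : ∀ v, volume (E v) = 1 := by
    intro v
    rw [Real.volume_pi_Ico]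
    simp
  have hd : Pairwise (Function.onFun Disjoint E) := by
    intro v v' hne
    refine Set.disjoint_left.2 fun y hy hy' => hne ?_
    ext i
    have h1 := hy i trivial
    have h2 := hy' i trivial
    have h3 : ⌊y i - h i⌋ = v i := Int.floor_eq_iff.2 ⟨by linarith [h1.1], by linarith [h1.2]⟩
    have h4 : ⌊y i - h i⌋ = v' i := Int.floor_eq_iff.2 ⟨by linarith [h2.1], by linarith [h2.2]⟩
    rw [← h3, h4]
  calc ∑' v : Fin n → ℤ, f (fun i => h i + v i)
      = ∑' v : Fin n → ℤ, ∫⁻ _ in E v, f (fun i => h i + v i) := by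
        simp [hvol]
    _ ≤ ∑' v : Fin n → ℤ, ∫⁻ y in E v, K * f y := by
        refine ENNReal.tsum_le_tsum fun v => setLIntegral_mono' (hE v) fun y hy => ?_
        have := hf (fun i => h i + v i) (fun i => y i - (h i + v i)) (fun i => by
          have := hy i trivial
          exact ⟨by linarith [this.1], by linarith [this.2]⟩)
        refine this.trans (le_of_eq ?_)
        congr 2
        ext i
        simp
    _ = ∫⁻ y in ⋃ v, E v, K * f y := (lintegral_iUnion hE hd _).symm
    _ ≤ ∫⁻ y, K * f y := setLIntegral_le_lintegral _ _
    _ = K * ∫⁻ y, f y := lintegral_const_mul' _ _ hK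

theorem lintegral_inv_one_add_norm_sq_lt_top {n s : ℕ} (hs : n < 2 * s) :
    ∫⁻ y : Fin n → ℝ, ENNReal.ofReal ((1 + y ⬝ᵥ y)⁻¹ ^ s) < ⊤ := by
  have hint : Integrable (fun y : Fin n → ℝ => ((1 : ℝ) + ‖y‖ ^ 2) ^ (-((2 * s : ℕ) : ℝ) / 2)) :=
    integrable_rpow_neg_one_add_norm_sq (by simpa using (by exact_mod_cast hs))
  refine lt_of_le_of_lt (lintegral_mono fun y => ENNReal.ofReal_le_ofReal ?_)
    hint.lintegral_lt_top
  have e : ((1 : ℝ) + ‖y‖ ^ 2) ^ (-((2 * s : ℕ) : ℝ) / 2) = (1 + ‖y‖ ^ 2)⁻¹ ^ s := by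
    have : (-((2 * s : ℕ) : ℝ) / 2) = -(s : ℝ) := by push_cast; ring
    rw [this, Real.rpow_neg (by positivity), Real.rpow_natCast, inv_pow]
  rw [e]
  refine pow_le_pow_left₀ ?_ (inv_anti₀ (by positivity) ?_) _
  · have : 0 ≤ y ⬝ᵥ y := Finset.sum_nonneg fun i _ => mul_self_nonneg _
    positivity
  · have h0 : 0 ≤ y ⬝ᵥ y := Finset.sum_nonneg fun i _ => mul_self_nonneg _
    have : ‖y‖ ≤ Real.sqrt (y ⬝ᵥ y) := by
      refine (pi_norm_le_iff_of_nonneg (Real.sqrt_nonneg _)).2 fun i => ?_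
      refine Real.le_sqrt_of_sq_le ?_
      rw [Real.norm_eq_abs, sq_abs, pow_two]
      exact Finset.single_le_sum (f := fun i => y i * y i) (fun i _ => mul_self_nonneg _)
        (Finset.mem_univ i)
    have h2 := pow_le_pow_left₀ (norm_nonneg y) this 2
    rw [Real.sq_sqrt h0] at h2
    linarith

/-- Substitute `y ↦ By` with `A = BᵀB`, whose Jacobian is `|det B| = (det A)^{1/2}`. -/
theorem lintegral_quadratic_form {n s : ℕ} {A : Matrix (Fin n) (Fin n) ℝ} (hA : A.PosDef) :
    ∫⁻ y : Fin n → ℝ, ENNReal.ofReal ((1 + y ⬝ᵥ (A *ᵥ y))⁻¹ ^ s)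
      = ENNReal.ofReal (Real.sqrt A.det)⁻¹
        * ∫⁻ y : Fin n → ℝ, ENNReal.ofReal ((1 + y ⬝ᵥ y)⁻¹ ^ s) := by
  obtain ⟨B, hB⟩ := exists_eq_transpose_mul_self hA.posSemidef
  have hdet : A.det = B.det ^ 2 := by rw [hB, det_mul, det_transpose, pow_two]
  have hB0 : B.det ≠ 0 := by
    intro h
    have := hA.det_pos
    rw [hdet, h] at this
    simp at this
  have hmap := Real.map_matrix_volume_pi_eq_smul_volume_pi hB0
  have hm : Measurable fun y : Fin n → ℝ => ENNReal.ofReal ((1 + y ⬝ᵥ y)⁻¹ ^ s) := by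
    unfold dotProduct
    fun_prop
  have hlin : Measurable (toLin' B) := by
    exact (LinearMap.continuous_of_finiteDimensional _).measurable
  have h := lintegral_map (μ := volume) hm hlin
  rw [hmap, lintegral_smul_measure] at h
  rw [hdet, Real.sqrt_sq_eq_abs, ← abs_inv, ← smul_eq_mul, h]
  refine lintegral_congr fun y => ?_
  rw [hB, ← mulVec_mulVec, dotProduct_mulVec, vecMul_transpose, toLin'_apply]

/-- A bound for lattice sums of negative powers of `1 + yᵀAy` which is uniform in the shift and
in the positive definite matrix `A ≤ 1`, up to the factor `(det A)^{-1/2}`. -/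
theorem exists_tsum_quadratic_form_le {n s : ℕ} (hs : n < 2 * s) :
    ∃ C : ℝ≥0∞, C ≠ ⊤ ∧ ∀ (A : Matrix (Fin n) (Fin n) ℝ), A.PosDef →
      (∀ u, u ⬝ᵥ (A *ᵥ u) ≤ u ⬝ᵥ u) → ∀ h : Fin n → ℝ,
      ∑' v : Fin n → ℤ, ENNReal.ofReal
        ((1 + (fun i => h i + v i) ⬝ᵥ (A *ᵥ (fun i => h i + v i)))⁻¹ ^ s)
        ≤ C * ENNReal.ofReal (Real.sqrt A.det)⁻¹ := by
  refine ⟨ENNReal.ofReal ((2 + 2 * n) ^ s) *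
    ∫⁻ y : Fin n → ℝ, ENNReal.ofReal ((1 + y ⬝ᵥ y)⁻¹ ^ s),
    ENNReal.mul_ne_top ENNReal.ofReal_ne_top (lintegral_inv_one_add_norm_sq_lt_top hs).ne, ?_⟩
  intro A hA hA1 h
  rw [mul_assoc, mul_comm (lintegral _ _), ← lintegral_quadratic_form hA]
  refine tsum_le_lintegral (fun y => ENNReal.ofReal ((1 + y ⬝ᵥ (A *ᵥ y))⁻¹ ^ s)) _
    ENNReal.ofReal_ne_top h ?_
  intro y u hu
  have hsym : A.IsSymm := by
    have := hA.1
    rwa [IsHermitian, conjTranspose_eq_transpose_of_trivial] at this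
  have hq : ∀ z, 0 ≤ z ⬝ᵥ (A *ᵥ z) := fun z => by
    simpa using hA.posSemidef.dotProduct_mulVec_nonneg z
  rw [← ENNReal.ofReal_mul (by positivity), ← mul_pow]
  refine ENNReal.ofReal_le_ofReal (pow_le_pow_left₀ (inv_nonneg.2 (by linarith [hq y])) ?_ _)
  have h1 := hq y
  have h2 := hq (y + u)
  have h3 := hq (y - u)
  have huu : u ⬝ᵥ (A *ᵥ u) ≤ n := by
    refine (hA1 u).trans ?_
    calc u ⬝ᵥ u ≤ ∑ _i : Fin n, (1 : ℝ) :=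
          Finset.sum_le_sum fun i _ => mul_le_one₀ (hu i).2 (hu i).1 (hu i).2
      _ = n := by simp
  -- By the parallelogram law `Q(y+u) ≤ 2Q(y) + 2Q(u) ≤ 2Q(y) + 2n`, since `A ≤ 1` and `u` is in the
  -- unit cube. This is the origin of the constant `2 + 2n`.
  have e2 : (y + u) ⬝ᵥ (A *ᵥ (y + u)) + (y - u) ⬝ᵥ (A *ᵥ (y - u))
      = 2 * (y ⬝ᵥ (A *ᵥ y)) + 2 * (u ⬝ᵥ (A *ᵥ u)) := by
    simp only [mulVec_add, mulVec_sub, dotProduct_add, dotProduct_sub, add_dotProduct,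
      sub_dotProduct]
    ring
  have hn : (0 : ℝ) ≤ n := Nat.cast_nonneg n
  rw [← div_eq_mul_inv, inv_eq_one_div, div_le_div_iff₀ (by linarith) (by linarith)]
  nlinarith [mul_nonneg hn h1]

/-- The lattice sums `∑_T |det (R + T + i)|⁻ᵏ` over integral symmetric `T` are bounded uniformly
in the real symmetric matrix `R`. -/
theorem exists_tsum_detAddI_le (n k : ℕ) (hk : n + 2 ≤ k) :
    ∃ C : ℝ≥0∞, C ≠ ⊤ ∧ ∀ R : SymMat n ℝ,
      ∑' T : SymMat n ℤ,
        ENNReal.ofReal (‖detAddI (R.1 + T.1.map (Int.cast : ℤ → ℝ))‖⁻¹ ^ k) ≤ C := by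
  induction n generalizing k with
  | zero =>
    refine ⟨1, ENNReal.one_ne_top, fun R => ?_⟩
    have : Unique (SymMat 0 ℤ) :=
      ⟨⟨⟨0, Subsingleton.elim _ _⟩⟩, fun a => Subtype.ext (Subsingleton.elim _ _)⟩
    rw [tsum_eq_single default fun b hb => (hb (Subsingleton.elim _ _)).elim]
    simp [detAddI]
  | succ n ih =>
    -- The sum over the corner leaves `|det(X+i)|^{-(k+2)}` and `(1 + yᵀ(1+X²)⁻¹y)^{-(k+1)}`. The
    -- sum over the row then costs `det(1+X²)^{1/2} = |det(X+i)|`, so the block is summed with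
    -- exponent `k + 1`.
    obtain ⟨k, rfl⟩ : ∃ k', k = k' + 2 := ⟨k - 2, by omega⟩
    obtain ⟨C₁, hC₁, h₁⟩ := ih (k + 1) (by omega)
    obtain ⟨C₂, hC₂, h₂⟩ := exists_tsum_quadratic_form_le (n := n) (s := k + 1) (by omega)
    refine ⟨ENNReal.ofReal 8 * C₂ * C₁,
      ENNReal.mul_ne_top (ENNReal.mul_ne_top ENNReal.ofReal_ne_top hC₂) hC₁, fun R => ?_⟩
    obtain ⟨⟨R, h, r⟩, rfl⟩ := (symMatSuccEquiv n ℝ).surjective R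
    rw [← (symMatSuccEquiv n ℤ).tsum_eq, ENNReal.tsum_prod']
    refine le_trans ?_ (mul_le_mul_right (h₁ R) _)
    rw [← ENNReal.tsum_mul_left]
    refine ENNReal.tsum_le_tsum fun T => ?_
    rw [ENNReal.tsum_prod']
    set X : Matrix (Fin n) (Fin n) ℝ := R.1 + T.1.map (Int.cast : ℤ → ℝ) with hXdef
    have hX : X.IsSymm := R.2.add (T.2.map _)
    have hd := norm_detAddI_pos hX
    have hq : ∀ z, 0 ≤ z ⬝ᵥ (invSq X *ᵥ z) := fun z => by
      simpa using (posDef_invSq hX).posSemidef.dotProduct_mulVec_nonneg z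
    have inner : ∀ v : Fin n → ℤ,
        ∑' x : ℤ, ENNReal.ofReal (‖detAddI (((symMatSuccEquiv n ℝ) (R, h, r)).1
            + ((symMatSuccEquiv n ℤ) (T, v, x)).1.map (Int.cast : ℤ → ℝ))‖⁻¹ ^ (k + 2))
        ≤ ENNReal.ofReal (‖detAddI X‖⁻¹ ^ (k + 2)) * (ENNReal.ofReal 8 * ENNReal.ofReal
          ((1 + (fun i => h i + v i) ⬝ᵥ (invSq X *ᵥ (fun i => h i + v i)))⁻¹ ^ (k + 1))) := by
      intro v
      set y : Fin n → ℝ := fun i => h i + v i with hy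
      have hb : ∀ x : ℤ, ((symMatSuccEquiv n ℝ) (R, h, r)).1
            + ((symMatSuccEquiv n ℤ) (T, v, x)).1.map (Int.cast : ℤ → ℝ)
          = border (r + x) y X := by
        intro x
        ext i j
        refine Fin.cases ?_ (fun i => ?_) i <;> refine Fin.cases ?_ (fun j => ?_) j <;>
          simp [symMatSuccEquiv_apply_val, hXdef, hy]
      have hw : 1 ≤ 1 + y ⬝ᵥ (invSq X *ᵥ y) := by linarith [hq y]
      rw [← ENNReal.ofReal_mul (by norm_num : (0 : ℝ) ≤ 8)]
      refine le_trans ?_ (mul_le_mul_right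
        (tsum_int_norm_inv_pow_le hw (y ⬝ᵥ ((X * invSq X) *ᵥ y) - r) k) _)
      rw [← ENNReal.tsum_mul_left]
      refine ENNReal.tsum_le_tsum fun x => ?_
      rw [hb, detAddI_border hX, norm_mul, mul_inv, mul_pow,
        ENNReal.ofReal_mul (by positivity)]
      refine le_of_eq ?_
      congr 6
      push_cast
      ring
    refine (ENNReal.tsum_le_tsum inner).trans ?_
    rw [ENNReal.tsum_mul_left, ENNReal.tsum_mul_left]
    refine (mul_le_mul_right (mul_le_mul_right
      (h₂ (invSq X) (posDef_invSq hX) (dotProduct_invSq_le hX) h) _) _).trans (le_of_eq ?_)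
    have e : (Real.sqrt (invSq X).det)⁻¹ = ‖detAddI X‖ := by
      rw [det_invSq hX, Real.sqrt_inv, inv_inv, Real.sqrt_sq hd.le]
    rw [e]
    have e2 : ENNReal.ofReal (‖detAddI X‖⁻¹ ^ (k + 1))
        = ENNReal.ofReal (‖detAddI X‖⁻¹ ^ (k + 2)) * ENNReal.ofReal ‖detAddI X‖ := by
      rw [← ENNReal.ofReal_mul (by positivity)]
      congr 1
      rw [pow_succ _ (k + 1), mul_assoc, inv_mul_cancel₀ hd.ne', mul_one]
    rw [e2]
    ring

end Archimedean

/-! ### Block identities in the symplectic group. -/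

section Blocks

variable {n : ℕ}

theorem fromBlocks_blk (γ : Sp n) : fromBlocks (blkA γ) (blkB γ) (blkC γ) (blkD γ) = γ.1 :=
  fromBlocks_toBlocks γ.1

theorem blkA_mul (γ δ : Sp n) : blkA (γ * δ) = blkA γ * blkA δ + blkB γ * blkC δ := by
  ext i j
  simp [blkA, blkB, blkC, toBlocks₁₁, toBlocks₁₂, toBlocks₂₁, Matrix.mul_apply]

theorem blkB_mul (γ δ : Sp n) : blkB (γ * δ) = blkA γ * blkB δ + blkB γ * blkD δ := by
  ext i j
  simp [blkA, blkB, blkD, toBlocks₁₁, toBlocks₁₂, toBlocks₂₂, Matrix.mul_apply]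

theorem blkA_inv (γ : Sp n) : blkA γ⁻¹ = (blkD γ)ᵀ := by
  have h : (γ⁻¹ : Sp n).1 = (-J (Fin n) ℤ) * γ.1ᵀ * J (Fin n) ℤ := rfl
  unfold blkA blkD
  rw [h, ← fromBlocks_toBlocks γ.1]
  simp [J, fromBlocks_transpose, fromBlocks_neg, fromBlocks_multiply]

theorem blkB_inv (γ : Sp n) : blkB γ⁻¹ = -(blkB γ)ᵀ := by
  have h : (γ⁻¹ : Sp n).1 = (-J (Fin n) ℤ) * γ.1ᵀ * J (Fin n) ℤ := rfl
  unfold blkB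
  rw [h, ← fromBlocks_toBlocks γ.1]
  simp [J, fromBlocks_transpose, fromBlocks_neg, fromBlocks_multiply]

theorem blkD_inv (γ : Sp n) : blkD γ⁻¹ = (blkA γ)ᵀ := by
  have h : (γ⁻¹ : Sp n).1 = (-J (Fin n) ℤ) * γ.1ᵀ * J (Fin n) ℤ := rfl
  unfold blkA blkD
  rw [h, ← fromBlocks_toBlocks γ.1]
  simp [J, fromBlocks_transpose, fromBlocks_neg, fromBlocks_multiply]

theorem blk_relations (γ : Sp n) : blkA γ * (blkB γ)ᵀ = blkB γ * (blkA γ)ᵀ ∧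
    blkC γ * (blkD γ)ᵀ = blkD γ * (blkC γ)ᵀ ∧ blkA γ * (blkD γ)ᵀ - blkB γ * (blkC γ)ᵀ = 1 := by
  have h := γ.2
  rw [← fromBlocks_blk γ] at h
  exact (mem_symplecticGroup_iff _ _ _ _).1 h

theorem blkC_mul_blkD_transpose (γ : Sp n) :
    blkC γ * (blkD γ)ᵀ = blkD γ * (blkC γ)ᵀ := (blk_relations γ).2.1

theorem blkD_mul_blkA_transpose_sub (γ : Sp n) :
    blkD γ * (blkA γ)ᵀ - blkC γ * (blkB γ)ᵀ = 1 := by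
  have h := congrArg Matrix.transpose (blk_relations γ).2.2
  simpa [transpose_sub, transpose_mul] using h

theorem blkC_mul_inv (γ δ : Sp n) :
    blkC (γ * δ⁻¹) = blkC γ * (blkD δ)ᵀ - blkD γ * (blkC δ)ᵀ := by
  rw [blkC_mul, blkA_inv, blkC_inv, Matrix.mul_neg, sub_eq_add_neg]

theorem mem_GamInf {γ : Sp n} : γ ∈ GamInf n ↔ blkC γ = 0 := Iff.rfl

theorem blkC_mul_of_mem {p : Sp n} (hp : p ∈ GamInf n) (δ : Sp n) :
    blkC (p * δ) = blkD p * blkC δ := by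
  rw [blkC_mul, mem_GamInf.1 hp, Matrix.zero_mul, zero_add]

theorem blkD_mul_of_mem {p : Sp n} (hp : p ∈ GamInf n) (δ : Sp n) :
    blkD (p * δ) = blkD p * blkD δ := by
  rw [blkD_mul, mem_GamInf.1 hp, Matrix.zero_mul, zero_add]

theorem det_blkD_mul {p : Sp n} (hp : p ∈ GamInf n) (δ : Sp n) :
    (blkD (p * δ)).det = (blkD p).det * (blkD δ).det := by
  rw [blkD_mul_of_mem hp, det_mul]

theorem det_blkD_isUnit {p : Sp n} (hp : p ∈ GamInf n) : IsUnit (blkD p).det := by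
  have h := det_blkD_mul hp p⁻¹
  rw [mul_inv_cancel, blkD_one, det_one] at h
  exact IsUnit.of_mul_eq_one _ h.symm

theorem det_blkD_eq {p : Sp n} (hp : p ∈ GamInf n) :
    (blkD p).det = 1 ∨ (blkD p).det = -1 := Int.isUnit_iff.1 (det_blkD_isUnit hp)

end Blocks

section ToC

variable {n : ℕ}

theorem toC_eq (M : Matrix (Fin n) (Fin n) ℤ) : toC M = (Int.castRingHom ℂ).mapMatrix M := rfl

theorem toC_mul (M M' : Matrix (Fin n) (Fin n) ℤ) : toC (M * M') = toC M * toC M' := by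
  simp only [toC_eq, map_mul]

theorem toC_add (M M' : Matrix (Fin n) (Fin n) ℤ) : toC (M + M') = toC M + toC M' := by
  simp only [toC_eq, map_add]

theorem toC_sub (M M' : Matrix (Fin n) (Fin n) ℤ) : toC (M - M') = toC M - toC M' := by
  simp only [toC_eq, map_sub]

theorem toC_smul (m : ℤ) (M : Matrix (Fin n) (Fin n) ℤ) : toC (m • M) = (m : ℂ) • toC M := by
  ext i j
  exact Int.cast_mul _ _

theorem toC_zero : toC (0 : Matrix (Fin n) (Fin n) ℤ) = 0 := by simp only [toC_eq, map_zero]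

theorem toC_one : toC (1 : Matrix (Fin n) (Fin n) ℤ) = 1 := by simp only [toC_eq, map_one]

theorem det_toC (M : Matrix (Fin n) (Fin n) ℤ) : (toC M).det = (M.det : ℂ) := by
  rw [toC_eq, ← RingHom.map_det]
  rfl

theorem toC_conjTranspose (M : Matrix (Fin n) (Fin n) ℤ) : (toC M)ᴴ = toC Mᵀ := by
  ext i j
  simp [toC]

theorem toC_eq_zero_iff {M : Matrix (Fin n) (Fin n) ℤ} : toC M = 0 ↔ M = 0 := by
  refine ⟨fun h => ?_, fun h => by rw [h, toC_zero]⟩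
  ext i j
  have := congrFun (congrFun h i) j
  simpa [toC] using this

end ToC

/-! ### The factor `Cτ + D` on the half-space. -/

section Denom

open scoped ComplexOrder

variable {n : ℕ}

theorem denom_mul (γ δ : Sp n) (τ : Matrix (Fin n) (Fin n) ℂ) :
    denom (γ * δ) τ = toC (blkC γ) * num δ τ + toC (blkD γ) * denom δ τ := by
  simp only [denom, num, blkC_mul, blkD_mul, toC_add, toC_mul, Matrix.mul_add, Matrix.add_mul,
    Matrix.mul_assoc]
  abel

theorem num_mul (γ δ : Sp n) (τ : Matrix (Fin n) (Fin n) ℂ) :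
    num (γ * δ) τ = toC (blkA γ) * num δ τ + toC (blkB γ) * denom δ τ := by
  simp only [denom, num, blkA_mul, blkB_mul, toC_add, toC_mul, Matrix.mul_add, Matrix.add_mul,
    Matrix.mul_assoc]
  abel

theorem denom_mul_of_isUnit (γ δ : Sp n) {τ : Matrix (Fin n) (Fin n) ℂ}
    (h : IsUnit (denom δ τ).det) :
    denom γ (num δ τ * (denom δ τ)⁻¹) * denom δ τ = denom (γ * δ) τ := by
  rw [denom_mul, denom, Matrix.add_mul, ← Matrix.mul_assoc, Matrix.mul_assoc _ _ (denom δ τ),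
    nonsing_inv_mul _ h, Matrix.mul_one]

theorem num_mul_of_isUnit (γ δ : Sp n) {τ : Matrix (Fin n) (Fin n) ℂ}
    (h : IsUnit (denom δ τ).det) :
    num γ (num δ τ * (denom δ τ)⁻¹) * denom δ τ = num (γ * δ) τ := by
  rw [num_mul, num, Matrix.add_mul, ← Matrix.mul_assoc, Matrix.mul_assoc _ _ (denom δ τ),
    nonsing_inv_mul _ h, Matrix.mul_one]

/-- The slash operator is a right action, at points where the denominator is invertible. -/
theorem slash_slash (k : ℕ) (F : Matrix (Fin n) (Fin n) ℂ → ℂ) (γ δ : Sp n)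
    {τ : Matrix (Fin n) (Fin n) ℂ} (h : IsUnit (denom δ τ).det) :
    slash k (slash k F γ) δ τ = slash k F (γ * δ) τ := by
  unfold slash
  rw [← denom_mul_of_isUnit γ δ h, ← num_mul_of_isUnit γ δ h, det_mul, mul_zpow, Matrix.mul_inv_rev,
    ← Matrix.mul_assoc, Matrix.mul_assoc (num γ _) (denom δ τ), mul_nonsing_inv _ h,
    Matrix.mul_one]
  ring

theorem denom_mul_of_mem {p : Sp n} (hp : p ∈ GamInf n) (δ : Sp n)
    (τ : Matrix (Fin n) (Fin n) ℂ) : denom (p * δ) τ = toC (blkD p) * denom δ τ := by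
  rw [denom_mul, mem_GamInf.1 hp, toC_zero, Matrix.zero_mul, zero_add]

theorem det_denom_mul_of_mem {p : Sp n} (hp : p ∈ GamInf n) (δ : Sp n)
    (τ : Matrix (Fin n) (Fin n) ℂ) :
    (denom (p * δ) τ).det = ((blkD p).det : ℂ) * (denom δ τ).det := by
  rw [denom_mul_of_mem hp, det_mul, det_toC]

theorem norm_det_denom_mul_of_mem {p : Sp n} (hp : p ∈ GamInf n) (δ : Sp n)
    (τ : Matrix (Fin n) (Fin n) ℂ) : ‖(denom (p * δ) τ).det‖ = ‖(denom δ τ).det‖ := by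
  rw [det_denom_mul_of_mem hp]
  rcases det_blkD_eq hp with h | h <;> simp [h]

theorem posSemidef_map_ofReal {P : Matrix (Fin n) (Fin n) ℝ} (hP : P.PosSemidef) :
    (P.map Complex.ofRealHom).PosSemidef := by
  obtain ⟨B, rfl⟩ := exists_eq_transpose_mul_self hP
  have : (Bᵀ * B).map Complex.ofRealHom
      = (B.map Complex.ofRealHom)ᴴ * B.map Complex.ofRealHom := by
    rw [Matrix.map_mul]
    congr 1
    ext i j
    simp
  rw [this]
  exact posSemidef_conjTranspose_mul_self _

theorem posDef_map_ofReal {P : Matrix (Fin n) (Fin n) ℝ} (hP : P.PosDef) :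
    (P.map Complex.ofRealHom).PosDef := by
  refine (posSemidef_map_ofReal hP.posSemidef).posDef_iff_isUnit.2 ?_
  rw [isUnit_iff_isUnit_det, ← RingHom.mapMatrix_apply, ← RingHom.map_det]
  exact hP.det_pos.ne'.isUnit.map _

theorem sub_conjTranspose_of_isSymm {τ : Matrix (Fin n) (Fin n) ℂ} (hτ : τ.IsSymm) :
    τ - τᴴ = (2 * Complex.I) • (τ.map Complex.im).map Complex.ofRealHom := by
  ext i j
  simp only [Matrix.sub_apply, conjTranspose_apply, hτ.apply, Matrix.smul_apply, Matrix.map_apply,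
    smul_eq_mul, Complex.ofRealHom_eq_coe]
  rw [← starRingEnd_apply, Complex.sub_conj]
  push_cast
  ring

/-- Combines `τ - τᴴ = 2i Im τ` with the symmetry of `C Dᵀ`. Both the invertibility of `Cτ + D` and
the bounds on `(Cτ + D)⁻¹C` come from this identity. -/
theorem denom_mul_transpose_sub (γ : Sp n) {τ : Matrix (Fin n) (Fin n) ℂ} (hτ : τ.IsSymm) :
    denom γ τ * toC (blkC γ)ᵀ - toC (blkC γ) * (denom γ τ)ᴴ
      = (2 * Complex.I) •
        (toC (blkC γ) * (τ.map Complex.im).map Complex.ofRealHom * toC (blkC γ)ᵀ) := by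
  have h1 : (denom γ τ)ᴴ = τᴴ * toC (blkC γ)ᵀ + toC (blkD γ)ᵀ := by
    rw [denom, conjTranspose_add, conjTranspose_mul, toC_conjTranspose, toC_conjTranspose]
  have h2 := congrArg toC (blkC_mul_blkD_transpose γ)
  rw [toC_mul, toC_mul] at h2
  have h3 := sub_conjTranspose_of_isSymm hτ
  rw [← Matrix.smul_mul, ← Matrix.mul_smul, ← h3, h1, denom, Matrix.add_mul, Matrix.mul_add, h2,
    Matrix.mul_sub, Matrix.sub_mul, Matrix.mul_assoc _ τᴴ]
  abel

/-- If `x(Cτ + D) = 0`, the identity above gives `(xC)(Im τ)(xC)ᴴ = 0`, hence `xC = 0` and `xD = 0`,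
against `D Aᵀ - C Bᵀ = 1`. -/
theorem isUnit_det_denom (γ : Sp n) {τ : Matrix (Fin n) (Fin n) ℂ} (hτ : τ ∈ halfSpace n) :
    IsUnit (denom γ τ).det := by
  rw [isUnit_iff_ne_zero]
  intro h0
  obtain ⟨x, hx, hxM⟩ := exists_vecMul_eq_zero_iff.2 h0
  have h1 := congrArg (fun M => (x ᵥ* M) ⬝ᵥ star x) (denom_mul_transpose_sub γ hτ.1)
  have h2 : (denom γ τ)ᴴ *ᵥ star x = 0 := by
    rw [mulVec_conjTranspose, star_star, hxM, star_zero]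
  simp only [vecMul_sub, ← vecMul_vecMul, hxM, zero_vecMul, zero_sub, neg_dotProduct] at h1
  rw [← dotProduct_mulVec, h2, dotProduct_zero, neg_zero, vecMul_smul, smul_dotProduct,
    ← vecMul_vecMul, ← vecMul_vecMul, ← dotProduct_mulVec, ← toC_conjTranspose,
    mulVec_conjTranspose, star_star, ← dotProduct_mulVec] at h1
  have h3 := (smul_eq_zero.1 h1.symm).resolve_left (by simp)
  have hY := posDef_map_ofReal hτ.2
  have h4 : x ᵥ* toC (blkC γ) = 0 := by
    by_contra hne
    have := hY.dotProduct_mulVec_pos (x := star (x ᵥ* toC (blkC γ))) (by simpa using hne)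
    rw [star_star, h3] at this
    exact lt_irrefl _ this
  have h5 : x ᵥ* toC (blkD γ) = 0 := by
    have := hxM
    rwa [denom, vecMul_add, ← vecMul_vecMul, h4, zero_vecMul, zero_add] at this
  have h6 := congrArg (fun M => x ᵥ* toC M) (blkD_mul_blkA_transpose_sub γ)
  simp only [toC_sub, toC_mul, vecMul_sub, ← vecMul_vecMul, h4, h5, zero_vecMul, sub_zero,
    toC_one, vecMul_one] at h6
  exact hx h6.symm

/-- Every eigenvalue has real part at least `1`, by testing on an eigenvector. -/
theorem one_le_norm_det {N : Matrix (Fin n) (Fin n) ℂ}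
    (h : ∀ v, (star v ⬝ᵥ v).re ≤ (star v ⬝ᵥ (N *ᵥ v)).re) : 1 ≤ ‖N.det‖ := by
  rw [det_eq_prod_roots_charpoly]
  have key : ∀ r ∈ N.charpoly.roots, 1 ≤ ‖r‖ := by
    intro r hr
    have hr' : Module.End.HasEigenvalue (Matrix.toLin' N) r := by
      rw [Module.End.hasEigenvalue_iff_isRoot_charpoly, Matrix.charpoly_toLin']
      exact (Polynomial.mem_roots'.1 hr).2
    obtain ⟨v, hv⟩ := hr'.exists_hasEigenvector
    have hNv : N *ᵥ v = r • v := by simpa using hv.apply_eq_smul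
    have h1 := h v
    have hpos : 0 < star v ⬝ᵥ v := dotProduct_star_self_pos_iff.2 hv.2
    rw [Complex.pos_iff] at hpos
    rw [hNv, dotProduct_smul, smul_eq_mul, Complex.mul_re, ← hpos.2, mul_zero, sub_zero] at h1
    have : 1 ≤ r.re := by
      by_contra hlt
      push Not at hlt
      nlinarith [hpos.1]
    exact this.trans (Complex.re_le_norm r)
  generalize N.charpoly.roots = s at key
  induction s using Multiset.induction with
  | empty => simp
  | cons a s ih =>
    rw [Multiset.prod_cons, norm_mul]
    exact one_le_mul_of_one_le_of_one_le (key a (Multiset.mem_cons_self a s))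
      (ih fun r hr => key r (Multiset.mem_cons_of_mem hr))

/-- The matrix `(Cτ + D)⁻¹C`. -/
noncomputable def cocycleQuot (γ : Sp n) (τ : Matrix (Fin n) (Fin n) ℂ) :
    Matrix (Fin n) (Fin n) ℂ := (denom γ τ)⁻¹ * toC (blkC γ)

/-- Multiplying `denom_mul_transpose_sub` by `(Cτ + D)⁻¹` on the left and its adjoint on the right
yields `Zᴴ - Z = 2i Z (Im τ) Zᴴ` for `Z = (Cτ + D)⁻¹C`. -/
theorem im_cocycleQuot (γ : Sp n) {τ : Matrix (Fin n) (Fin n) ℂ} (hτ : τ ∈ halfSpace n)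
    (u : Fin n → ℂ) :
    (star u ⬝ᵥ (cocycleQuot γ τ *ᵥ u)).im
      = -(star ((cocycleQuot γ τ)ᴴ *ᵥ u) ⬝ᵥ
          ((τ.map Complex.im).map Complex.ofRealHom *ᵥ ((cocycleQuot γ τ)ᴴ *ᵥ u))).re := by
  have hU := isUnit_det_denom γ hτ
  set M := denom γ τ
  set C := toC (blkC γ)
  set Y := (τ.map Complex.im).map Complex.ofRealHom
  have hC : toC (blkC γ)ᵀ = Cᴴ := (toC_conjTranspose _).symm
  have h0 := denom_mul_transpose_sub γ hτ.1
  rw [hC] at h0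
  set Z := cocycleQuot γ τ with hZ
  have hZ' : Z = M⁻¹ * C := rfl
  have hZH : Zᴴ = Cᴴ * (M⁻¹)ᴴ := by rw [hZ', conjTranspose_mul]
  have h1 : Zᴴ - Z = (2 * Complex.I) • (Z * Y * Zᴴ) := by
    have := congrArg (fun X => M⁻¹ * X * (M⁻¹)ᴴ) h0
    simp only [Matrix.mul_sub, Matrix.sub_mul, Matrix.mul_smul, Matrix.smul_mul] at this
    have e1 : M⁻¹ * (M * Cᴴ) * (M⁻¹)ᴴ = Zᴴ := by
      rw [← Matrix.mul_assoc, nonsing_inv_mul _ hU, Matrix.one_mul, hZH]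
    have e2 : M⁻¹ * (C * Mᴴ) * (M⁻¹)ᴴ = Z := by
      rw [Matrix.mul_assoc, Matrix.mul_assoc, ← conjTranspose_mul, nonsing_inv_mul _ hU,
        conjTranspose_one, Matrix.mul_one, hZ']
    have e3 : M⁻¹ * (C * Y * Cᴴ) * (M⁻¹)ᴴ = Z * Y * Zᴴ := by
      rw [hZH, hZ']
      simp only [Matrix.mul_assoc]
    calc Zᴴ - Z = M⁻¹ * (M * Cᴴ) * (M⁻¹)ᴴ - M⁻¹ * (C * Mᴴ) * (M⁻¹)ᴴ := by rw [e1, e2]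
      _ = (2 * Complex.I) • (M⁻¹ * (C * Y * Cᴴ) * (M⁻¹)ᴴ) := this
      _ = _ := by rw [e3]
  have h2 := congrArg (fun X => star u ⬝ᵥ (X *ᵥ u)) h1
  simp only [sub_mulVec, dotProduct_sub, smul_mulVec, dotProduct_smul] at h2
  have e4 : star u ⬝ᵥ (Zᴴ *ᵥ u) = star (star u ⬝ᵥ (Z *ᵥ u)) := by
    rw [star_dotProduct, star_mulVec, conjTranspose_conjTranspose, dotProduct_mulVec]
  have e5 : star u ⬝ᵥ ((Z * Y * Zᴴ) *ᵥ u) = star (Zᴴ *ᵥ u) ⬝ᵥ (Y *ᵥ (Zᴴ *ᵥ u)) := by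
    rw [← mulVec_mulVec, ← mulVec_mulVec, star_mulVec, conjTranspose_conjTranspose,
      dotProduct_mulVec]
  rw [e4, e5] at h2
  have h3 := congrArg Complex.im h2
  rw [Complex.sub_im, smul_eq_mul, mul_assoc] at h3
  simp only [Complex.star_def, Complex.conj_im, Complex.mul_im, Complex.re_ofNat, Complex.im_ofNat,
    Complex.I_re, Complex.I_im, zero_mul, one_mul, zero_add, add_zero] at h3
  linarith

end Denom

/-! ### Lower bounds and growth of `det (Cτ + D)`. -/

section Growth

open scoped ComplexOrder

variable {n : ℕ}

/-- The absolute value of `det (Cτ + D)` does not decrease when the imaginary part of `τ`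
increases. -/
theorem norm_det_denom_le_of_posSemidef (γ : Sp n) {τ : Matrix (Fin n) (Fin n) ℂ}
    (hτ : τ ∈ halfSpace n) {P : Matrix (Fin n) (Fin n) ℝ} (hP : P.PosSemidef) :
    ‖(denom γ τ).det‖ ≤ ‖(denom γ (τ + Complex.I • P.map Complex.ofRealHom)).det‖ := by
  obtain ⟨B, rfl⟩ := exists_eq_transpose_mul_self hP
  have hU := isUnit_det_denom γ hτ
  set Q := B.map Complex.ofRealHom with hQ
  have hQP : (Bᵀ * B).map Complex.ofRealHom = Qᴴ * Q := by
    rw [Matrix.map_mul]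
    congr 1
    ext i j
    simp [hQ]
  -- After factoring out `Cτ + D`, `det(1 + iZQᴴQ) = det(1 + iQZQᴴ)`, and the quadratic form of
  -- `iQZQᴴ` has non-negative real part by `im_cocycleQuot`.
  have e1 : denom γ (τ + Complex.I • (Qᴴ * Q))
      = denom γ τ * (1 + (Complex.I • (cocycleQuot γ τ * Qᴴ)) * Q) := by
    rw [Matrix.mul_add, Matrix.mul_one, Matrix.smul_mul, Matrix.mul_smul, cocycleQuot,
      Matrix.mul_assoc, Matrix.mul_assoc, ← Matrix.mul_assoc (denom γ τ),
      mul_nonsing_inv _ hU, Matrix.one_mul, denom, denom, Matrix.mul_add, Matrix.mul_smul]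
    abel
  rw [hQP, e1, det_mul, norm_mul, det_one_add_mul_comm]
  refine le_mul_of_one_le_right (norm_nonneg _) (one_le_norm_det fun v => ?_)
  set u := Qᴴ *ᵥ v with hu
  have e2 : star v ⬝ᵥ ((Q * (Complex.I • (cocycleQuot γ τ * Qᴴ))) *ᵥ v)
      = Complex.I * (star u ⬝ᵥ (cocycleQuot γ τ *ᵥ u)) := by
    rw [Matrix.mul_smul, smul_mulVec, dotProduct_smul, smul_eq_mul, ← mulVec_mulVec,
      ← mulVec_mulVec, hu, star_mulVec, conjTranspose_conjTranspose, dotProduct_mulVec]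
  rw [add_mulVec, dotProduct_add, one_mulVec, e2, Complex.add_re]
  have h1 := im_cocycleQuot γ hτ u
  have h2 := (posSemidef_map_ofReal hτ.2.posSemidef).dotProduct_mulVec_nonneg
    ((cocycleQuot γ τ)ᴴ *ᵥ u)
  rw [Complex.nonneg_iff] at h2
  have h3 : (Complex.I * (star u ⬝ᵥ (cocycleQuot γ τ *ᵥ u))).re
      = -(star u ⬝ᵥ (cocycleQuot γ τ *ᵥ u)).im := by simp
  rw [h3, h1]
  linarith [h2.1]

/-- Let `S` be the sum of `‖Z i j‖²` over the `i`-th row. Applying `im_cocycleQuot` to the `i`-th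
unit vector gives `c S ≤ ‖Z i i‖ ≤ √S`, so `√S ≤ c⁻¹`. -/
theorem norm_cocycleQuot_le (γ : Sp n) {τ : Matrix (Fin n) (Fin n) ℂ}
    (hτ : τ ∈ halfSpace n) {c : ℝ} (hc : 0 < c)
    (hcτ : (τ.map Complex.im - c • 1).PosSemidef) (i j : Fin n) :
    ‖cocycleQuot γ τ i j‖ ≤ c⁻¹ := by
  set Z := cocycleQuot γ τ with hZ
  have h1 := im_cocycleQuot γ hτ (Pi.single i 1)
  set w := Zᴴ *ᵥ Pi.single i 1 with hw
  have hwi : ∀ j, w j = star (Z i j) := fun j => by simp [hw]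
  have h2 : star (Pi.single i 1 : Fin n → ℂ) ⬝ᵥ (Z *ᵥ Pi.single i 1) = Z i i := by simp
  have h3 := (posSemidef_map_ofReal hcτ).dotProduct_mulVec_nonneg w
  have h4 : (τ.map Complex.im - c • (1 : Matrix (Fin n) (Fin n) ℝ)).map Complex.ofRealHom
      = (τ.map Complex.im).map Complex.ofRealHom - (c : ℂ) • 1 := by
    ext a b
    by_cases h : a = b
    · subst h
      simp
    · simp [h]
  rw [h4, sub_mulVec, dotProduct_sub, smul_mulVec, one_mulVec, dotProduct_smul] at h3
  rw [Complex.nonneg_iff] at h3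
  have h5 : (star w ⬝ᵥ w) = ((∑ j, ‖Z i j‖ ^ 2 : ℝ) : ℂ) := by
    simp only [dotProduct, Pi.star_apply, hwi, star_star]
    push_cast
    refine Finset.sum_congr rfl fun j _ => ?_
    rw [Complex.star_def, Complex.mul_conj, Complex.normSq_eq_norm_sq]
    push_cast
    rfl
  rw [h2] at h1
  rw [h5] at h3
  have h6 := h3.1
  rw [Complex.sub_re, smul_eq_mul, ← Complex.ofReal_mul, Complex.ofReal_re] at h6
  set S := ∑ j, ‖Z i j‖ ^ 2
  have hle : ∀ j, ‖Z i j‖ ^ 2 ≤ S := fun j =>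
    Finset.single_le_sum (f := fun j => ‖Z i j‖ ^ 2) (fun _ _ => by positivity)
      (Finset.mem_univ j)
  have h7 : c * S ≤ ‖Z i i‖ := by
    have := Complex.abs_im_le_norm (Z i i)
    rw [h1, abs_neg] at this
    exact le_trans (by linarith) ((le_abs_self _).trans this)
  have h8 : ‖Z i i‖ ≤ Real.sqrt S := Real.le_sqrt_of_sq_le (hle i)
  have hS : 0 ≤ S := le_trans (by positivity) (hle i)
  have h9 : Real.sqrt S ≤ c⁻¹ := by
    rcases hS.eq_or_lt with h0 | h0
    · rw [← h0, Real.sqrt_zero]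
      positivity
    · have hs := Real.sqrt_pos.2 h0
      have : c * (Real.sqrt S * Real.sqrt S) ≤ Real.sqrt S := by
        rw [Real.mul_self_sqrt hS]
        exact h7.trans h8
      rw [le_inv_comm₀ hs hc, ← one_div, le_div_iff₀ hs]
      nlinarith
  exact (Real.le_sqrt_of_sq_le (hle j)).trans h9

theorem norm_det_le_of_entries {N : Matrix (Fin n) (Fin n) ℂ} {K : ℝ}
    (h : ∀ i j, ‖N i j‖ ≤ K) : ‖N.det‖ ≤ n.factorial * K ^ n := by
  have := Matrix.det_le (A := N) (abv := NormedField.toAbsoluteValue ℂ) (x := K) h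
  rw [nsmul_eq_mul, Fintype.card_fin] at this
  exact this

/-- The point `i c` of the half-space. -/
noncomputable def imagPoint (n : ℕ) (c : ℝ) : Matrix (Fin n) (Fin n) ℂ := (Complex.I * c) • 1

theorem imagPoint_map_im (c : ℝ) : (imagPoint n c).map Complex.im = c • 1 := by
  ext i j
  by_cases h : i = j
  · subst h
    simp [imagPoint]
  · simp [imagPoint, h]

theorem add_imagPoint_mem {X : Matrix (Fin n) (Fin n) ℝ} (hX : X.IsSymm) {c : ℝ} (hc : 0 < c) :
    X.map Complex.ofRealHom + imagPoint n c ∈ halfSpace n := by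
  refine ⟨(hX.map _).add ?_, ?_⟩
  · rw [imagPoint]
    exact (Matrix.isSymm_one).smul _
  · have : (X.map Complex.ofRealHom + imagPoint n c).map Complex.im = c • 1 := by
      rw [← imagPoint_map_im]
      ext i j
      simp
    rw [this]
    exact Matrix.PosDef.one.smul hc

theorem imagPoint_mem {c : ℝ} (hc : 0 < c) : imagPoint n c ∈ halfSpace n := by
  have := add_imagPoint_mem (n := n) (X := 0) isSymm_zero hc
  simpa using this

/-- In regions where the real part is bounded and the imaginary part is at least `c ≥ 1`,
`det (Cτ + D)` is at least a fixed proportion of its value at `ic`. -/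
theorem norm_det_denom_imagPoint_le (γ : Sp n) {τ : Matrix (Fin n) (Fin n) ℂ}
    (hτ : τ ∈ halfSpace n) {c K : ℝ} (hc : 1 ≤ c)
    (hcτ : (τ.map Complex.im - c • 1).PosSemidef) (hK : ∀ i j, |(τ i j).re| ≤ K) :
    ‖(denom γ (imagPoint n c)).det‖
      ≤ n.factorial * (1 + n * K) ^ n * ‖(denom γ τ).det‖ := by
  have hc0 : 0 < c := by linarith
  set X : Matrix (Fin n) (Fin n) ℝ := τ.map Complex.re with hXdef
  have hX : X.IsSymm := hτ.1.map _
  -- The intermediate point `Re τ + ic`: passing from it to `τ` only enlarges the determinant.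
  set τ₁ := X.map Complex.ofRealHom + imagPoint n c with hτ₁
  have hmem : τ₁ ∈ halfSpace n := add_imagPoint_mem hX hc0
  have him : τ₁.map Complex.im = c • 1 := by
    rw [← imagPoint_map_im, hτ₁]
    ext i j
    simp
  have h1 := norm_det_denom_le_of_posSemidef γ hmem hcτ
  have e1 : τ₁ + Complex.I • (τ.map Complex.im - c • 1).map Complex.ofRealHom = τ := by
    ext i j
    by_cases h : i = j
    · subst h
      simp only [hτ₁, hXdef, imagPoint, Matrix.add_apply, Matrix.map_apply, Matrix.smul_apply,
        Matrix.sub_apply, Matrix.one_apply_eq, smul_eq_mul, Complex.ofRealHom_eq_coe]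
      push_cast
      rw [mul_comm Complex.I (_ - _), sub_mul, mul_one, mul_one, mul_comm (Complex.I),
        add_add_sub_cancel]
      exact Complex.re_add_im _
    · simp only [hτ₁, hXdef, imagPoint, Matrix.add_apply, Matrix.map_apply, Matrix.smul_apply,
        Matrix.sub_apply, Matrix.one_apply_ne h, smul_eq_mul, Complex.ofRealHom_eq_coe,
        mul_zero, sub_zero, add_zero]
      rw [mul_comm]
      exact Complex.re_add_im _
  rw [e1] at h1
  have hU := isUnit_det_denom γ hmem
  -- Passing from `τ₁` to `ic` costs `det(1 - ZX)`, where the entries of `Z` are at most `c⁻¹ ≤ 1`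
  -- and those of `X` at most `K`.
  have e2 : denom γ (imagPoint n c)
      = denom γ τ₁ * (1 - cocycleQuot γ τ₁ * X.map Complex.ofRealHom) := by
    rw [Matrix.mul_sub, Matrix.mul_one, cocycleQuot, ← Matrix.mul_assoc, ← Matrix.mul_assoc,
      mul_nonsing_inv _ hU, Matrix.one_mul, hτ₁, denom, denom, Matrix.mul_add]
    abel
  rw [e2, det_mul, norm_mul, mul_comm]
  refine mul_le_mul (norm_det_le_of_entries fun i j => ?_) h1 (norm_nonneg _) ?_
  · rw [Matrix.sub_apply]
    refine (norm_sub_le _ _).trans (add_le_add ?_ ?_)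
    · by_cases h : i = j
      · subst h
        simp
      · simp [h]
    · rw [Matrix.mul_apply]
      refine (norm_sum_le _ _).trans ?_
      calc ∑ l, ‖cocycleQuot γ τ₁ i l * (X.map Complex.ofRealHom) l j‖
          ≤ ∑ _l : Fin n, K := by
            refine Finset.sum_le_sum fun l _ => ?_
            rw [norm_mul]
            have hz := norm_cocycleQuot_le γ hmem hc0 (by
              rw [him, sub_self]
              exact Matrix.PosSemidef.zero) i l
            have hx : ‖(X.map Complex.ofRealHom) l j‖ ≤ K := by
              simpa [hXdef] using hK l j
            calc _ ≤ 1 * K := mul_le_mul (hz.trans (inv_le_one_of_one_le₀ hc)) hx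
                    (norm_nonneg _) zero_le_one
              _ = K := one_mul K
        _ = n * K := by simp
  · rcases Nat.eq_zero_or_pos n with rfl | hn
    · simp
    · have : 0 ≤ K := (abs_nonneg _).trans (hK ⟨0, hn⟩ ⟨0, hn⟩)
      positivity

theorem imagPoint_isUnit (γ : Sp n) {c : ℝ} (hc : 0 < c) :
    IsUnit (denom γ (imagPoint n c)).det := isUnit_det_denom γ (imagPoint_mem hc)

/-- The polynomial `det (Cz + D)`. -/
noncomputable def denomPoly (γ : Sp n) : Polynomial ℂ :=
  ((Polynomial.X : Polynomial ℂ) • (toC (blkC γ)).map Polynomial.C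
    + (toC (blkD γ)).map Polynomial.C).det

theorem eval_denomPoly (γ : Sp n) (z : ℂ) :
    (denomPoly γ).eval z = (z • toC (blkC γ) + toC (blkD γ)).det := by
  rw [denomPoly, ← Polynomial.coe_evalRingHom, RingHom.map_det]
  congr 1
  ext i j
  simp
  exact mul_comm _ _

theorem denom_smul_one (γ : Sp n) (z : ℂ) :
    denom γ (z • 1) = z • toC (blkC γ) + toC (blkD γ) := by
  rw [denom, Matrix.mul_smul, Matrix.mul_one]

theorem eval_denomPoly_I_mul (γ : Sp n) (c : ℝ) :
    (denomPoly γ).eval (Complex.I * c) = (denom γ (imagPoint n c)).det := by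
  rw [eval_denomPoly, imagPoint, denom_smul_one]

/-- If `det(Cz + D)` is constant it equals `det D ≠ 0`, so `det(1 + zS) = 1` for all `z`, where `S =
D⁻¹C` is Hermitian. A non-zero eigenvalue `μ` would give a zero at `z = -1/μ`; hence `S = 0` and `C
= 0`. -/
theorem degree_denomPoly_pos {γ : Sp n} (hγ : blkC γ ≠ 0) : 0 < (denomPoly γ).degree := by
  by_contra hdeg
  have hconst := Polynomial.eq_C_of_degree_le_zero (not_lt.1 hdeg)
  have heval : ∀ z, (denomPoly γ).eval z = (toC (blkD γ)).det := by
    intro z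
    have h0 := eval_denomPoly γ 0
    rw [zero_smul, zero_add] at h0
    rw [← h0, hconst, Polynomial.eval_C, Polynomial.eval_C]
  have hD : IsUnit (toC (blkD γ)).det := by
    rw [← heval (Complex.I * (1 : ℝ)), eval_denomPoly_I_mul]
    exact imagPoint_isUnit γ one_pos
  set C := toC (blkC γ) with hC
  set D := toC (blkD γ) with hDdef
  set S := D⁻¹ * C with hS
  have hDS : D * S = C := by rw [hS, ← Matrix.mul_assoc, mul_nonsing_inv _ hD, Matrix.one_mul]
  have hCD : C * Dᴴ = D * Cᴴ := by
    rw [hC, hDdef, toC_conjTranspose, toC_conjTranspose, ← toC_mul, ← toC_mul,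
      blkC_mul_blkD_transpose]
  have hDH : IsUnit (Dᴴ).det := by
    rw [det_conjTranspose]
    exact hD.star
  have hSH : S.IsHermitian := by
    have h1 : D * S * Dᴴ = D * Sᴴ * Dᴴ := by
      rw [hDS, hCD, Matrix.mul_assoc, ← conjTranspose_mul, hDS]
    have h2 : ∀ T : Matrix (Fin n) (Fin n) ℂ, D⁻¹ * (D * T * Dᴴ) * (Dᴴ)⁻¹ = T := by
      intro T
      rw [← Matrix.mul_assoc, ← Matrix.mul_assoc, nonsing_inv_mul _ hD, Matrix.one_mul,
        Matrix.mul_assoc, mul_nonsing_inv _ hDH, Matrix.mul_one]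
    rw [IsHermitian, ← h2 Sᴴ, ← h1, h2]
  have hev : hSH.eigenvalues = 0 := by
    ext i
    by_contra hne
    have hne' : hSH.eigenvalues i ≠ 0 := hne
    set μ : ℂ := ((hSH.eigenvalues i : ℝ) : ℂ) with hμ
    have hμ0 : μ ≠ 0 := by
      rw [hμ]
      exact_mod_cast hne'
    have h1 := heval (-μ⁻¹)
    rw [eval_denomPoly, ← hC, ← hDdef] at h1
    have h2 : -μ⁻¹ • C + D = D * (1 + (-μ⁻¹) • S) := by
      rw [Matrix.mul_add, Matrix.mul_one, Matrix.mul_smul, hDS, add_comm]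
    rw [h2, det_mul] at h1
    have h3 : (1 + (-μ⁻¹) • S).det = 1 := by
      have := hD.ne_zero
      exact mul_left_cancel₀ this (h1.trans (mul_one _).symm)
    have h4 := hSH.mulVec_eigenvectorBasis i
    have hv : (hSH.eigenvectorBasis i).ofLp ≠ 0 := by
      have := hSH.eigenvectorBasis.orthonormal.ne_zero i
      intro h
      exact this (by ext j; exact congrFun h j)
    have h5 : (1 + (-μ⁻¹) • S) *ᵥ (hSH.eigenvectorBasis i).ofLp = 0 := by
      rw [add_mulVec, one_mulVec, smul_mulVec, h4]
      ext j
      simp only [Pi.add_apply, Pi.smul_apply, smul_eq_mul, Complex.real_smul, ← hμ, Pi.zero_apply]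
      rw [← mul_assoc, neg_mul, inv_mul_cancel₀ hμ0]
      ring
    have h6 : (1 + (-μ⁻¹) • S).det = 0 := exists_mulVec_eq_zero_iff.1 ⟨_, hv, h5⟩
    rw [h3] at h6
    exact one_ne_zero h6
  have hS0 : S = 0 := hSH.eigenvalues_eq_zero_iff.1 hev
  rw [hS0, Matrix.mul_zero] at hDS
  exact hγ (toC_eq_zero_iff.1 hDS.symm)

theorem tendsto_norm_det_denom_imagPoint {γ : Sp n} (hγ : blkC γ ≠ 0) :
    Tendsto (fun c : ℝ => ‖(denom γ (imagPoint n c)).det‖) atTop atTop := by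
  have h := Polynomial.tendsto_norm_atTop (denomPoly γ) (degree_denomPoly_pos hγ) (l := atTop)
    (z := fun c : ℝ => Complex.I * c) (by
      simp only [norm_mul, Complex.norm_I, one_mul, Complex.norm_real]
      exact tendsto_norm_atTop_atTop)
  simpa only [eval_denomPoly_I_mul] using h

/-- Some `C + tD` with `0 ≤ t ≤ n` has non-zero determinant. -/
theorem exists_det_add_smul_ne_zero (γ : Sp n) :
    ∃ t : Fin (n + 1), (blkC γ + ((t : ℕ) : ℤ) • blkD γ).det ≠ 0 := by
  let q : Polynomial ℂ := ((Polynomial.X : Polynomial ℂ) • (toC (blkD γ)).map Polynomial.C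
    + (toC (blkC γ)).map Polynomial.C).det
  have hq : ∀ z, q.eval z = (z • toC (blkD γ) + toC (blkC γ)).det := by
    intro z
    rw [← Polynomial.coe_evalRingHom, RingHom.map_det]
    congr 1
    ext i j
    simp
    exact mul_comm _ _
  have hdeg : q.natDegree ≤ n := by
    simpa using Polynomial.natDegree_det_X_add_C_le (toC (blkD γ)) (toC (blkC γ))
  -- At `z = -i` the matrix `C + zD` is `-i(Ci + D)`, which is invertible. A non-zero polynomial of
  -- degree at most `n` cannot vanish at all of `0, …, n`.
  have hq0 : q ≠ 0 := by
    intro h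
    have h1 := hq (-Complex.I)
    rw [h, Polynomial.eval_zero] at h1
    have h2 : (-Complex.I) • toC (blkD γ) + toC (blkC γ)
        = (-Complex.I) • denom γ (imagPoint n 1) := by
      rw [imagPoint, denom_smul_one, smul_add, smul_smul, Complex.ofReal_one, mul_one, neg_mul,
        Complex.I_mul_I, neg_neg, one_smul, add_comm]
    rw [h2, det_smul] at h1
    rcases mul_eq_zero.1 h1.symm with h3 | h3
    · exact pow_ne_zero _ (neg_ne_zero.2 Complex.I_ne_zero) h3
    · exact (imagPoint_isUnit γ one_pos).ne_zero h3
  by_contra hall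
  push Not at hall
  refine hq0 (Polynomial.eq_zero_of_natDegree_lt_card_of_eval_eq_zero q
    (f := fun t : Fin (n + 1) => ((t : ℕ) : ℂ)) ?_ ?_ (by simpa using Nat.lt_succ_of_le hdeg))
  · intro a b hab
    exact Fin.ext (Nat.cast_injective hab)
  · intro t
    rw [hq]
    have h1 := congrArg (Int.cast : ℤ → ℂ) (hall t)
    rw [← det_toC] at h1
    rw [Int.cast_zero] at h1
    rw [← h1]
    rw [toC_add, toC_smul, Int.cast_natCast, add_comm]

end Growth

/-! ### Special symplectic elements. -/

section Elements

variable {n : ℕ}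

/-- The symplectic matrix with the given blocks. -/
def spMk (A B C D : Matrix (Fin n) (Fin n) ℤ)
    (h : A * Bᵀ = B * Aᵀ ∧ C * Dᵀ = D * Cᵀ ∧ A * Dᵀ - B * Cᵀ = 1) : Sp n :=
  ⟨fromBlocks A B C D, (mem_symplecticGroup_iff A B C D).2 h⟩

/-- The translation `(1 T; 0 1)` by an integral symmetric matrix. -/
def translation (T : SymMat n ℤ) : Sp n :=
  spMk 1 T.1 0 1 (by simp [T.2.eq])

/-- The lower unipotent element `(1 0; t 1)`. -/
def lowerShift (n : ℕ) (t : ℤ) : Sp n :=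
  spMk 1 0 (t • 1) 1 (by simp)

/-- The block diagonal element `(U 0; 0 V)`, where `U Vᵀ = 1`. -/
def leviElt (U V : Matrix (Fin n) (Fin n) ℤ) (h : U * Vᵀ = 1) : Sp n :=
  spMk U 0 0 V (by simp [h])

theorem blkC_mul_lowerShift (γ : Sp n) (t : ℤ) :
    blkC (γ * lowerShift n t) = blkC γ + t • blkD γ := by
  have h1 : blkA (lowerShift n t) = 1 := rfl
  have h2 : blkC (lowerShift n t) = t • 1 := rfl
  rw [blkC_mul, h1, h2, Matrix.mul_one, Matrix.mul_smul, Matrix.mul_one]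

theorem blkD_mul_lowerShift (γ : Sp n) (t : ℤ) : blkD (γ * lowerShift n t) = blkD γ := by
  have h1 : blkB (lowerShift n t) = 0 := rfl
  have h2 : blkD (lowerShift n t) = 1 := rfl
  rw [blkD_mul, h1, h2, Matrix.mul_zero, Matrix.mul_one, zero_add]

/-- With `M = Ci + D` and `Z = M⁻¹C` one has `D = M(1 - iZ)`, so the shift multiplies `M` by `1 +
ti(1 - iZ)`. Its entries are at most `1 + 2n`, as `t ≤ n` and `‖Z i j‖ ≤ 1`. -/
theorem norm_det_denom_lowerShift_le (γ : Sp n) (t : Fin (n + 1)) :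
    ‖(denom (γ * lowerShift n (t : ℕ)) (imagPoint n 1)).det‖
      ≤ n.factorial * (1 + 2 * n : ℝ) ^ n * ‖(denom γ (imagPoint n 1)).det‖ := by
  have hU := imagPoint_isUnit γ one_pos
  set M := denom γ (imagPoint n 1) with hM
  have hMeq : M = Complex.I • toC (blkC γ) + toC (blkD γ) := by
    rw [hM, imagPoint, denom_smul_one, Complex.ofReal_one, mul_one]
  set Z := cocycleQuot γ (imagPoint n 1) with hZ
  have hMZ : M * Z = toC (blkC γ) := by
    rw [hZ, cocycleQuot, ← Matrix.mul_assoc, mul_nonsing_inv _ hU, Matrix.one_mul]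
  have e : denom (γ * lowerShift n (t : ℕ)) (imagPoint n 1)
      = M * (1 + ((t : ℕ) * Complex.I) • (1 - Complex.I • Z)) := by
    rw [Matrix.mul_add, Matrix.mul_smul, Matrix.mul_sub, Matrix.mul_smul, hMZ, Matrix.mul_one]
    nth_rewrite 2 [hMeq]
    rw [add_sub_cancel_left, hMeq, imagPoint, denom_smul_one, blkC_mul_lowerShift,
      blkD_mul_lowerShift, toC_add, toC_smul, smul_add, smul_smul, Complex.ofReal_one, mul_one,
      Int.cast_natCast, mul_comm Complex.I]
    abel
  rw [e, det_mul, norm_mul, mul_comm]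
  refine mul_le_mul_of_nonneg_right (norm_det_le_of_entries fun i j => ?_) (norm_nonneg _)
  have hone : ‖(1 : Matrix (Fin n) (Fin n) ℂ) i j‖ ≤ 1 := by
    by_cases h : i = j
    · subst h
      simp
    · simp [h]
  have hZij : ‖Z i j‖ ≤ 1 := by
    have := norm_cocycleQuot_le γ (imagPoint_mem one_pos) one_pos (by
      rw [imagPoint_map_im, sub_self]
      exact Matrix.PosSemidef.zero) i j
    simpa using this
  have ht : ((t : ℕ) : ℝ) ≤ n := by exact_mod_cast Nat.lt_succ_iff.1 t.2
  rw [Matrix.add_apply, Matrix.smul_apply, Matrix.sub_apply, Matrix.smul_apply]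
  refine (norm_add_le _ _).trans (add_le_add hone ?_)
  rw [norm_smul, norm_mul, Complex.norm_I, mul_one, Complex.norm_natCast, mul_comm]
  refine mul_le_mul ((norm_sub_le _ _).trans ?_) ht (Nat.cast_nonneg _) zero_le_two
  rw [norm_smul, Complex.norm_I, one_mul]
  linarith

end Elements

/-! ### The cosets of `Γ_∞⁺` and the right action on them. -/

section Cosets

variable {n : ℕ}

/-- The cosets `Γ_∞⁺ δ` in `Sp_n(ℤ)`. -/
abbrev Cosets (n : ℕ) : Type := Quotient (QuotientGroup.rightRel (GamInfPlus n))

/-- The coset `Γ_∞⁺ δ`. -/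
abbrev cosetMk (δ : Sp n) : Cosets n := Quotient.mk'' δ

theorem cosetMk_eq_iff {δ δ' : Sp n} : cosetMk δ = cosetMk δ' ↔ δ' * δ⁻¹ ∈ GamInfPlus n := by
  rw [Quotient.eq'', QuotientGroup.rightRel_apply]

theorem cosetMk_out (q : Cosets n) : cosetMk q.out = q := Quotient.out_eq' q

theorem exists_out_eq (δ : Sp n) : ∃ p ∈ GamInfPlus n, (cosetMk δ).out = p * δ := by
  refine ⟨(cosetMk δ).out * δ⁻¹, cosetMk_eq_iff.1 (cosetMk_out _).symm, by group⟩

theorem cosetMk_mul_of_mem {p : Sp n} (hp : p ∈ GamInfPlus n) (δ : Sp n) :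
    cosetMk (p * δ) = cosetMk δ := by
  rw [cosetMk_eq_iff]
  simpa using inv_mem hp

/-- Right multiplication on the cosets `Γ_∞⁺ δ`. -/
noncomputable def cosetMulRight (g : Sp n) (q : Cosets n) : Cosets n := cosetMk (q.out * g)

theorem cosetMulRight_mk (g δ : Sp n) : cosetMulRight g (cosetMk δ) = cosetMk (δ * g) := by
  obtain ⟨p, hp, h⟩ := exists_out_eq δ
  rw [cosetMulRight, h, mul_assoc, cosetMk_mul_of_mem hp]

theorem cosetMulRight_mul (g h : Sp n) (q : Cosets n) :
    cosetMulRight h (cosetMulRight g q) = cosetMulRight (g * h) q := by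
  change cosetMulRight h (cosetMk (q.out * g)) = cosetMk (q.out * (g * h))
  rw [cosetMulRight_mk, mul_assoc]

/-- Right multiplication as a permutation of the cosets `Γ_∞⁺ δ`. -/
noncomputable def cosetEquiv (g : Sp n) : Cosets n ≃ Cosets n where
  toFun := cosetMulRight g
  invFun := cosetMulRight g⁻¹
  left_inv q := by rw [cosetMulRight_mul, mul_inv_cancel, cosetMulRight, mul_one, cosetMk_out]
  right_inv q := by rw [cosetMulRight_mul, inv_mul_cancel, cosetMulRight, mul_one, cosetMk_out]

/-- The absolute value of `det (Ci + D)` on cosets. -/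
noncomputable def absDet (q : Cosets n) : ℝ := ‖(denom q.out (imagPoint n 1)).det‖

theorem absDet_mk (δ : Sp n) : absDet (cosetMk δ) = ‖(denom δ (imagPoint n 1)).det‖ := by
  obtain ⟨p, hp, h⟩ := exists_out_eq δ
  rw [absDet, h, norm_det_denom_mul_of_mem hp.1]

theorem absDet_pos (q : Cosets n) : 0 < absDet q :=
  norm_pos_iff.2 (imagPoint_isUnit _ one_pos).ne_zero

theorem det_blkC_out (δ : Sp n) : (blkC (cosetMk δ).out).det = (blkC δ).det := by
  obtain ⟨p, hp, h⟩ := exists_out_eq δ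
  rw [h, blkC_mul_of_mem hp.1, det_mul, hp.2, one_mul]

end Cosets

/-! ### Convergence of the Eisenstein series at the point `i`. -/

section Nonsingular

variable {n : ℕ}

theorem mul_left_cancel_of_det_ne_zero {C X Y : Matrix (Fin n) (Fin n) ℤ} (hC : C.det ≠ 0)
    (h : C * X = C * Y) : X = Y := by
  have h1 := congrArg (fun Z => C.adjugate * Z) h
  simp only [← Matrix.mul_assoc, adjugate_mul, Matrix.smul_mul, Matrix.one_mul] at h1
  exact smul_right_injective _ hC h1

theorem mulVec_left_cancel_of_det_ne_zero {C : Matrix (Fin n) (Fin n) ℤ} (hC : C.det ≠ 0)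
    {x y : Fin n → ℤ} (h : C *ᵥ x = C *ᵥ y) : x = y := by
  by_contra hne
  exact hC (exists_mulVec_eq_zero_iff.1 ⟨x - y, sub_ne_zero.2 hne, by
    rw [mulVec_sub, h, sub_self]⟩)

/-- `M C⁻¹ D` is an integral symmetric matrix if `det C ≠ 0` divides `M`. -/
theorem exists_symMat_of_dvd (γ : Sp n) (hC : (blkC γ).det ≠ 0) {M : ℤ}
    (hM : (blkC γ).det ∣ M) : ∃ S : SymMat n ℤ, blkC γ * S.1 = M • blkD γ := by
  obtain ⟨m, rfl⟩ := hM
  have h : blkC γ * (m • ((blkC γ).adjugate * blkD γ)) = ((blkC γ).det * m) • blkD γ := by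
    rw [Matrix.mul_smul, ← Matrix.mul_assoc, mul_adjugate, Matrix.smul_mul, Matrix.one_mul,
      smul_smul, mul_comm]
  set S := m • ((blkC γ).adjugate * blkD γ) with hS
  refine ⟨⟨S, ?_⟩, h⟩
  have hCt : ((blkC γ)ᵀ).det ≠ 0 := by rwa [det_transpose]
  have h1 : blkC γ * (Sᵀ * (blkC γ)ᵀ) = blkC γ * (S * (blkC γ)ᵀ) := by
    rw [← Matrix.mul_assoc _ S, h, ← transpose_mul, h, transpose_smul, Matrix.mul_smul,
      Matrix.smul_mul, blkC_mul_blkD_transpose]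
  have h2 := congrArg Matrix.transpose (mul_left_cancel_of_det_ne_zero hC h1)
  rw [transpose_mul, transpose_mul, transpose_transpose, transpose_transpose] at h2
  exact (mul_left_cancel_of_det_ne_zero hC h2).symm

theorem card_quotient_range_mulVec {C : Matrix (Fin n) (Fin n) ℤ} (hC : C.det ≠ 0) :
    Nat.card ((Fin n → ℤ) ⧸ LinearMap.range C.mulVecLin) = C.det.natAbs := by
  have hinj : Function.Injective C.mulVecLin := fun x y h =>
    mulVec_left_cancel_of_det_ne_zero hC h
  let e := LinearEquiv.ofInjective C.mulVecLin hinj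
  have h := Submodule.natAbs_det_equiv (LinearMap.range C.mulVecLin) e
  rw [← h]
  change (LinearMap.det C.mulVecLin).natAbs = _
  rw [← Matrix.toLin'_apply', LinearMap.det_toLin']

/-- If `C S = M D` then the column space of `S` modulo `M` has at most `|det C|` elements. -/
theorem card_colSpace_le_natAbs_det {M : ℕ} [NeZero M] {C S D : Matrix (Fin n) (Fin n) ℤ}
    (hC : C.det ≠ 0) (h : C * S = (M : ℤ) • D) :
    Nat.card (colSpace (S.map (Int.cast : ℤ → ZMod M))) ≤ C.det.natAbs := by
  have hM : (M : ℤ) ≠ 0 := by exact_mod_cast NeZero.ne M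
  rw [← card_quotient_range_mulVec hC]
  have hfin : Finite ((Fin n → ℤ) ⧸ LinearMap.range C.mulVecLin) := by
    refine Nat.finite_of_card_ne_zero ?_
    rw [card_quotient_range_mulVec hC]
    exact Int.natAbs_ne_zero.2 hC
  -- If `y ≡ S w` modulo `M`, then `C y ≡ C S w ≡ 0`, say `C y = M z`. The class of `z` modulo `C
  -- ℤⁿ` determines `y` modulo `M`, and there are `|det C|` classes.
  let lift : (Fin n → ZMod M) → (Fin n → ℤ) := fun y i => ((y i).val : ℤ)
  have hlift : ∀ y i, ((lift y i : ℤ) : ZMod M) = y i := fun y i => by simp [lift]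
  have hex : ∀ y : colSpace (S.map (Int.cast : ℤ → ZMod M)),
      ∃ z : Fin n → ℤ, C *ᵥ lift y.1 = (M : ℤ) • z := by
    rintro ⟨y, hy⟩
    obtain ⟨w, rfl⟩ := mem_colSpace.1 hy
    set y := S.map (Int.cast : ℤ → ZMod M) *ᵥ w
    have h1 : ∀ i, (M : ℤ) ∣ (lift y - S *ᵥ lift w) i := by
      intro i
      rw [← ZMod.intCast_zmod_eq_zero_iff_dvd, Pi.sub_apply, Int.cast_sub, hlift, sub_eq_zero]
      simp [y, mulVec, dotProduct, hlift]
    choose d hd using h1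
    refine ⟨C *ᵥ d + D *ᵥ lift w, ?_⟩
    have h2 : lift y = S *ᵥ lift w + (M : ℤ) • d := by
      ext i
      have := hd i
      simp only [Pi.sub_apply] at this
      simp only [Pi.add_apply, Pi.smul_apply, smul_eq_mul]
      linarith
    rw [h2, mulVec_add, mulVec_mulVec, h, mulVec_smul, smul_mulVec, smul_add, add_comm]
  choose z hz using hex
  refine Nat.card_le_card_of_injective
    (fun y => (Submodule.Quotient.mk (z y) : (Fin n → ℤ) ⧸ LinearMap.range C.mulVecLin)) ?_
  intro y y' hyy
  obtain ⟨w, hw⟩ := (Submodule.Quotient.eq _).1 hyy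
  have h3 : C *ᵥ (lift y.1 - lift y'.1) = C *ᵥ ((M : ℤ) • w) := by
    rw [mulVec_sub, hz, hz, mulVec_smul, ← smul_sub, ← hw]
    rfl
  have h4 := mulVec_left_cancel_of_det_ne_zero hC h3
  ext i
  have h5 := congrArg (Int.cast : ℤ → ZMod M) (congrFun h4 i)
  simp only [Pi.sub_apply, Int.cast_sub, hlift, Pi.smul_apply, smul_eq_mul, Int.cast_mul,
    Int.cast_natCast, CharP.cast_eq_zero, zero_mul] at h5
  exact sub_eq_zero.1 h5

theorem norm_det_denom_eq_of_mul_eq {γ : Sp n} {M : ℕ} [NeZero M] {S : SymMat n ℤ}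
    (h : blkC γ * S.1 = (M : ℤ) • blkD γ) :
    ‖(denom γ (imagPoint n 1)).det‖
      = (blkC γ).det.natAbs * ‖detAddI ((M : ℝ)⁻¹ • S.1.map (Int.cast : ℤ → ℝ))‖ := by
  have hM : (M : ℂ) ≠ 0 := by exact_mod_cast NeZero.ne M
  have h1 := congrArg toC h
  rw [toC_mul, toC_smul, Int.cast_natCast] at h1
  have h2 : toC (blkD γ) = toC (blkC γ) * ((M : ℂ)⁻¹ • toC S.1) := by
    rw [Matrix.mul_smul, h1, smul_smul, inv_mul_cancel₀ hM, one_smul]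
  have h3 : denom γ (imagPoint n 1) = toC (blkC γ) *
      (((M : ℝ)⁻¹ • S.1.map (Int.cast : ℤ → ℝ)).map Complex.ofRealHom
        + Complex.I • (1 : Matrix (Fin n) (Fin n) ℂ)) := by
    have h4 : ((M : ℝ)⁻¹ • S.1.map (Int.cast : ℤ → ℝ)).map Complex.ofRealHom
        = (M : ℂ)⁻¹ • toC S.1 := by
      ext i j
      simp [toC]
    rw [h4, Matrix.mul_add, ← h2, imagPoint, denom, Complex.ofReal_one, mul_one, add_comm]
  rw [h3, det_mul, norm_mul, det_toC, detAddI]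
  congr 1
  rw [Complex.norm_intCast, Nat.cast_natAbs, Int.cast_abs]

/-- `S` and `M` determine `C⁻¹D = S/M`, hence the coset of `Γ_∞`; the sign of `det C` then singles
out the coset of `Γ_∞⁺`. -/
theorem coset_eq_of_mul_eq {q q' : Cosets n} {M : ℕ} [NeZero M] {S : SymMat n ℤ}
    (hC : (blkC q.out).det ≠ 0)
    (h : blkC q.out * S.1 = (M : ℤ) • blkD q.out)
    (h' : blkC q'.out * S.1 = (M : ℤ) • blkD q'.out)
    (hs : 0 < (blkC q.out).det ↔ 0 < (blkC q'.out).det) : q = q' := by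
  have hM : (M : ℤ) ≠ 0 := by exact_mod_cast NeZero.ne M
  have hmem : q'.out * q.out⁻¹ ∈ GamInf n := by
    rw [mem_GamInf, blkC_mul_inv]
    refine smul_right_injective _ hM ?_
    simp only [smul_sub, smul_zero]
    rw [← Matrix.mul_smul, ← Matrix.smul_mul, ← transpose_smul, ← h, ← h', transpose_mul,
      S.2.eq, Matrix.mul_assoc, sub_self]
  rw [← cosetMk_out q, ← cosetMk_out q', cosetMk_eq_iff]
  refine ⟨hmem, ?_⟩
  have h1 := congrArg Matrix.det (blkC_mul_of_mem hmem q.out)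
  rw [inv_mul_cancel_right, det_mul] at h1
  rcases det_blkD_eq hmem with h2 | h2
  · exact h2
  · rw [h2, neg_one_mul] at h1
    rcases lt_or_gt_of_ne hC with h3 | h3 <;> omega

open scoped ENNReal

/-- The summand `(ν(S) |det (S/M + i)|)⁻ᵏ`. -/
noncomputable def siegelTerm (k M : ℕ) [NeZero M] (S : SymMat n ℤ) : ℝ≥0∞ :=
  ENNReal.ofReal ((Nat.card (colSpace (S.1.map (Int.cast : ℤ → ZMod M))) : ℝ)⁻¹ ^ k)
    * ENNReal.ofReal (‖detAddI ((M : ℝ)⁻¹ • S.1.map (Int.cast : ℤ → ℝ))‖⁻¹ ^ k)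

/-- Write `S` as a residue plus `M T`. The first factor of the term depends only on the residue, and
the second, summed over `T`, is bounded uniformly in the shift. The bound must not depend on `M`,
which varies with the finite set of cosets considered next. -/
theorem exists_tsum_siegelTerm_le (n k : ℕ) (hk : n + 2 ≤ k) :
    ∃ B : ℝ≥0∞, B ≠ ⊤ ∧ ∀ (M : ℕ) [NeZero M], ∑' S : SymMat n ℤ, siegelTerm k M S ≤ B := by
  obtain ⟨C, hC, h⟩ := exists_tsum_detAddI_le n k hk
  refine ⟨ENNReal.ofReal (zetaTwo ^ (2 * n)) * C, ENNReal.mul_ne_top ENNReal.ofReal_ne_top hC, ?_⟩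
  intro M _
  have hM : (M : ℝ) ≠ 0 := by exact_mod_cast NeZero.ne M
  let lift : SymMat n (ZMod M) → SymMat n ℤ := fun S => ⟨S.1.map fun x => (x.val : ℤ), S.2.map _⟩
  let f : SymMat n (ZMod M) × SymMat n ℤ → SymMat n ℤ := fun x =>
    ⟨(lift x.1).1 + (M : ℤ) • x.2.1, (lift x.1).2.add (x.2.2.smul _)⟩
  have hred : ∀ x, (f x).1.map (Int.cast : ℤ → ZMod M) = x.1.1 := by
    intro x
    ext i j
    simp only [f, lift, Matrix.map_apply, Matrix.add_apply, Matrix.smul_apply, smul_eq_mul]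
    simp
  have hf : Function.Surjective f := by
    intro S
    have hd : ∀ i j, (M : ℤ) ∣ S.1 i j - ((S.1 i j : ZMod M).val : ℤ) := by
      intro i j
      rw [← ZMod.intCast_zmod_eq_zero_iff_dvd]
      simp
    choose T hT using hd
    have hTs : (Matrix.of T).IsSymm := by
      ext i j
      have h1 := hT i j
      have h2 := hT j i
      rw [S.2.apply] at h2
      have hM' : (M : ℤ) ≠ 0 := by exact_mod_cast NeZero.ne M
      exact mul_left_cancel₀ hM' (h2.symm.trans h1)
    refine ⟨(⟨S.1.map (Int.cast : ℤ → ZMod M), S.2.map _⟩, ⟨Matrix.of T, hTs⟩), ?_⟩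
    ext i j
    have := hT i j
    simp only [f, lift, Matrix.add_apply, Matrix.map_apply, Matrix.smul_apply, Matrix.of_apply,
      smul_eq_mul]
    omega
  refine (ENNReal.tsum_le_tsum_comp_of_surjective hf _).trans ?_
  rw [ENNReal.tsum_prod']
  have inner : ∀ S : SymMat n (ZMod M), ∑' T : SymMat n ℤ, siegelTerm k M (f (S, T))
      ≤ ENNReal.ofReal ((Nat.card (colSpace S.1) : ℝ)⁻¹ ^ k) * C := by
    intro S
    have hR : ((M : ℝ)⁻¹ • (lift S).1.map (Int.cast : ℤ → ℝ)).IsSymm := ((lift S).2.map _).smul _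
    refine le_trans ?_ (mul_le_mul_right (h ⟨_, hR⟩) _)
    rw [← ENNReal.tsum_mul_left]
    refine ENNReal.tsum_le_tsum fun T => le_of_eq ?_
    rw [siegelTerm, hred]
    congr 6
    ext i j
    simp only [f, Matrix.smul_apply, Matrix.map_apply, Matrix.add_apply, smul_eq_mul,
      Int.cast_add, Int.cast_mul, Int.cast_natCast, mul_add]
    rw [inv_mul_cancel_left₀ hM]
  refine (ENNReal.tsum_le_tsum inner).trans ?_
  rw [ENNReal.tsum_mul_right, tsum_fintype,
    ← ENNReal.ofReal_sum_of_nonneg fun _ _ => by positivity]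
  exact mul_le_mul_left (ENNReal.ofReal_le_ofReal (sum_card_colSpace_le n k hk M)) _

open Classical in
/-- The summand `|det (Ci + D)|⁻ᵏ`, restricted to the cosets with `det C ≠ 0`. -/
noncomputable def nonsingTerm (k : ℕ) (q : Cosets n) : ℝ≥0∞ :=
  if (blkC q.out).det ≠ 0 then ENNReal.ofReal ((absDet q)⁻¹ ^ k) else 0

/-- On a finite set of cosets the product `M` of the `|det C|` is a common denominator of the
`C⁻¹D`. The matrices `S = M C⁻¹D`, in two copies for the two signs of `det C`, separate the cosets.
-/
theorem tsum_nonsingTerm_ne_top (n k : ℕ) (hk : n + 2 ≤ k) :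
    ∑' q : Cosets n, nonsingTerm k q ≠ ⊤ := by
  classical
  obtain ⟨B, hB, h⟩ := exists_tsum_siegelTerm_le n k hk
  refine ne_top_of_le_ne_top (b := B + B) (ENNReal.add_ne_top.2 ⟨hB, hB⟩) ?_
  rw [ENNReal.tsum_eq_iSup_sum]
  refine iSup_le fun F => ?_
  set F' := F.filter fun q => (blkC q.out).det ≠ 0 with hF'
  have e1 : ∑ q ∈ F, nonsingTerm k q = ∑ q ∈ F', ENNReal.ofReal ((absDet q)⁻¹ ^ k) := by
    rw [hF', Finset.sum_filter]
    rfl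
  have hne : ∀ q ∈ F', (blkC q.out).det ≠ 0 := fun q hq => (Finset.mem_filter.1 hq).2
  set M : ℕ := ∏ q ∈ F', (blkC q.out).det.natAbs with hMdef
  have hM0 : M ≠ 0 := Finset.prod_ne_zero_iff.2 fun q hq => Int.natAbs_ne_zero.2 (hne q hq)
  have : NeZero M := ⟨hM0⟩
  have hex : ∀ q : F', ∃ S : SymMat n ℤ,
      blkC q.1.out * S.1 = (M : ℤ) • blkD q.1.out := fun q => by
    refine exists_symMat_of_dvd _ (hne q.1 q.2) ?_
    rw [← Int.natAbs_dvd_natAbs, Int.natAbs_natCast]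
    exact Finset.dvd_prod_of_mem (fun q : Cosets n => (blkC q.out).det.natAbs) q.2
  choose S hS using hex
  let g : F' → SymMat n ℤ ⊕ SymMat n ℤ := fun q =>
    if 0 < (blkC q.1.out).det then Sum.inl (S q) else Sum.inr (S q)
  have hg : Function.Injective g := by
    intro q q' hqq
    have key : S q = S q' ∧ (0 < (blkC q.1.out).det ↔ 0 < (blkC q'.1.out).det) := by
      simp only [g] at hqq
      split_ifs at hqq with h1 h2 h2
      · exact ⟨Sum.inl_injective hqq, by simp [h1, h2]⟩
      · exact ⟨Sum.inr_injective hqq, by simp [h1, h2]⟩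
    refine Subtype.ext (coset_eq_of_mul_eq (hne q.1 q.2) (hS q) ?_ key.2)
    rw [key.1]
    exact hS q'
  rw [e1, ← Finset.sum_coe_sort F', ← tsum_fintype (L := SummationFilter.unconditional _)]
  calc ∑' q : F', ENNReal.ofReal ((absDet q.1)⁻¹ ^ k)
      ≤ ∑' q : F', Sum.elim (siegelTerm k M) (siegelTerm k M) (g q) := by
        refine ENNReal.tsum_le_tsum fun q => ?_
        have e2 : Sum.elim (siegelTerm k M) (siegelTerm k M) (g q) = siegelTerm k M (S q) := by
          simp only [g]
          split_ifs <;> rfl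
        have hc : (0 : ℝ) < Nat.card (colSpace ((S q).1.map (Int.cast : ℤ → ZMod M))) := by
          exact_mod_cast card_colSpace_pos _
        rw [e2, absDet, norm_det_denom_eq_of_mul_eq (hS q), siegelTerm,
          ← ENNReal.ofReal_mul (by positivity), ← mul_pow, ← mul_inv]
        have hpos := norm_detAddI_pos (((S q).2.map (Int.cast : ℤ → ℝ)).smul (M : ℝ)⁻¹)
        refine ENNReal.ofReal_le_ofReal (pow_le_pow_left₀ (by positivity)
          (inv_anti₀ (by positivity) (mul_le_mul_of_nonneg_right ?_ hpos.le)) k)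
        exact_mod_cast card_colSpace_le_natAbs_det (hne q.1 q.2) (hS q)
    _ ≤ ∑' x : SymMat n ℤ ⊕ SymMat n ℤ, Sum.elim (siegelTerm k M) (siegelTerm k M) x :=
        ENNReal.tsum_comp_le_tsum_of_injective hg _
    _ = ∑' S : SymMat n ℤ, siegelTerm k M S + ∑' S : SymMat n ℤ, siegelTerm k M S := by
        rw [ENNReal.summable.tsum_sum ENNReal.summable]
        rfl
    _ ≤ B + B := add_le_add (h M) (h M)

/-- Convergence of the Siegel Eisenstein series at the point `i`, for `k > n + 1`. -/
theorem summable_absDet (n k : ℕ) (hk : n + 2 ≤ k) :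
    Summable fun q : Cosets n => (absDet q)⁻¹ ^ k := by
  set K : ℝ := n.factorial * (1 + 2 * n : ℝ) ^ n with hK
  have hK0 : 0 ≤ K := by positivity
  have hle : ∀ q : Cosets n, ENNReal.ofReal ((absDet q)⁻¹ ^ k)
      ≤ ∑ t : Fin (n + 1), ENNReal.ofReal (K ^ k) *
          nonsingTerm k (cosetEquiv (lowerShift n (t : ℕ)) q) := by
    intro q
    -- A suitable shift makes `det C` non-zero at the cost of the factor `K`. Each shift permutes
    -- the cosets, so each of the `n + 1` sums is a copy of the convergent one.
    obtain ⟨t, ht⟩ := exists_det_add_smul_ne_zero q.out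
    refine le_trans ?_ (Finset.single_le_sum (f := fun t : Fin (n + 1) => ENNReal.ofReal (K ^ k) *
          nonsingTerm k (cosetEquiv (lowerShift n (t : ℕ)) q)) (fun _ _ => zero_le)
          (Finset.mem_univ t))
    have h1 : cosetEquiv (lowerShift n (t : ℕ)) q = cosetMk (q.out * lowerShift n (t : ℕ)) := rfl
    have h2 : (blkC (cosetMk (q.out * lowerShift n (t : ℕ))).out).det ≠ 0 := by
      rw [det_blkC_out, blkC_mul_lowerShift]
      exact ht
    have h3 := absDet_pos (cosetMk (q.out * lowerShift n (t : ℕ)))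
    have h4 : absDet (cosetMk (q.out * lowerShift n (t : ℕ))) ≤ K * absDet q := by
      rw [absDet_mk]
      exact norm_det_denom_lowerShift_le q.out t
    simp only [h1, nonsingTerm, if_pos h2]
    rw [← ENNReal.ofReal_mul (by positivity), ← mul_pow]
    refine ENNReal.ofReal_le_ofReal (pow_le_pow_left₀ (inv_nonneg.2 (absDet_pos q).le) ?_ k)
    rw [← div_eq_mul_inv, inv_eq_one_div, div_le_div_iff₀ (absDet_pos q) h3]
    linarith
  have htop : ∑' q : Cosets n, ENNReal.ofReal ((absDet q)⁻¹ ^ k) ≠ ⊤ := by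
    refine ne_top_of_le_ne_top ?_ (ENNReal.tsum_le_tsum hle)
    rw [Summable.tsum_finsetSum fun _ _ => ENNReal.summable]
    refine ENNReal.sum_ne_top.2 fun t _ => ?_
    rw [ENNReal.tsum_mul_left, (cosetEquiv (lowerShift n (t : ℕ))).tsum_eq (nonsingTerm k)]
    exact ENNReal.mul_ne_top ENNReal.ofReal_ne_top (tsum_nonsingTerm_ne_top n k hk)
  have := ENNReal.summable_toReal htop
  refine this.congr fun q => ?_
  rw [ENNReal.toReal_ofReal (pow_nonneg (inv_nonneg.2 (absDet_pos q).le) k)]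

end Nonsingular

/-! ### Reduction modulo `N` and the congruence subgroups. -/

section Congruence

variable {n N : ℕ}

/-- Reduction modulo `N` of integral matrices. -/
def redMat (N : ℕ) : Matrix (Fin n) (Fin n) ℤ →+* Matrix (Fin n) (Fin n) (ZMod N) :=
  (Int.castRingHom (ZMod N)).mapMatrix

theorem redMat_apply (M : Matrix (Fin n) (Fin n) ℤ) (i j : Fin n) :
    redMat N M i j = ((M i j : ℤ) : ZMod N) := rfl

theorem redMat_transpose (M : Matrix (Fin n) (Fin n) ℤ) : redMat N Mᵀ = (redMat N M)ᵀ := rfl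

theorem det_redMat (M : Matrix (Fin n) (Fin n) ℤ) :
    (redMat N M).det = ((M.det : ℤ) : ZMod N) :=
  (RingHom.map_det (Int.castRingHom (ZMod N)) M).symm

theorem redMat_smul (m : ℤ) (M : Matrix (Fin n) (Fin n) ℤ) :
    redMat N (m • M) = (m : ZMod N) • redMat N M := by
  ext i j
  exact Int.cast_mul _ _

theorem mem_Gam_iff {γ : Sp n} : γ ∈ Gam n N ↔ redMat N (blkA γ) = 1 ∧ redMat N (blkB γ) = 0 ∧
    redMat N (blkC γ) = 0 ∧ redMat N (blkD γ) = 1 := by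
  have h : γ ∈ Gam n N ↔ (Int.castRingHom (ZMod N)).mapMatrix γ.1 = 1 := Iff.rfl
  rw [h, ← fromBlocks_blk γ, RingHom.mapMatrix_apply, fromBlocks_map, ← fromBlocks_one,
    fromBlocks_inj]
  rfl

instance Gam_normal : (Gam n N).Normal := by
  unfold Gam
  infer_instance

theorem mem_Gam0_iff {γ : Sp n} : γ ∈ Gam0 n N ↔ redMat N (blkC γ) = 0 := by
  refine ⟨fun h => ?_, fun h i j => ?_⟩
  · ext i j
    exact (ZMod.intCast_zmod_eq_zero_iff_dvd _ _).2 (h i j)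
  · exact (ZMod.intCast_zmod_eq_zero_iff_dvd _ _).1 (congrFun (congrFun h i) j)

theorem Gam_le_Gam0 : Gam n N ≤ Gam0 n N := fun _ h => mem_Gam0_iff.2 (mem_Gam_iff.1 h).2.2.1

theorem GamInf_le_Gam0 : GamInf n ≤ Gam0 n N := fun γ h => by
  rw [mem_Gam0_iff, mem_GamInf.1 h, map_zero]

theorem cast_det_blkD_mul {γ δ : Sp n} (hγ : γ ∈ Gam0 n N) :
    (((blkD (γ * δ)).det : ℤ) : ZMod N)
      = (((blkD γ).det : ℤ) : ZMod N) * (((blkD δ).det : ℤ) : ZMod N) := by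
  rw [← det_redMat, ← det_redMat, ← det_redMat, blkD_mul, map_add, map_mul, mem_Gam0_iff.1 hγ,
    zero_mul, zero_add, map_mul, det_mul]

theorem cast_det_blkD_of_mem_Gam {g : Sp n} (hg : g ∈ Gam n N) :
    (((blkD g).det : ℤ) : ZMod N) = 1 := by
  rw [← det_redMat, (mem_Gam_iff.1 hg).2.2.2, det_one]

theorem blkC_mul_translation (γ : Sp n) (T : SymMat n ℤ) :
    blkC (γ * translation T) = blkC γ := by
  have h1 : blkA (translation T) = 1 := rfl
  have h2 : blkC (translation T) = 0 := rfl
  rw [blkC_mul, h1, h2, Matrix.mul_one, Matrix.mul_zero, add_zero]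

theorem blkD_mul_translation (γ : Sp n) (T : SymMat n ℤ) :
    blkD (γ * translation T) = blkC γ * T.1 + blkD γ := by
  have h1 : blkB (translation T) = T.1 := rfl
  have h2 : blkD (translation T) = 1 := rfl
  rw [blkD_mul, h1, h2, Matrix.mul_one]

theorem translation_mem_Gam (T : SymMat n ℤ) (hT : redMat N T.1 = 0) : translation T ∈ Gam n N := by
  rw [mem_Gam_iff]
  refine ⟨map_one _, hT, map_zero _, map_one _⟩

theorem translation_mem_GamInf (T : SymMat n ℤ) : translation T ∈ GamInf n := rfl

theorem denom_mul_translation (γ : Sp n) (T : SymMat n ℤ) (τ : Matrix (Fin n) (Fin n) ℂ) :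
    denom (γ * translation T) τ = denom γ (τ + toC T.1) := by
  rw [denom, denom, blkC_mul_translation, blkD_mul_translation, toC_add, toC_mul, Matrix.mul_add]
  abel

end Congruence

/-! ### Eisenstein series over the cosets in `Γ_∞⁺ Γ(N) M`. -/

section CosetSums

variable {n : ℕ}

/-- The summand `det (Cτ + D)⁻ᵏ` of an Eisenstein series. -/
noncomputable def cosetTerm (k : ℕ) (q : Cosets n) (τ : Matrix (Fin n) (Fin n) ℂ) : ℂ :=
  (denom q.out τ).det ^ (-(k : ℤ))

theorem cosetTerm_mk (k : ℕ) (δ : Sp n) (τ : Matrix (Fin n) (Fin n) ℂ) :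
    cosetTerm k (cosetMk δ) τ = (denom δ τ).det ^ (-(k : ℤ)) := by
  obtain ⟨p, hp, h⟩ := exists_out_eq δ
  rw [cosetTerm, h, det_denom_mul_of_mem hp.1, hp.2, Int.cast_one, one_mul]

theorem zpow_neg_det_blkD (k : ℕ) {p : Sp n} (hp : p ∈ GamInf n) :
    ((blkD p).det : ℂ) ^ (-(k : ℤ)) = ((blkD p).det : ℂ) ^ k := by
  rcases det_blkD_eq hp with h | h <;> rw [h] <;>
    rcases Nat.even_or_odd k with h' | h' <;> simp [h'.neg_one_pow]

theorem norm_cosetTerm (k : ℕ) (q : Cosets n) (τ : Matrix (Fin n) (Fin n) ℂ) :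
    ‖cosetTerm k q τ‖ = ‖(denom q.out τ).det‖⁻¹ ^ k := by
  rw [cosetTerm, norm_zpow, _root_.zpow_neg, zpow_natCast, inv_pow]

/-- The cosets `Γ_∞⁺ δ` contained in `Γ_∞⁺ Γ(N) M`. -/
def cosetsIn (N : ℕ) (M : Sp n) : Set (Cosets n) := {q | ∃ g ∈ Gam n N, q = cosetMk (g * M)}

theorem starCosets_eq (n N : ℕ) : starCosets n N = cosetsIn N (1 : Sp n) := by
  ext q
  constructor
  · rintro ⟨_, ⟨p, hp, g, hg, rfl⟩, rfl⟩
    exact ⟨g, hg, by rw [mul_one]; exact cosetMk_mul_of_mem hp g⟩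
  · rintro ⟨g, hg, rfl⟩
    exact ⟨g, ⟨1, one_mem _, g, hg, one_mul g⟩, by rw [mul_one]⟩

theorem cosetEquiv_mk (g δ : Sp n) : cosetEquiv g (cosetMk δ) = cosetMk (δ * g) :=
  cosetMulRight_mk g δ

theorem cosetEquiv_mem_cosetsIn {N : ℕ} {M g : Sp n} {q : Cosets n} :
    cosetEquiv g q ∈ cosetsIn N (M * g) ↔ q ∈ cosetsIn N M := by
  constructor
  · rintro ⟨h, hh, e⟩
    refine ⟨h, hh, ?_⟩
    rw [← mul_assoc, ← cosetEquiv_mk] at e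
    exact (cosetEquiv g).injective e
  · rintro ⟨h, hh, rfl⟩
    exact ⟨h, hh, by rw [cosetEquiv_mk, mul_assoc]⟩

theorem cosetsIn_mul_left {N : ℕ} {g : Sp n} (hg : g ∈ Gam n N) (M : Sp n) :
    cosetsIn N (g * M) = cosetsIn N M := by
  ext q
  constructor
  · rintro ⟨h, hh, rfl⟩
    exact ⟨h * g, mul_mem hh hg, by rw [mul_assoc]⟩
  · rintro ⟨h, hh, rfl⟩
    exact ⟨h * g⁻¹, mul_mem hh (inv_mem hg), by group⟩

theorem cosetsIn_mul_right {N : ℕ} {g : Sp n} (hg : g ∈ Gam n N) (M : Sp n) :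
    cosetsIn N (M * g) = cosetsIn N M := by
  have : M * g = (M * g * M⁻¹) * M := by group
  rw [this, cosetsIn_mul_left (Gam_normal.conj_mem g hg M)]

/-- The Eisenstein series `∑ 1|δ` over the cosets `Γ_∞⁺ δ` contained in `Γ_∞⁺ Γ(N) M`. -/
noncomputable def cosetSum (N k : ℕ) (M : Sp n) (τ : Matrix (Fin n) (Fin n) ℂ) : ℂ :=
  ∑' q : Cosets n, (cosetsIn N M).indicator (fun q => cosetTerm k q τ) q

theorem cosetSum_mul_left {N : ℕ} (k : ℕ) {g : Sp n} (hg : g ∈ Gam n N) (M : Sp n) :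
    cosetSum N k (g * M) = cosetSum N k M := by
  unfold cosetSum
  rw [cosetsIn_mul_left hg]

/-- Termwise `(1|δ)|M = 1|δM`, and right multiplication by `M` permutes the cosets. -/
theorem slash_eisStar (N k : ℕ) (M : Sp n) {τ : Matrix (Fin n) (Fin n) ℂ}
    (h : IsUnit (denom M τ).det) : slash k (eisStar N k) M τ = cosetSum N k M τ := by
  have e : ∀ q : Cosets n, (denom M τ).det ^ (-(k : ℤ)) *
      slash k (fun _ => 1) q.out (num M τ * (denom M τ)⁻¹) = cosetTerm k (cosetEquiv M q) τ := by
    intro q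
    change slash k (slash k (fun _ => 1) q.out) M τ = _
    rw [slash_slash k _ _ _ h, slash, mul_one]
    exact (cosetTerm_mk k _ τ).symm
  rw [slash, eisStar, ← tsum_mul_left]
  simp only [e]
  rw [tsum_subtype (starCosets n N) (fun q => cosetTerm k (cosetEquiv M q) τ), cosetSum,
    ← (cosetEquiv M).tsum_eq (fun q => (cosetsIn N M).indicator (fun q => cosetTerm k q τ) q)]
  refine tsum_congr fun q => ?_
  have hmem : cosetEquiv M q ∈ cosetsIn N M ↔ q ∈ starCosets n N := by
    have := cosetEquiv_mem_cosetsIn (N := N) (M := 1) (g := M) (q := q)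
    rwa [one_mul, ← starCosets_eq] at this
  by_cases hq : q ∈ starCosets n N
  · rw [Set.indicator_of_mem hq, Set.indicator_of_mem (hmem.2 hq)]
  · rw [Set.indicator_of_notMem hq, Set.indicator_of_notMem (fun h => hq (hmem.1 h))]

/-- Left multiplication by `p ∈ Γ_∞` multiplies the coset sum by `(det D_p)ᵏ`. -/
theorem cosetSum_mul_left_of_mem {N : ℕ} (k : ℕ) {p : Sp n} (hp : p ∈ GamInf n) (M : Sp n)
    (τ : Matrix (Fin n) (Fin n) ℂ) :
    cosetSum N k (p * M) τ = ((blkD p).det : ℂ) ^ k * cosetSum N k M τ := by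
  have hconj : ∀ r ∈ GamInf n, ∀ δ δ' : Sp n, cosetMk δ = cosetMk δ' →
      cosetMk (r * δ) = cosetMk (r * δ') := by
    intro r hr δ δ' h
    rw [cosetMk_eq_iff] at h ⊢
    have e : r * δ' * (r * δ)⁻¹ = r * (δ' * δ⁻¹) * r⁻¹ := by group
    rw [e]
    refine ⟨mul_mem (mul_mem hr h.1) (inv_mem hr), ?_⟩
    have h1 := det_blkD_mul hr r⁻¹
    rw [mul_inv_cancel, blkD_one, det_one] at h1
    rw [det_blkD_mul (mul_mem hr h.1), det_blkD_mul hr, h.2, mul_one, ← h1]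
  let e : Cosets n ≃ Cosets n :=
    { toFun := fun q => cosetMk (p * q.out)
      invFun := fun q => cosetMk (p⁻¹ * q.out)
      left_inv := fun q => by
        refine (hconj p⁻¹ (inv_mem hp) _ (p * q.out) (cosetMk_out _)).trans ?_
        rw [inv_mul_cancel_left, cosetMk_out]
      right_inv := fun q => by
        refine (hconj p hp _ (p⁻¹ * q.out) (cosetMk_out _)).trans ?_
        rw [mul_inv_cancel_left, cosetMk_out] }
  have he : ∀ δ, e (cosetMk δ) = cosetMk (p * δ) := fun δ =>
    hconj p hp _ δ (cosetMk_out _)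
  have hmem : ∀ q, e q ∈ cosetsIn N (p * M) ↔ q ∈ cosetsIn N M := by
    intro q
    constructor
    · rintro ⟨g, hg, h⟩
      refine ⟨p⁻¹ * g * p, ?_, e.injective ?_⟩
      · simpa using Gam_normal.conj_mem g hg p⁻¹
      · rw [h, he]
        congr 1
        group
    · rintro ⟨g, hg, rfl⟩
      refine ⟨p * g * p⁻¹, Gam_normal.conj_mem g hg p, ?_⟩
      rw [he]
      congr 1
      group
  rw [cosetSum, ← e.tsum_eq, cosetSum, ← tsum_mul_left]
  refine tsum_congr fun q => ?_
  by_cases hq : q ∈ cosetsIn N M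
  · rw [Set.indicator_of_mem hq, Set.indicator_of_mem ((hmem q).2 hq)]
    change cosetTerm k (cosetMk (p * q.out)) τ = _
    rw [cosetTerm_mk, det_denom_mul_of_mem hp, mul_zpow, cosetTerm]
    rw [zpow_neg_det_blkD k hp]
  · rw [Set.indicator_of_notMem hq, Set.indicator_of_notMem (fun h => hq ((hmem q).1 h)), mul_zero]

/-- The translation by `T ≡ 0` lies in the normal subgroup `Γ(N)`, so right multiplication by it
preserves the index set. -/
theorem cosetSum_add_toC {N : ℕ} (k : ℕ) (M : Sp n) (T : SymMat n ℤ) (hT : redMat N T.1 = 0)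
    (τ : Matrix (Fin n) (Fin n) ℂ) :
    cosetSum N k M (τ + toC T.1) = cosetSum N k M τ := by
  have hg := translation_mem_Gam T hT
  rw [cosetSum, cosetSum, ← (cosetEquiv (translation T)).tsum_eq
    (fun q => (cosetsIn N M).indicator (fun q => cosetTerm k q τ) q)]
  refine tsum_congr fun q => ?_
  have hmem := cosetEquiv_mem_cosetsIn (N := N) (M := M) (g := translation T) (q := q)
  rw [cosetsIn_mul_right hg] at hmem
  by_cases hq : q ∈ cosetsIn N M
  · rw [Set.indicator_of_mem hq, Set.indicator_of_mem (hmem.2 hq)]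
    change _ = cosetTerm k (cosetMk (q.out * translation T)) τ
    rw [cosetTerm_mk, denom_mul_translation, cosetTerm]
  · rw [Set.indicator_of_notMem hq, Set.indicator_of_notMem (fun h => hq (hmem.1 h))]

end CosetSums

/-! ### Termwise passage to the limit. -/

section Limit

variable {n : ℕ}

theorem mem_atIInfty (c : ℝ) :
    {τ | τ ∈ halfSpace n ∧ (τ.map Complex.im - c • 1).PosSemidef} ∈ atIInfty n :=
  mem_iInf_of_mem c (mem_principal_self _)

/-- The integral part of `Re τ / N`, times `N`. -/
noncomputable def periodPart (N : ℕ) (τ : Matrix (Fin n) (Fin n) ℂ) : Matrix (Fin n) (Fin n) ℤ :=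
  (N : ℤ) • τ.map fun z => ⌊z.re / N⌋

theorem redMat_periodPart (N : ℕ) (τ : Matrix (Fin n) (Fin n) ℂ) :
    redMat N (periodPart N τ) = 0 := by
  rw [periodPart, redMat_smul, Int.cast_natCast, CharP.cast_eq_zero, zero_smul]

/-- The translate of `τ` by an integral multiple of `N` with real part in `[0, N]`. -/
noncomputable def reducePoint (N : ℕ) (τ : Matrix (Fin n) (Fin n) ℂ) :
    Matrix (Fin n) (Fin n) ℂ := τ - toC (periodPart N τ)

theorem reducePoint_map_im (N : ℕ) (τ : Matrix (Fin n) (Fin n) ℂ) :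
    (reducePoint N τ).map Complex.im = τ.map Complex.im := by
  ext i j
  simp [reducePoint, toC]

theorem reducePoint_mem (N : ℕ) {τ : Matrix (Fin n) (Fin n) ℂ} (hτ : τ ∈ halfSpace n) :
    reducePoint N τ ∈ halfSpace n := by
  refine ⟨hτ.1.sub (IsSymm.map (IsSymm.smul (hτ.1.map _) _) _), ?_⟩
  rw [reducePoint_map_im]
  exact hτ.2

theorem abs_re_reducePoint_le {N : ℕ} (hN : 0 < N) (τ : Matrix (Fin n) (Fin n) ℂ) (i j : Fin n) :
    |(reducePoint N τ i j).re| ≤ N := by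
  have hN' : (0 : ℝ) < N := by exact_mod_cast hN
  have h1 := Int.floor_le ((τ i j).re / N)
  have h2 := Int.lt_floor_add_one ((τ i j).re / N)
  rw [le_div_iff₀ hN'] at h1
  rw [div_lt_iff₀ hN'] at h2
  have e : (reducePoint N τ i j).re = (τ i j).re - N * ⌊(τ i j).re / N⌋ := by
    simp only [reducePoint, toC, periodPart, Matrix.sub_apply, Matrix.map_apply,
      Matrix.smul_apply, smul_eq_mul, Complex.sub_re, Complex.intCast_re]
    push_cast
    rfl
  rw [e, abs_le]
  constructor <;> nlinarith

theorem cosetSum_reducePoint {N : ℕ} (k : ℕ) (M : Sp n) {τ : Matrix (Fin n) (Fin n) ℂ}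
    (hτ : τ ∈ halfSpace n) : cosetSum N k M (reducePoint N τ) = cosetSum N k M τ := by
  have h := cosetSum_add_toC k M ⟨periodPart N τ, IsSymm.smul (hτ.1.map _) _⟩
    (redMat_periodPart N τ) (reducePoint N τ)
  rw [← h, reducePoint, sub_add_cancel]

theorem tendsto_norm_det_denom_reducePoint {N : ℕ} (hN : 0 < N) {γ : Sp n} (hγ : blkC γ ≠ 0) :
    Tendsto (fun τ => ‖(denom γ (reducePoint N τ)).det‖) (atIInfty n) atTop := by
  set K : ℝ := n.factorial * (1 + n * N : ℝ) ^ n with hK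
  have hK0 : 0 < K := by positivity
  refine tendsto_atTop.2 fun b => ?_
  obtain ⟨c, hcb, hc1⟩ := (((tendsto_norm_det_denom_imagPoint hγ).eventually_ge_atTop
    (K * b)).and (eventually_ge_atTop 1)).exists
  filter_upwards [mem_atIInfty c] with τ hτ
  have h := norm_det_denom_imagPoint_le γ (reducePoint_mem N hτ.1) hc1
    (by rw [reducePoint_map_im]; exact hτ.2) (abs_re_reducePoint_le hN τ)
  exact le_of_mul_le_mul_left (hcb.trans h) hK0

open Classical in
/-- The constant term of the summand belonging to a coset. -/
noncomputable def constTerm (k : ℕ) (q : Cosets n) : ℂ :=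
  if blkC q.out = 0 then ((blkD q.out).det : ℂ) ^ k else 0

/-- The limit at infinity of a coset sum, term by term. -/
theorem tendsto_cosetSum {N k : ℕ} (hN : 0 < N) (hk : n + 1 < k) (M : Sp n) :
    Tendsto (cosetSum N k M) (atIInfty n)
      (𝓝 (∑' q : Cosets n, (cosetsIn N M).indicator (constTerm k) q)) := by
  set K : ℝ := n.factorial * (1 + n * N : ℝ) ^ n with hK
  have hK0 : 0 < K := by positivity
  -- Only the imaginary part is controlled as `τ → i∞`. Periodicity brings the real part into a
  -- bounded range, where each term is dominated by a multiple of its value at `i`.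
  have hev : ∀ᶠ τ in atIInfty n, cosetSum N k M (reducePoint N τ) = cosetSum N k M τ := by
    filter_upwards [mem_atIInfty 1] with τ hτ
    exact cosetSum_reducePoint k M hτ.1
  refine Tendsto.congr' hev ?_
  refine tendsto_tsum_of_dominated_convergence (bound := fun q => K ^ k * (absDet q)⁻¹ ^ k)
    ((summable_absDet n k (by omega)).mul_left _) (fun q => ?_) ?_
  · by_cases hq : q ∈ cosetsIn N M
    · simp only [Set.indicator_of_mem hq]
      unfold constTerm
      split_ifs with hC
      · refine tendsto_const_nhds.congr fun τ => ?_
        rw [cosetTerm, denom, hC, toC_zero, Matrix.zero_mul, zero_add, det_toC,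
          zpow_neg_det_blkD k hC]
      · rw [tendsto_zero_iff_norm_tendsto_zero]
        simp only [norm_cosetTerm, inv_pow]
        exact tendsto_inv_atTop_zero.comp ((tendsto_pow_atTop (by omega)).comp
          (tendsto_norm_det_denom_reducePoint hN hC))
    · simp only [Set.indicator_of_notMem hq]
      exact tendsto_const_nhds
  · filter_upwards [mem_atIInfty 1] with τ hτ q
    refine (norm_indicator_le_norm_self _ _).trans ?_
    rw [norm_cosetTerm, ← mul_pow]
    refine pow_le_pow_left₀ (by positivity) ?_ k
    have h := norm_det_denom_imagPoint_le q.out (reducePoint_mem N hτ.1) le_rfl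
      (by rw [reducePoint_map_im]; exact hτ.2) (abs_re_reducePoint_le hN τ)
    have hpos : 0 < ‖(denom q.out (reducePoint N τ)).det‖ :=
      norm_pos_iff.2 (isUnit_det_denom _ (reducePoint_mem N hτ.1)).ne_zero
    have h0 := absDet_pos q
    rw [← div_eq_mul_inv, inv_eq_one_div, div_le_div_iff₀ hpos h0, one_mul]
    exact h

end Limit

/-! ### The constant term of a coset sum. -/

section ConstantTerm

variable {n N : ℕ}

theorem exists_eq_mul_of_mem_cosetsIn {M : Sp n} {q : Cosets n} (hq : q ∈ cosetsIn N M)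
    (hC : blkC q.out = 0) : ∃ g ∈ Gam n N, g * M ∈ GamInf n ∧ q = cosetMk (g * M) := by
  obtain ⟨g, hg, rfl⟩ := hq
  obtain ⟨p, hp, h⟩ := exists_out_eq (g * M)
  refine ⟨g, hg, ?_, rfl⟩
  have h1 : (cosetMk (g * M)).out ∈ GamInf n := hC
  rw [h] at h1
  exact (Subgroup.mul_mem_cancel_left _ hp.1).1 h1

theorem tsum_constTerm_eq_zero {k : ℕ} {M : Sp n}
    (hM : ¬ ∃ g ∈ Gam n N, ∃ p ∈ GamInf n, M = g * p) :
    ∑' q : Cosets n, (cosetsIn N M).indicator (constTerm k) q = 0 := by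
  have h0 : ∀ q : Cosets n, (cosetsIn N M).indicator (constTerm k) q = 0 := by
    intro q
    by_cases hq : q ∈ cosetsIn N M
    · rw [Set.indicator_of_mem hq, constTerm, if_neg]
      intro hC
      obtain ⟨g, hg, hp, -⟩ := exists_eq_mul_of_mem_cosetsIn hq hC
      exact hM ⟨g⁻¹, inv_mem hg, g * M, hp, by group⟩
    · rw [Set.indicator_of_notMem hq]
  simp only [h0, tsum_zero]

theorem constTerm_mk (k : ℕ) {p : Sp n} (hp : p ∈ GamInf n) :
    constTerm k (cosetMk p) = ((blkD p).det : ℂ) ^ k := by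
  obtain ⟨r, hr, h⟩ := exists_out_eq p
  rw [constTerm, h, if_pos, det_blkD_mul hr.1, hr.2, one_mul]
  exact mul_mem hr.1 hp

theorem cosetMk_eq_of_det_eq {p p' : Sp n} (hp : p ∈ GamInf n) (hp' : p' ∈ GamInf n)
    (h : (blkD p').det = (blkD p).det) : cosetMk p = cosetMk p' := by
  rw [cosetMk_eq_iff]
  have hm : p' * p⁻¹ ∈ GamInf n := mul_mem hp' (inv_mem hp)
  refine ⟨hm, ?_⟩
  have h1 := det_blkD_mul hm p
  rw [inv_mul_cancel_right, h] at h1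
  rcases det_blkD_eq hp with h2 | h2 <;> rw [h2] at h1 <;> omega

theorem det_blkD_eq_of_cosetMk_eq {p p' : Sp n}
    (h : cosetMk p = cosetMk p') : (blkD p').det = (blkD p).det := by
  rw [cosetMk_eq_iff] at h
  have h1 := det_blkD_mul h.1 p
  rwa [inv_mul_cancel_right, h.2, one_mul] at h1

/-- The diagonal matrix with entries `-1, 1, …, 1`. -/
def signDiag (n : ℕ) (i₀ : Fin n) : Matrix (Fin n) (Fin n) ℤ :=
  Matrix.diagonal fun i => if i = i₀ then -1 else 1

/-- The block diagonal element with blocks `diag (-1, 1, …, 1)`. -/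
def signElt (n : ℕ) (i₀ : Fin n) : Sp n := leviElt (signDiag n i₀) (signDiag n i₀) (by
  rw [signDiag, diagonal_transpose, diagonal_mul_diagonal, ← diagonal_one]
  congr 1
  ext i
  split_ifs <;> simp)

theorem signElt_mem (i₀ : Fin n) : signElt n i₀ ∈ GamInf n := rfl

theorem det_blkD_signElt (i₀ : Fin n) : (blkD (signElt n i₀)).det = -1 := by
  have : blkD (signElt n i₀) = signDiag n i₀ := rfl
  rw [this, signDiag, det_diagonal, Finset.prod_ite_eq' Finset.univ i₀]
  simp

theorem signElt_mem_Gam (hN : N ∣ 2) (i₀ : Fin n) : signElt n i₀ ∈ Gam n N := by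
  have h : redMat N (signDiag n i₀) = 1 := by
    have h2 : (-1 : ZMod N) = 1 := by
      have : ((2 : ℕ) : ZMod N) = 0 := (ZMod.natCast_eq_zero_iff _ _).2 hN
      rw [neg_eq_iff_add_eq_zero]
      rw [← this]
      norm_num
    ext i j
    rw [redMat_apply, signDiag]
    by_cases hij : i = j
    · subst hij
      rw [diagonal_apply_eq, one_apply_eq]
      split_ifs <;> simp [h2]
    · rw [diagonal_apply_ne _ hij, one_apply_ne hij, Int.cast_zero]
  rw [mem_Gam_iff]
  exact ⟨h, map_zero _, map_zero _, h⟩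

/-- The value at infinity of a coset sum over a coset which meets `Γ_∞`. -/
theorem tsum_constTerm_mul {k : ℕ} (hn : 0 < n) (hN : 0 < N) (hk : N ≤ 2 → Even k) {g p : Sp n}
    (hg : g ∈ Gam n N) (hp : p ∈ GamInf n) :
    ∑' q : Cosets n, (cosetsIn N (g * p)).indicator (constTerm k) q
      = (if N ≤ 2 then 2 else 1) * ((blkD p).det : ℂ) ^ k := by
  classical
  rw [cosetsIn_mul_left hg]
  have hpm : cosetMk p ∈ cosetsIn N p := ⟨1, one_mem _, by rw [one_mul]⟩
  have hcases : ∀ q ∈ cosetsIn N p, blkC q.out = 0 → ∃ r ∈ Gam n N, r ∈ GamInf n ∧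
      q = cosetMk (r * p) := by
    intro q hq hC
    obtain ⟨r, hr, hrp, rfl⟩ := exists_eq_mul_of_mem_cosetsIn hq hC
    exact ⟨r, hr, (Subgroup.mul_mem_cancel_right _ hp).1 hrp, rfl⟩
  split_ifs with h2
  -- Here `-1 ≡ 1` modulo `N`, so `ε ∈ Γ(N)` and the cosets of `p` and `εp` both occur; they
  -- contribute equally because `k` is even.
  · have hdvd : N ∣ 2 := by interval_cases N <;> decide
    set ε := signElt n ⟨0, hn⟩
    have hε : ε ∈ GamInf n := signElt_mem _
    have hεp : ε * p ∈ GamInf n := mul_mem hε hp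
    have hdet : (blkD (ε * p)).det = -(blkD p).det := by
      rw [det_blkD_mul hε, det_blkD_signElt, neg_one_mul]
    have hεm : cosetMk (ε * p) ∈ cosetsIn N p := ⟨ε, signElt_mem_Gam hdvd _, rfl⟩
    have hne : cosetMk p ≠ cosetMk (ε * p) := by
      intro h
      have := det_blkD_eq_of_cosetMk_eq h
      rw [hdet] at this
      rcases det_blkD_eq hp with h | h <;> rw [h] at this <;> omega
    rw [tsum_eq_sum (s := {cosetMk p, cosetMk (ε * p)}), Finset.sum_pair hne,
      Set.indicator_of_mem hpm, Set.indicator_of_mem hεm, constTerm_mk k hp, constTerm_mk k hεp,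
      hdet, Int.cast_neg, (hk h2).neg_pow, two_mul]
    intro q hq
    by_cases hqm : q ∈ cosetsIn N p
    · rw [Set.indicator_of_mem hqm, constTerm, if_neg]
      intro hC
      obtain ⟨r, hr, hr', rfl⟩ := hcases q hqm hC
      refine hq ?_
      rw [Finset.mem_insert, Finset.mem_singleton]
      rcases det_blkD_eq hr' with h | h
      · exact Or.inl (cosetMk_mul_of_mem ⟨hr', h⟩ p)
      · refine Or.inr (cosetMk_eq_of_det_eq (mul_mem hr' hp) hεp ?_)
        rw [hdet, det_blkD_mul hr', h, neg_one_mul]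
    · rw [Set.indicator_of_notMem hqm]
  · rw [tsum_eq_single (cosetMk p), Set.indicator_of_mem hpm, constTerm_mk k hp, one_mul]
    intro q hq
    by_cases hqm : q ∈ cosetsIn N p
    · rw [Set.indicator_of_mem hqm, constTerm, if_neg]
      intro hC
      obtain ⟨r, hr, hr', rfl⟩ := hcases q hqm hC
      rcases det_blkD_eq hr' with h | h
      · exact hq (cosetMk_mul_of_mem ⟨hr', h⟩ p)
      -- An element of `Γ(N)` with `det D = -1` would force `-1 ≡ 1` modulo `N`, that is `N ∣ 2`.
      · have h3 := cast_det_blkD_of_mem_Gam hr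
        rw [h] at h3
        have h4 : ((2 : ℕ) : ZMod N) = 0 := by
          push_cast at h3 ⊢
          rw [← one_add_one_eq_two]
          nth_rewrite 1 [← h3]
          exact neg_add_cancel 1
        have h5 := Nat.le_of_dvd two_pos ((ZMod.natCast_eq_zero_iff _ _).1 h4)
        exact h2 h5
    · rw [Set.indicator_of_notMem hqm]

end ConstantTerm

/-! ### Reflections adapted to a coprime symmetric pair. -/

section CoprimePair

variable {n : ℕ}

/-- For a coprime symmetric pair over a field some `CT + D` with `T` symmetric is invertible. -/
theorem exists_isSymm_det_ne_zero {F : Type*} [Field F] {A B C D : Matrix (Fin n) (Fin n) F}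
    (h1 : C * Dᵀ = D * Cᵀ) (h2 : D * Aᵀ - C * Bᵀ = 1) :
    ∃ T : Matrix (Fin n) (Fin n) F, T.IsSymm ∧ (C * T + D).det ≠ 0 := by
  classical
  let K : Matrix (Fin n) (Fin n) F → Submodule F (Fin n → F) :=
    fun T => LinearMap.ker (C * T + D).vecMulLinear
  have hK : ∀ T x, x ∈ K T ↔ x ᵥ* (C * T + D) = 0 := fun T x => Iff.rfl
  have hne : (K '' {T | T.IsSymm}).Nonempty := ⟨_, 0, isSymm_zero, rfl⟩
  -- Choose `T` with minimal left kernel of `CT + D`; a non-zero kernel is shrunk by a rank one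
  -- change of `T`.
  obtain ⟨_, ⟨T, hT, rfl⟩, hmin⟩ :=
    WellFounded.has_min (wellFounded_lt (α := Submodule F (Fin n → F))) _ hne
  refine ⟨T, hT, fun h0 => ?_⟩
  obtain ⟨x, hx0, hx⟩ := exists_vecMul_eq_zero_iff.2 h0
  set D' := C * T + D with hD'
  have hT' : Tᵀ = T := hT
  have h1' : C * D'ᵀ = D' * Cᵀ := by
    rw [hD', transpose_add, transpose_mul, hT', Matrix.mul_add, Matrix.add_mul, h1,
      Matrix.mul_assoc]
  have hc : x ᵥ* C ≠ 0 := by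
    intro hc
    refine hx0 ?_
    have hxD : x ᵥ* D = 0 := by
      rw [hD', vecMul_add, ← vecMul_vecMul, hc, zero_vecMul, zero_add] at hx
      exact hx
    rw [← vecMul_one x, ← h2, vecMul_sub, ← vecMul_vecMul, ← vecMul_vecMul, hc, hxD,
      zero_vecMul, zero_vecMul, sub_zero]
  obtain ⟨i, hi⟩ := Function.ne_iff.1 hc
  rw [Pi.zero_apply] at hi
  have hDc : D' *ᵥ (x ᵥ* C) = 0 := by
    rw [← mulVec_transpose, mulVec_mulVec, ← h1', ← mulVec_mulVec, mulVec_transpose, hx,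
      mulVec_zero]
  -- The index `i` has `(xC)_i ≠ 0`. Pairing with the vector `xC`, which `D'` kills, shows that the
  -- kernel for `T + E` lies in the old one; and `x` is no longer in it.
  let E : Matrix (Fin n) (Fin n) F := vecMulVec (Pi.single i 1) (Pi.single i 1)
  have hE : ∀ y : Fin n → F, y ᵥ* (C * (T + E) + D)
      = y ᵥ* D' + (y ᵥ* C) i • Pi.single i 1 := by
    intro y
    have e : C * (T + E) + D = D' + C * E := by rw [hD', Matrix.mul_add]; abel
    rw [e, vecMul_add, ← vecMul_vecMul, vecMul_vecMulVec, dotProduct_single, mul_one]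
  have hle : K (T + E) ≤ K T := by
    intro y hy
    rw [hK, hE] at hy
    rw [hK]
    have h3 : (y ᵥ* C) i = 0 := by
      have h4 := congrArg (fun z => z ⬝ᵥ (x ᵥ* C)) hy
      simp only [add_dotProduct, zero_dotProduct, smul_dotProduct, ← dotProduct_mulVec, hDc,
        dotProduct_zero, single_dotProduct, one_mul, zero_add, smul_eq_mul] at h4
      exact (mul_eq_zero.1 h4).resolve_right hi
    rwa [h3, zero_smul, add_zero] at hy
  refine hmin (K (T + E)) ⟨T + E, hT.add ?_, rfl⟩ (lt_of_le_of_ne hle fun he => ?_)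
  · exact transpose_vecMulVec _ _
  · have hxT : x ∈ K T := hx
    rw [← he, hK, hE, hx, zero_add] at hxT
    have := congrFun hxT i
    simp at this
    exact hi this

/-- A translation `T` making `D' = CT + D` invertible, with inverse `Q`, together with a reflection
`1 - w vᵀ` which respects the symmetric matrix `D'⁻¹ C`. -/
def IsReflectionDatum {R : Type*} [CommRing R] (C D T Q : Matrix (Fin n) (Fin n) R)
    (v w : Fin n → R) : Prop :=
  Tᵀ = T ∧ (C * T + D) * Q = 1 ∧ v ⬝ᵥ w = 2 ∧
    vecMulVec (C *ᵥ v) ((C * T + D) *ᵥ w) = vecMulVec ((C * T + D) *ᵥ w) (C *ᵥ v)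

/-- Every coprime symmetric pair over `R` has a reflection datum. -/
def HasReflections (n : ℕ) (R : Type*) [CommRing R] : Prop :=
  ∀ A B C D : Matrix (Fin n) (Fin n) R, C * Dᵀ = D * Cᵀ → D * Aᵀ - C * Bᵀ = 1 →
    ∃ T Q v w, IsReflectionDatum C D T Q v w

theorem HasReflections.exists_map {R S : Type*} [CommRing R] [CommRing S] (h : HasReflections n S)
    (f : R →+* S) {A B C D : Matrix (Fin n) (Fin n) R} (hCD : C * Dᵀ = D * Cᵀ)
    (hDA : D * Aᵀ - C * Bᵀ = 1) : ∃ T Q v w, IsReflectionDatum (C.map f) (D.map f) T Q v w := by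
  refine h (A.map f) (B.map f) (C.map f) (D.map f) ?_ ?_
  · rw [← transpose_map, ← transpose_map, ← Matrix.map_mul, ← Matrix.map_mul, hCD]
  · rw [← transpose_map, ← transpose_map, ← Matrix.map_mul, ← Matrix.map_mul,
      ← Matrix.map_sub f (map_sub f), hDA, Matrix.map_one f (map_zero f) (map_one f)]

theorem IsReflectionDatum.of_map {R S : Type*} [CommRing R] [CommRing S] {f : R →+* S}
    {C D T Q : Matrix (Fin n) (Fin n) R} {v w : Fin n → R}
    (h : IsReflectionDatum (C.map f) (D.map f) (T.map f) (Q.map f) (f ∘ v) (f ∘ w)) :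
    Tᵀ.map f = T.map f ∧ ((C * T + D) * Q).map f = (1 : Matrix (Fin n) (Fin n) R).map f ∧
      f (v ⬝ᵥ w) = f 2 ∧ (vecMulVec (C *ᵥ v) ((C * T + D) *ᵥ w)).map f
        = (vecMulVec ((C * T + D) *ᵥ w) (C *ᵥ v)).map f := by
  have hD : C.map f * T.map f + D.map f = (C * T + D).map f := by
    rw [Matrix.map_add f (map_add f), Matrix.map_mul]
  have hV : ∀ x y : Fin n → R, vecMulVec (f ∘ x) (f ∘ y) = (vecMulVec x y).map f := fun x y => by
    ext i j
    simp [vecMulVec_apply]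
  have hW : ∀ (M : Matrix (Fin n) (Fin n) R) (x : Fin n → R),
      M.map f *ᵥ (f ∘ x) = f ∘ (M *ᵥ x) := fun M x => by
    ext i
    exact (RingHom.map_mulVec f M x i).symm
  obtain ⟨h1, h2, h3, h4⟩ := h
  rw [hD, hW, hW, hV, hV] at h4
  refine ⟨h1, ?_, ?_, h4⟩
  · rw [Matrix.map_mul, ← hD, h2, Matrix.map_one f (map_zero f) (map_one f)]
  · rw [RingHom.map_dotProduct, h3, map_ofNat]

theorem isReflectionDatum_of_map {R R₁ R₂ : Type*} [CommRing R] [CommRing R₁] [CommRing R₂]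
    {f : R →+* R₁} {g : R →+* R₂} (hinj : ∀ a b, f a = f b → g a = g b → a = b)
    {C D T Q : Matrix (Fin n) (Fin n) R} {v w : Fin n → R}
    (h₁ : IsReflectionDatum (C.map f) (D.map f) (T.map f) (Q.map f) (f ∘ v) (f ∘ w))
    (h₂ : IsReflectionDatum (C.map g) (D.map g) (T.map g) (Q.map g) (g ∘ v) (g ∘ w)) :
    IsReflectionDatum C D T Q v w := by
  have hM : ∀ M M' : Matrix (Fin n) (Fin n) R, M.map f = M'.map f → M.map g = M'.map g →
      M = M' := fun M M' h h' => by
    ext i j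
    exact hinj _ _ (congrFun (congrFun h i) j) (congrFun (congrFun h' i) j)
  obtain ⟨h1, h2, h3, h4⟩ := h₁.of_map
  obtain ⟨h1', h2', h3', h4'⟩ := h₂.of_map
  exact ⟨hM _ _ h1 h1', hM _ _ h2 h2', hinj _ _ h3 h3', hM _ _ h4 h4'⟩

theorem HasReflections.of_ringEquiv_prod {R R₁ R₂ : Type*} [CommRing R] [CommRing R₁]
    [CommRing R₂] (e : R ≃+* R₁ × R₂) (h₁ : HasReflections n R₁) (h₂ : HasReflections n R₂) :
    HasReflections n R := by
  intro A B C D hCD hDA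
  let f : R →+* R₁ := (RingHom.fst R₁ R₂).comp e.toRingHom
  let g : R →+* R₂ := (RingHom.snd R₁ R₂).comp e.toRingHom
  let s : R₁ → R₂ → R := fun a b => e.symm (a, b)
  have hf : ∀ a b, f (s a b) = a := fun a b => congrArg Prod.fst (e.apply_symm_apply (a, b))
  have hg : ∀ a b, g (s a b) = b := fun a b => congrArg Prod.snd (e.apply_symm_apply (a, b))
  obtain ⟨T₁, Q₁, v₁, w₁, d₁⟩ := h₁.exists_map f hCD hDA
  obtain ⟨T₂, Q₂, v₂, w₂, d₂⟩ := h₂.exists_map g hCD hDA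
  refine ⟨of fun i j => s (T₁ i j) (T₂ i j), of fun i j => s (Q₁ i j) (Q₂ i j),
    fun i => s (v₁ i) (v₂ i), fun i => s (w₁ i) (w₂ i),
    isReflectionDatum_of_map (f := f) (g := g) (fun a b h h' => e.injective (Prod.ext h h')) ?_ ?_⟩
  · convert d₁ using 1 <;> ext <;> exact hf _ _
  · convert d₂ using 1 <;> ext <;> exact hg _ _

/-- Reflections exist over a ring whose elements are products of units and powers of `π`, and
whose non-units are the kernel of a homomorphism to a field. -/
theorem hasReflections_of_local {R F : Type*} [CommRing R] [Field F] (hn : 0 < n) {r : R →+* F}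
    (hr : Function.Surjective r) (hunit : ∀ x, r x ≠ 0 → IsUnit x) {π : R}
    (hπ : ∀ x, ∃ (j : ℕ) (u : R), IsUnit u ∧ x = π ^ j * u) (htwo : ∀ x, r x = 0 → 2 ∣ x) :
    HasReflections n R := by
  intro A B C D hCD hDA
  obtain ⟨T₀, hT₀, hdet⟩ := exists_isSymm_det_ne_zero (A := A.map r) (B := B.map r)
    (C := C.map r) (D := D.map r)
    (by rw [← transpose_map, ← transpose_map, ← Matrix.map_mul, ← Matrix.map_mul, hCD])
    (by rw [← transpose_map, ← transpose_map, ← Matrix.map_mul, ← Matrix.map_mul,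
      ← Matrix.map_sub r (map_sub r), hDA, Matrix.map_one r (map_zero r) (map_one r)])
  choose s hs using hr
  set T : Matrix (Fin n) (Fin n) R := T₀.map s with hT
  have hTT : Tᵀ = T := by rw [hT, ← transpose_map, hT₀.eq]
  have hTr : T.map r = T₀ := by
    ext i j
    exact hs _
  set D' := C * T + D with hD'
  have hu : IsUnit D'.det := by
    refine hunit _ ?_
    rw [RingHom.map_det, hD', RingHom.mapMatrix_apply, Matrix.map_add r (map_add r),
      Matrix.map_mul, hTr]
    exact hdet
  have h1 : C * D'ᵀ = D' * Cᵀ := by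
    rw [hD', transpose_add, transpose_mul, hTT, Matrix.mul_add, Matrix.add_mul, hCD,
      Matrix.mul_assoc]
  have hQ : D' * D'⁻¹ = 1 := mul_nonsing_inv _ hu
  have hQ' : D'⁻¹ * D' = 1 := nonsing_inv_mul _ hu
  set S := D'⁻¹ * C with hS
  have hC : C = D' * S := by rw [hS, ← Matrix.mul_assoc, hQ, Matrix.one_mul]
  have hSS : Sᵀ = S := by
    have h3 : D' * Sᵀ * D'ᵀ = D' * S * D'ᵀ := by
      have h2 : Sᵀ * D'ᵀ = Cᵀ := by rw [← transpose_mul, ← hC]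
      rw [← hC, h1, Matrix.mul_assoc, h2]
    have h4 := congrArg (fun M => D'⁻¹ * M * D'⁻¹ᵀ) h3
    have h5 : D'ᵀ * D'⁻¹ᵀ = 1 := by rw [← transpose_mul, hQ', transpose_one]
    simpa only [Matrix.mul_assoc, h5, Matrix.mul_one, ← Matrix.mul_assoc D'⁻¹ D', hQ',
      Matrix.one_mul] using h4
  -- Factoring `D'` out of the symmetry condition leaves one on the symmetric matrix `S = D'⁻¹C`: it
  -- suffices that `S v` and `w` be proportional.
  suffices h : ∃ v w : Fin n → R, v ⬝ᵥ w = 2 ∧ vecMulVec (S *ᵥ v) w = vecMulVec w (S *ᵥ v) by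
    obtain ⟨v, w, h3, h4⟩ := h
    refine ⟨T, D'⁻¹, v, w, hTT, hQ, h3, ?_⟩
    have h5 : ∀ x y : Fin n → R, vecMulVec (D' *ᵥ x) (D' *ᵥ y) = D' * vecMulVec x y * D'ᵀ := by
      intro x y
      rw [mul_vecMulVec, vecMulVec_mul, vecMul_transpose]
    have h6 : C *ᵥ v = D' *ᵥ (S *ᵥ v) := by rw [mulVec_mulVec, ← hC]
    rw [h6, h5, h5, h4]
  choose j u hju hx using hπ
  -- An entry with the smallest power of `π` is chosen, so that `S = π^m S'` with a unit among the
  -- entries of `S'`.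
  obtain ⟨⟨a, b⟩, -, hab⟩ := Finset.exists_min_image (Finset.univ : Finset (Fin n × Fin n))
    (fun q => j (S q.1 q.2)) ⟨(⟨0, hn⟩, ⟨0, hn⟩), Finset.mem_univ _⟩
  set m := j (S a b)
  let F' : R → R := fun x => π ^ (j x - m) * u x
  set S' : Matrix (Fin n) (Fin n) R := S.map F' with hS'
  have hSS' : S = π ^ m • S' := by
    ext i k
    have h3 : m ≤ j (S i k) := hab (i, k) (Finset.mem_univ _)
    rw [Matrix.smul_apply, hS', Matrix.map_apply, smul_eq_mul, ← mul_assoc, ← pow_add,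
      Nat.add_sub_cancel' h3]
    exact hx _
  have hT' : S'ᵀ = S' := by rw [hS', ← transpose_map, hSS]
  have hab' : IsUnit (S' a b) := by
    have : S' a b = u (S a b) := by
      change π ^ (j (S a b) - m) * u (S a b) = _
      rw [Nat.sub_self, pow_zero, one_mul]
    rw [this]
    exact hju _
  have hba : S' b a = S' a b := congrFun (congrFun hT' a) b
  -- Take `w = c S' v`: then `S v = π^m S' v` is proportional to `w`, and only the value `v ⬝ᵥ w =
  -- 2` remains.
  suffices h : ∃ (v : Fin n → R) (c : R), c * (v ⬝ᵥ S' *ᵥ v) = 2 by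
    obtain ⟨v, c, h⟩ := h
    refine ⟨v, c • (S' *ᵥ v), ?_, ?_⟩
    · rw [dotProduct_smul, smul_eq_mul, h]
    · rw [hSS', smul_mulVec]
      ext i k
      simp only [vecMulVec_apply, Pi.smul_apply, smul_eq_mul]
      ring
  have hdiag : ∀ i, (∃ c, c * S' i i = 2) → ∃ (v : Fin n → R) (c : R), c * (v ⬝ᵥ S' *ᵥ v) = 2 := by
    rintro i ⟨c, hc⟩
    refine ⟨Pi.single i 1, c, ?_⟩
    rw [mulVec_single_one, single_dotProduct, one_mul]
    exact hc
  have hcase : ∀ i, (∃ c, c * S' i i = 2) ∨ ∃ y, r y = 0 ∧ S' i i = 2 * y := by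
    intro i
    by_cases h3 : r (S' i i) = 0
    · obtain ⟨y, hy⟩ := htwo _ h3
      by_cases h4 : r y = 0
      · exact Or.inr ⟨y, h4, hy⟩
      · obtain ⟨z, hz⟩ := (hunit y h4).exists_left_inv
        exact Or.inl ⟨z, by rw [hy, mul_left_comm, hz, mul_one]⟩
    · obtain ⟨z, hz⟩ := (hunit _ h3).exists_left_inv
      exact Or.inl ⟨2 * z, by rw [mul_assoc, hz, mul_one]⟩
  rcases hcase a with h3 | ⟨y, hy, hya⟩
  · exact hdiag a h3
  rcases hcase b with h3 | ⟨z, hz, hzb⟩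
  · exact hdiag b h3
  -- No unit vector at `a` or `b` serves, so the two diagonal entries are `2y` and `2z` with `y`,
  -- `z` non-units. For `v = e_a + e_b` the form takes the value `2(y + z + S' a b)`, twice a unit.
  have h4 : r (y + z + S' a b) ≠ 0 := by
    rw [map_add, map_add, hy, hz, zero_add, zero_add]
    exact (hab'.map r).ne_zero
  obtain ⟨c, hc⟩ := (hunit _ h4).exists_left_inv
  refine ⟨Pi.single a 1 + Pi.single b 1, c, ?_⟩
  rw [mulVec_add, mulVec_single_one, mulVec_single_one, add_dotProduct, single_dotProduct,
    single_dotProduct, one_mul, one_mul]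
  simp only [Pi.add_apply, Matrix.col_apply]
  rw [hya, hzb, hba]
  linear_combination 2 * hc

theorem hasReflections_zmod_prime_pow (hn : 0 < n) {p e : ℕ} (hp : p.Prime) (he : 0 < e) :
    HasReflections n (ZMod (p ^ e)) := by
  have : Fact p.Prime := ⟨hp⟩
  have hpe : p ∣ p ^ e := dvd_pow_self p he.ne'
  have : NeZero (p ^ e) := ⟨(pow_pos hp.pos e).ne'⟩
  have hunit : ∀ m : ℕ, ¬ p ∣ m → IsUnit (m : ZMod (p ^ e)) := fun m hm =>
    (ZMod.isUnit_iff_coprime m (p ^ e)).2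
      (Nat.Coprime.pow_right e ((hp.coprime_iff_not_dvd.2 hm).symm))
  have hcast : ∀ x : ZMod (p ^ e), ZMod.castHom hpe (ZMod p) x = 0 → p ∣ x.val := by
    intro x h
    rw [← ZMod.natCast_zmod_val x, map_natCast] at h
    exact (ZMod.natCast_eq_zero_iff _ _).1 h
  refine hasReflections_of_local hn (r := ZMod.castHom hpe (ZMod p))
    (ZMod.castHom_surjective hpe) (π := (p : ZMod (p ^ e))) ?_ ?_ ?_
  · intro x hx
    rw [← ZMod.natCast_zmod_val x]
    refine hunit _ fun h => hx ?_
    rw [← ZMod.natCast_zmod_val x, map_natCast]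
    exact (ZMod.natCast_eq_zero_iff _ _).2 h
  · intro x
    by_cases hx : x.val = 0
    · refine ⟨e, 1, isUnit_one, ?_⟩
      rw [← ZMod.natCast_zmod_val x, hx, mul_one, ← Nat.cast_pow, ZMod.natCast_self, Nat.cast_zero]
    · obtain ⟨j, m, hm, h⟩ := Nat.exists_eq_pow_mul_and_not_dvd hx p hp.ne_one
      refine ⟨j, m, hunit m hm, ?_⟩
      rw [← ZMod.natCast_zmod_val x, h, Nat.cast_mul, Nat.cast_pow]
  · intro x hx
    obtain ⟨y, hy⟩ := hcast x hx
    rcases hp.eq_two_or_odd' with h2 | h2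
    · refine ⟨(y : ZMod (p ^ e)), ?_⟩
      rw [← ZMod.natCast_zmod_val x, hy, Nat.cast_mul, h2, Nat.cast_ofNat]
    · have : IsUnit ((2 : ℕ) : ZMod (p ^ e)) := hunit 2 fun h => by
        have := (Nat.prime_dvd_prime_iff_eq hp Nat.prime_two).1 h
        rw [this] at h2
        exact absurd h2 (by decide)
      rw [Nat.cast_ofNat] at this
      exact this.dvd

theorem hasReflections_zmod (hn : 0 < n) {N : ℕ} (hN : 0 < N) : HasReflections n (ZMod N) := by
  induction N using Nat.recOnPosPrimePosCoprime with
  | zero => exact absurd hN (lt_irrefl 0)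
  | one =>
    intro A B C D _ _
    exact ⟨0, 0, 0, 0, Subsingleton.elim _ _, Subsingleton.elim _ _, Subsingleton.elim _ _,
      Subsingleton.elim _ _⟩
  | prime_pow p e hp he => exact hasReflections_zmod_prime_pow hn hp he
  | coprime a b ha hb hab iha ihb =>
    exact HasReflections.of_ringEquiv_prod (ZMod.chineseRemainder hab) (iha (by omega))
      (ihb (by omega))

end CoprimePair

/-! ### Integral reflections and an element of determinant `-1`. -/

section Reflections

variable {n N : ℕ}

/-- An integral lift of a vector modulo `N`. -/
theorem exists_intCast_eq (v : Fin n → ZMod N) : ∃ v₀ : Fin n → ℤ, ∀ i, ((v₀ i : ℤ) : ZMod N) = v i :=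
  ⟨fun i => (v i).cast, fun _ => ZMod.intCast_zmod_cast _⟩

theorem exists_symMat_redMat_eq {M : Matrix (Fin n) (Fin n) (ZMod N)} (hM : Mᵀ = M) :
    ∃ T : SymMat n ℤ, redMat N T.1 = M :=
  ⟨⟨M.map fun x => (x.cast : ℤ), IsSymm.map hM _⟩, by
    ext i j
    exact ZMod.intCast_zmod_cast _⟩

theorem exists_dotProduct_eq_one_of_gcd {v : Fin n → ℤ} (hv : Finset.univ.gcd v = 1) :
    ∃ u : Fin n → ℤ, v ⬝ᵥ u = 1 := by
  have h : (1 : ℤ) ∈ Ideal.span (Set.range v) := by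
    obtain ⟨d, hd⟩ := (IsPrincipalIdealRing.principal (Ideal.span (Set.range v))).principal
    have hd' : Ideal.span (Set.range v) = Ideal.span {d} := hd
    have h1 : ∀ i, d ∣ v i := fun i => Ideal.mem_span_singleton.1 (by
      rw [← hd']
      exact Ideal.subset_span ⟨i, rfl⟩)
    rw [hd', Ideal.mem_span_singleton, ← hv]
    exact Finset.dvd_gcd fun i _ => h1 i
  obtain ⟨u, hu⟩ := (Ideal.mem_span_range_iff_exists_fun).1 h
  refine ⟨u, ?_⟩
  rw [dotProduct_comm]
  exact hu

/-- A reflection modulo `N` lifts to an integral reflection. -/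
theorem exists_reflection_lift (hN : 2 < N) {v w : Fin n → ZMod N} (h : v ⬝ᵥ w = 2) :
    ∃ U : Matrix (Fin n) (Fin n) ℤ, U * U = 1 ∧ U.det = -1 ∧
      redMat N U = 1 - vecMulVec v w := by
  obtain ⟨v₀, hv₀⟩ := exists_intCast_eq v
  obtain ⟨w₀, hw₀⟩ := exists_intCast_eq w
  have h2 : (2 : ZMod N) ≠ 0 := by
    intro h0
    have : ((2 : ℕ) : ZMod N) = 0 := by exact_mod_cast h0
    have := Nat.le_of_dvd two_pos ((ZMod.natCast_eq_zero_iff _ _).1 this)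
    omega
  have hne : v ≠ 0 := by
    rintro rfl
    rw [zero_dotProduct] at h
    exact h2 h.symm
  obtain ⟨i₀, -⟩ := Function.ne_iff.1 hne
  -- Writing `v₀ = e v'` with `v'` primitive and moving `e` to the other vector leaves the
  -- reflection unchanged modulo `N`. A vector `u` with `v'·u = 1` then corrects `e w₀`, by a
  -- multiple of `N`, so that the product is exactly `2`.
  obtain ⟨v', hv', hg⟩ := Finset.extract_gcd v₀ ⟨i₀, Finset.mem_univ i₀⟩
  set e := Finset.univ.gcd v₀
  obtain ⟨u, hu⟩ := exists_dotProduct_eq_one_of_gcd hg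
  have hsum : (((v' ⬝ᵥ (e • w₀) : ℤ)) : ZMod N) = 2 := by
    rw [← h]
    simp only [dotProduct, Pi.smul_apply, smul_eq_mul, Int.cast_sum, Int.cast_mul]
    refine Finset.sum_congr rfl fun i _ => ?_
    rw [← hv₀, ← hw₀, hv' i (Finset.mem_univ i), Int.cast_mul]
    ring
  set w₁ : Fin n → ℤ := e • w₀ + (2 - v' ⬝ᵥ (e • w₀)) • u with hw₁
  have hdot : v' ⬝ᵥ w₁ = 2 := by
    rw [hw₁, dotProduct_add, dotProduct_smul _ _ u, hu, smul_eq_mul, mul_one]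
    ring
  refine ⟨1 - vecMulVec v' w₁, ?_, ?_, ?_⟩
  · have : vecMulVec v' w₁ * vecMulVec v' w₁ = vecMulVec v' w₁ + vecMulVec v' w₁ := by
      rw [vecMulVec_mul_vecMulVec, dotProduct_comm, hdot]
      ext i j
      simp [vecMulVec_apply]
      ring
    rw [Matrix.sub_mul, Matrix.one_mul, Matrix.mul_sub, Matrix.mul_one, this]
    abel
  · rw [vecMulVec_eq Unit, det_one_sub_mul_comm]
    simp [dotProduct_comm w₁ v', hdot]
  · ext i j
    have h3 : ((w₁ j : ℤ) : ZMod N) = e * w j := by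
      rw [hw₁, Pi.add_apply, Pi.smul_apply, Pi.smul_apply, smul_eq_mul, smul_eq_mul]
      push_cast
      rw [hsum, hw₀]
      ring
    rw [redMat_apply, Matrix.sub_apply, Matrix.sub_apply, vecMulVec_apply, vecMulVec_apply,
      Int.cast_sub, Int.cast_mul, h3, ← hv₀, hv' i (Finset.mem_univ i)]
    rw [one_apply, one_apply]
    split_ifs <;> push_cast <;> ring

/-- An element of `Γ₀(N)` with `D ≡ 1` is a translation up to `Γ(N)`. -/
theorem exists_translation_mul {g : Sp n} (hC : redMat N (blkC g) = 0)
    (hD : redMat N (blkD g) = 1) : ∃ T : SymMat n ℤ, ∃ h ∈ Gam n N, g = translation T * h := by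
  obtain ⟨hAB, -, hAD⟩ := blk_relations g
  have hA : redMat N (blkA g) = 1 := by
    have := congrArg (redMat N) hAD
    rwa [map_sub, map_mul, map_mul, redMat_transpose, redMat_transpose, hC, hD, transpose_one,
      transpose_zero, Matrix.mul_one, Matrix.mul_zero, sub_zero, map_one] at this
  have hB : (redMat N (blkB g))ᵀ = redMat N (blkB g) := by
    have := congrArg (redMat N) hAB
    rwa [map_mul, map_mul, redMat_transpose, redMat_transpose, hA, transpose_one, Matrix.one_mul,
      Matrix.mul_one] at this
  obtain ⟨T, hT⟩ := exists_symMat_redMat_eq hB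
  refine ⟨T, (translation T)⁻¹ * g, ?_, by group⟩
  have e1 : blkA (translation T)⁻¹ = 1 := by rw [blkA_inv]; exact transpose_one
  have e2 : blkB (translation T)⁻¹ = -T.1 := by
    rw [blkB_inv]
    exact congrArg Neg.neg T.2
  have e3 : blkC (translation T)⁻¹ = 0 := by
    rw [blkC_inv]
    exact (congrArg Neg.neg transpose_zero).trans neg_zero
  have e4 : blkD (translation T)⁻¹ = 1 := by rw [blkD_inv]; exact transpose_one
  rw [mem_Gam_iff, blkA_mul, blkB_mul, blkC_mul, blkD_mul, e1, e2, e3, e4]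
  simp [hA, hC, hD, hT]

/-- For every `γ` there are `b ∈ Γ_∞` and `p ∈ Γ_∞` with `det D = -1` and
`γ b ∈ p Γ(N) γ`. -/
theorem exists_det_neg_one_mul_eq (hn : 0 < n) (hN : 2 < N) (γ : Sp n) :
    ∃ b ∈ GamInf n, ∃ p ∈ GamInf n, ∃ g ∈ Gam n N, γ * b = p * g * γ ∧
      (blkD b).det = -1 ∧ (blkD p).det = -1 := by
  have r1 := congrArg (redMat N) (blkC_mul_blkD_transpose γ)
  have r2 := congrArg (redMat N) (blkD_mul_blkA_transpose_sub γ)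
  rw [map_mul, map_mul, redMat_transpose, redMat_transpose] at r1
  rw [map_sub, map_mul, map_mul, redMat_transpose, redMat_transpose, map_one] at r2
  obtain ⟨T, Q, v, w, hT, hQ, hvw, hsymm⟩ := hasReflections_zmod hn (by omega) _ _ _ _ r1 r2
  obtain ⟨T₀, rfl⟩ := exists_symMat_redMat_eq hT
  set t := translation T₀
  set γ' := γ * t with hγ'
  rw [← map_mul, ← map_add, ← blkD_mul_translation] at hQ hsymm
  rw [← blkC_mul_translation γ T₀] at hsymm
  change vecMulVec (redMat N (blkC γ') *ᵥ v) (redMat N (blkD γ') *ᵥ w)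
    = vecMulVec (redMat N (blkD γ') *ᵥ w) (redMat N (blkC γ') *ᵥ v) at hsymm
  change redMat N (blkD γ') * Q = 1 at hQ
  have r3 := congrArg (redMat N) (blkC_mul_blkD_transpose γ')
  rw [map_mul, map_mul, redMat_transpose, redMat_transpose] at r3
  set C' := redMat N (blkC γ')
  set D' := redMat N (blkD γ')
  obtain ⟨R, hRR, hRdet, hR⟩ := exists_reflection_lift hN ((dotProduct_comm w v).trans hvw)
  have hRT : Rᵀ * Rᵀ = 1 := by rw [← transpose_mul, hRR, transpose_one]
  set b := leviElt Rᵀ R hRT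
  set h := γ' * b * γ'⁻¹ with hh
  have hhγ : h * γ' = γ' * b := by rw [hh]; group
  have hbA : blkA b = Rᵀ := rfl
  have hbB : blkB b = 0 := rfl
  have hbC : blkC b = 0 := rfl
  have hbD : blkD b = R := rfl
  -- The lower left block of `h` is `C'RᵀD'ᵀ - D'RC'ᵀ` with `R ≡ 1 - w vᵀ`; it vanishes modulo `N`
  -- by the symmetry of `C'D'ᵀ` and of `(C'v)(D'w)ᵀ`.
  have hhC : redMat N (blkC h) = 0 := by
    rw [hh, blkC_mul_inv, blkC_mul γ' b, blkD_mul γ' b, hbA, hbB, hbC, hbD, Matrix.mul_zero, Matrix.mul_zero,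
      add_zero, zero_add]
    simp only [map_sub, map_mul, redMat_transpose, hR]
    change C' * _ * D'ᵀ - D' * _ * C'ᵀ = 0
    rw [transpose_sub, transpose_one, transpose_vecMulVec, Matrix.mul_sub, Matrix.mul_sub,
      Matrix.mul_one, Matrix.mul_one, Matrix.sub_mul, Matrix.sub_mul, mul_vecMulVec,
      mul_vecMulVec, vecMulVec_mul, vecMulVec_mul, vecMul_transpose, vecMul_transpose, hsymm, r3,
      sub_self]
  -- So `D_h` is a conjugate reflection modulo `N`. It lifts to `W` of determinant `-1`, and
  -- dividing `h` by the block diagonal element of `W` leaves a translation up to `Γ(N)`.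
  have hhD : redMat N (blkD h) * D' = D' * (1 - vecMulVec w v) := by
    have := congrArg (fun x => redMat N (blkD x)) hhγ
    simp only [blkD_mul, map_add, map_mul, hhC, zero_mul, zero_add, hbB, hbD,
      mul_zero, hR] at this
    exact this
  have hhD' : redMat N (blkD h) = 1 - vecMulVec (D' *ᵥ w) (v ᵥ* Q) := by
    have := congrArg (· * Q) hhD
    simp only [Matrix.mul_assoc, hQ, Matrix.mul_one] at this
    rw [this, Matrix.sub_mul, Matrix.mul_sub, Matrix.one_mul, hQ, vecMulVec_mul, mul_vecMulVec]
  have hQ' : Q * D' = 1 := mul_eq_one_comm.1 hQ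
  obtain ⟨W, hWW, hWdet, hW⟩ := exists_reflection_lift hN (v := D' *ᵥ w) (w := v ᵥ* Q) (by
    rw [dotProduct_comm, ← dotProduct_mulVec, mulVec_mulVec, hQ', one_mulVec, hvw])
  have hWT : Wᵀ * Wᵀ = 1 := by rw [← transpose_mul, hWW, transpose_one]
  set p₀ := leviElt Wᵀ W hWT
  have hp₀ : p₀ ∈ GamInf n := rfl
  have hp₀D : blkD p₀⁻¹ = W := by rw [blkD_inv]; exact transpose_transpose W
  obtain ⟨T₁, g, hg, hpg⟩ := exists_translation_mul (N := N) (g := p₀⁻¹ * h)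
    (by rw [blkC_mul_of_mem (inv_mem hp₀), map_mul, hhC, mul_zero])
    (by rw [blkD_mul_of_mem (inv_mem hp₀), hp₀D, map_mul, hhD', ← hW, ← map_mul, hWW, map_one])
  have ht : t ∈ GamInf n := translation_mem_GamInf T₀
  have hb : b ∈ GamInf n := rfl
  refine ⟨t * b * t⁻¹, mul_mem (mul_mem ht hb) (inv_mem ht), p₀ * translation T₁,
    mul_mem hp₀ (translation_mem_GamInf T₁), g, hg, ?_, ?_, ?_⟩
  · have e : h = p₀ * (translation T₁ * g) := by rw [← hpg]; group
    have e' : γ * (t * b * t⁻¹) = h * γ := by rw [hh, hγ']; group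
    rw [e', e]
    group
  · rw [det_blkD_mul (mul_mem ht hb), det_blkD_mul ht, mul_right_comm, ← det_blkD_mul ht,
      mul_inv_cancel, blkD_one, det_one, one_mul]
    exact hRdet
  · rw [det_blkD_mul hp₀]
    have : blkD (translation T₁) = 1 := rfl
    rw [this, det_one, mul_one]
    exact hWdet

end Reflections

/-! ### Sums over cosets of a normal subgroup. -/

section Quotients

theorem mul_singleton_eq_iff {G : Type*} [Group G] (K : Subgroup G) (a b : G) :
    (K : Set G) * {a} = (K : Set G) * {b} ↔ a * b⁻¹ ∈ K := by
  have hmem : ∀ c y : G, y ∈ (K : Set G) * {c} ↔ y * c⁻¹ ∈ K := fun c y => by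
    rw [Set.mul_singleton, Set.image_mul_right, Set.mem_preimage, SetLike.mem_coe]
  constructor
  · intro h
    rw [← hmem, ← h, hmem, mul_inv_cancel]
    exact one_mem K
  · intro h
    ext y
    rw [hmem, hmem, show y * b⁻¹ = y * a⁻¹ * (a * b⁻¹) by group]
    exact (Subgroup.mul_mem_cancel_right K h).symm

variable {G : Type*} [Group G] (L : Subgroup G) [L.Normal] {φ : G → ℂ}

theorem apply_eq_of_mk_eq (hφ : ∀ g ∈ L, ∀ x, φ (g * x) = φ x) {x y : G}
    (h : (x : G ⧸ L) = y) : φ x = φ y := by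
  have h1 : x⁻¹ * y ∈ L := QuotientGroup.eq.1 h
  have h2 := ‹L.Normal›.conj_mem _ h1 x
  rw [← hφ _ h2 x]
  congr 1
  group

theorem sum_out_mul_right [Fintype (G ⧸ L)] (hφ : ∀ g ∈ L, ∀ x, φ (g * x) = φ x) (y : G) :
    ∑ c : G ⧸ L, φ (c.out * y) = ∑ c : G ⧸ L, φ c.out := by
  refine Eq.trans ?_ (Equiv.sum_comp (Equiv.mulRight (y : G ⧸ L)) fun c => φ c.out)
  refine Finset.sum_congr rfl fun c _ => apply_eq_of_mk_eq L hφ ?_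
  rw [QuotientGroup.mk_mul, QuotientGroup.out_eq', QuotientGroup.out_eq', Equiv.coe_mulRight]

theorem sum_out_mul_left [Fintype (G ⧸ L)] (hφ : ∀ g ∈ L, ∀ x, φ (g * x) = φ x) (y : G) :
    ∑ c : G ⧸ L, φ (y * c.out) = ∑ c : G ⧸ L, φ c.out := by
  refine Eq.trans ?_ (Equiv.sum_comp (Equiv.mulLeft (y : G ⧸ L)) fun c => φ c.out)
  refine Finset.sum_congr rfl fun c _ => apply_eq_of_mk_eq L hφ ?_
  rw [QuotientGroup.mk_mul, QuotientGroup.out_eq', QuotientGroup.out_eq', Equiv.coe_mulLeft]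

/-- A double sum over right cosets in a chain `L ≤ H ≤ K` as a sum over `G ⧸ L`. -/
theorem tsum_tsum_rightRel [Finite (G ⧸ L)] {H K : Subgroup G} (hLH : L ≤ H)
    (hφ : ∀ g ∈ L, ∀ x, φ (g * x) = φ x) (h0 : ∀ x ∉ K, φ x = 0) :
    ∑' q : Quotient (QuotientGroup.rightRel (H.subgroupOf K)),
      ∑' q' : Quotient (QuotientGroup.rightRel (L.subgroupOf H)),
        φ ((q'.out : G) * (q.out : G)) = ∑' c : G ⧸ L, φ c.out := by
  -- Left and right cosets of the normal subgroup `L` coincide, so pairs of representatives inject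
  -- into `G ⧸ L` by their product. The classes missed lie outside `K`, where `φ` vanishes.
  let Φ : Quotient (QuotientGroup.rightRel (H.subgroupOf K)) ×
      Quotient (QuotientGroup.rightRel (L.subgroupOf H)) → G ⧸ L :=
    fun q => (((q.2.out : G) * (q.1.out : G) : G) : G ⧸ L)
  have hΦ : Function.Injective Φ := by
    rintro ⟨q₁, r₁⟩ ⟨q₂, r₂⟩ h
    have h1 : ((r₁.out : G) * (q₁.out : G))⁻¹ * ((r₂.out : G) * (q₂.out : G)) ∈ L :=
      QuotientGroup.eq.1 h
    have h2 := ‹L.Normal›.conj_mem _ h1 ((r₁.out : G) * (q₁.out : G))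
    have hq : q₁ = q₂ := by
      rw [← Quotient.out_eq' q₁, ← Quotient.out_eq' q₂]
      refine Quotient.eq''.2 (QuotientGroup.rightRel_apply.2 ?_)
      rw [Subgroup.mem_subgroupOf]
      have h3 := mul_mem (mul_mem (inv_mem r₂.out.2) (hLH h2)) r₁.out.2
      have e : ((q₂.out * q₁.out⁻¹ : K) : G) = (r₂.out : G)⁻¹ * ((r₁.out : G) * (q₁.out : G) *
          (((r₁.out : G) * (q₁.out : G))⁻¹ * ((r₂.out : G) * (q₂.out : G))) *
          ((r₁.out : G) * (q₁.out : G))⁻¹) * (r₁.out : G) := by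
        push_cast
        group
      rw [e]
      exact h3
    subst hq
    refine Prod.ext rfl ?_
    change r₁ = r₂
    rw [← Quotient.out_eq' r₁, ← Quotient.out_eq' r₂]
    refine Quotient.eq''.2 (QuotientGroup.rightRel_apply.2 ?_)
    rw [Subgroup.mem_subgroupOf]
    have e : ((r₂.out * r₁.out⁻¹ : H) : G) = (r₁.out : G) * (q₁.out : G) *
          (((r₁.out : G) * (q₁.out : G))⁻¹ * ((r₂.out : G) * (q₁.out : G))) *
          ((r₁.out : G) * (q₁.out : G))⁻¹ := by
      push_cast
      group
    rw [e]
    exact h2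
  have hfin : Finite (Quotient (QuotientGroup.rightRel (H.subgroupOf K)) ×
      Quotient (QuotientGroup.rightRel (L.subgroupOf H))) := Finite.of_injective Φ hΦ
  have hsupp : Function.support (fun c : G ⧸ L => φ c.out) ⊆ Set.range Φ := by
    intro c hc
    have hK : c.out ∈ K := by
      by_contra h
      exact hc (h0 _ h)
    let x : K := ⟨c.out, hK⟩
    let q : Quotient (QuotientGroup.rightRel (H.subgroupOf K)) := Quotient.mk'' x
    have h1 : QuotientGroup.rightRel (H.subgroupOf K) q.out x := Quotient.mk_out x
    rw [QuotientGroup.rightRel_apply, Subgroup.mem_subgroupOf] at h1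
    let y : H := ⟨_, h1⟩
    let r : Quotient (QuotientGroup.rightRel (L.subgroupOf H)) := Quotient.mk'' y
    have h2 : QuotientGroup.rightRel (L.subgroupOf H) r.out y := Quotient.mk_out y
    rw [QuotientGroup.rightRel_apply, Subgroup.mem_subgroupOf] at h2
    refine ⟨(q, r), ?_⟩
    rw [← QuotientGroup.out_eq' c]
    refine QuotientGroup.eq.2 ?_
    have h3 := ‹L.Normal›.conj_mem _ h2 ((r.out : G) * (q.out : G))⁻¹
    have e : ((r.out : G) * (q.out : G))⁻¹ * c.out = ((r.out : G) * (q.out : G))⁻¹ *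
        ((y * r.out⁻¹ : H) : G) * ((r.out : G) * (q.out : G))⁻¹⁻¹ := by
      have : (y : G) = c.out * (q.out : G)⁻¹ := rfl
      push_cast
      rw [this]
      group
    rw [e]
    exact h3
  have := Fintype.ofFinite (G ⧸ L)
  have hs : Summable fun q : Quotient (QuotientGroup.rightRel (H.subgroupOf K)) ×
      Quotient (QuotientGroup.rightRel (L.subgroupOf H)) => φ ((q.2.out : G) * (q.1.out : G)) :=
    Summable.of_finite
  rw [← hs.tsum_prod, ← hΦ.tsum_eq hsupp]
  refine tsum_congr fun q => apply_eq_of_mk_eq L hφ ?_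
  rw [QuotientGroup.out_eq']

end Quotients

/-! ### `𝔼_γ` as an average over `Sp_n(ℤ)/Γ(N)`, and its limit. -/

section Averages

variable {n N : ℕ}

theorem finite_quotient_Gam (hN : 0 < N) : Finite (Sp n ⧸ Gam n N) := by
  have : NeZero N := ⟨hN.ne'⟩
  let F : Sp n →* Matrix (Fin n ⊕ Fin n) (Fin n ⊕ Fin n) (ZMod N) :=
    ((Int.castRingHom (ZMod N)).mapMatrix : Matrix (Fin n ⊕ Fin n) (Fin n ⊕ Fin n) ℤ →+* _)
      |>.toMonoidHom.comp (Matrix.symplecticGroup (Fin n) ℤ).subtype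
  have hfin : Finite (Matrix (Fin n ⊕ Fin n) (Fin n ⊕ Fin n) (ZMod N)) :=
    inferInstanceAs (Finite ((Fin n ⊕ Fin n) → (Fin n ⊕ Fin n) → ZMod N))
  refine Finite.of_injective (fun c : Sp n ⧸ Gam n N => F c.out) fun c d h => ?_
  rw [← QuotientGroup.out_eq' c, ← QuotientGroup.out_eq' d]
  refine QuotientGroup.eq.2 ?_
  have h' : F c.out = F d.out := h
  change F (c.out⁻¹ * d.out) = 1
  rw [map_mul, ← h', ← map_mul, inv_mul_cancel, map_one]

/-- As `Γ(N)` is normal, `P Γ(N)` is a subgroup, and equality of its right cosets is a membership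
condition on `γ b γ⁻¹`. -/
theorem mem_cosetStab_iff {P : Subgroup (Sp n)} {γ b : Sp n} : b ∈ cosetStab N P γ ↔
    b ∈ Gam0 n N ∧ ∃ p ∈ P, ∃ g ∈ Gam n N, γ * b = p * g * γ := by
  have h : b ∈ cosetStab N P γ ↔ b ∈ Gam0 n N ∧
    (P : Set (Sp n)) * (Gam n N : Set (Sp n)) * {γ * b}
      = (P : Set (Sp n)) * (Gam n N : Set (Sp n)) * {γ} := Iff.rfl
  have h' : γ * b * γ⁻¹ ∈ P ⊔ Gam n N ↔ γ * b * γ⁻¹ ∈ (P : Set (Sp n)) * (Gam n N : Set (Sp n)) := by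
    rw [← Subgroup.mul_normal, SetLike.mem_coe]
  rw [h, ← Subgroup.mul_normal, mul_singleton_eq_iff, h']
  refine and_congr_right fun _ => ⟨?_, ?_⟩
  · rintro ⟨p, hp, g, hg, e⟩
    exact ⟨p, hp, g, hg, eq_mul_of_mul_inv_eq e.symm⟩
  · rintro ⟨p, hp, g, hg, e⟩
    exact ⟨p, hp, g, hg, eq_mul_inv_of_mul_eq e.symm⟩

theorem cosetStab_le_Gam0 (P : Subgroup (Sp n)) (γ : Sp n) : cosetStab N P γ ≤ Gam0 n N :=
  fun _ h => h.1

theorem Gam_le_cosetStab (P : Subgroup (Sp n)) (γ : Sp n) : Gam n N ≤ cosetStab N P γ :=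
  fun g hg => mem_cosetStab_iff.2 ⟨Gam_le_Gam0 hg, 1, one_mem _, γ * g * γ⁻¹,
    Gam_normal.conj_mem g hg γ, by group⟩

variable (χ : DirichletCharacter ℂ N)

theorem chi_mul {γ : Sp n} (hγ : γ ∈ Gam0 n N) (δ : Sp n) :
    chi χ (γ * δ) = chi χ γ * chi χ δ := by
  rw [chi, cast_det_blkD_mul hγ, map_mul]
  rfl

theorem chi_of_mem_Gam {g : Sp n} (hg : g ∈ Gam n N) : chi χ g = 1 := by
  rw [chi, cast_det_blkD_of_mem_Gam hg, map_one]

open Classical in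
/-- The conjugate character on `Γ₀(N)`, extended by zero. -/
noncomputable def twist (x : Sp n) : ℂ := if x ∈ Gam0 n N then starRingEnd ℂ (chi χ x) else 0

theorem twist_of_mem {x : Sp n} (hx : x ∈ Gam0 n N) : twist χ x = starRingEnd ℂ (chi χ x) :=
  if_pos hx

theorem twist_of_notMem {x : Sp n} (hx : x ∉ Gam0 n N) : twist χ x = 0 := if_neg hx

theorem twist_mul_left {b : Sp n} (hb : b ∈ Gam0 n N) (x : Sp n) :
    twist χ (b * x) = starRingEnd ℂ (chi χ b) * twist χ x := by
  by_cases hx : x ∈ Gam0 n N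
  · rw [twist_of_mem χ hx, twist_of_mem χ (mul_mem hb hx), chi_mul χ hb, map_mul]
  · rw [twist_of_notMem χ hx, mul_zero,
      twist_of_notMem χ fun h => hx ((Subgroup.mul_mem_cancel_left _ hb).1 h)]

theorem twist_mul_right {b : Sp n} (hb : b ∈ Gam0 n N) (x : Sp n) :
    twist χ (x * b) = starRingEnd ℂ (chi χ b) * twist χ x := by
  by_cases hx : x ∈ Gam0 n N
  · rw [twist_of_mem χ hx, twist_of_mem χ (mul_mem hx hb), chi_mul χ hx, map_mul, mul_comm]
  · rw [twist_of_notMem χ hx, mul_zero,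
      twist_of_notMem χ fun h => hx ((Subgroup.mul_mem_cancel_right _ hb).1 h)]

theorem twist_mul_of_mem_Gam {g : Sp n} (hg : g ∈ Gam n N) (x : Sp n) :
    twist χ (g * x) = twist χ x := by
  rw [twist_mul_left χ (Gam_le_Gam0 hg), chi_of_mem_Gam χ hg, map_one, one_mul]

theorem cosetSum_conj_mul (k : ℕ) (γ δ : Sp n) {g : Sp n} (hg : g ∈ Gam n N) (x : Sp n) :
    cosetSum N k (γ * (g * x) * δ) = cosetSum N k (γ * x * δ) := by
  rw [← cosetSum_mul_left k (Gam_normal.conj_mem g hg γ) (γ * x * δ)]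
  congr 1
  group

/-- The transform of `𝔼_γ` by `δ` as an average over `Sp_n(ℤ) / Γ(N)`. -/
theorem slash_eis (hN : 0 < N) (k : ℕ) (γ δ : Sp n) {τ : Matrix (Fin n) (Fin n) ℂ}
    (hτ : τ ∈ halfSpace n) : slash k (eis k χ γ) δ τ
      = (((Gam n N).relIndex (Stab N γ) : ℕ) : ℂ)⁻¹ *
        ∑' c : Sp n ⧸ Gam n N, twist χ c.out * cosetSum N k (γ * c.out * δ) τ := by
  have := finite_quotient_Gam (n := n) hN
  have hle : Gam n N ≤ StabPlus N γ := Gam_le_cosetStab (GamInfPlus n) γ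
  rw [← tsum_tsum_rightRel (Gam n N) (H := StabPlus N γ) (K := Gam0 n N) hle
    (φ := fun x => twist χ x * cosetSum N k (γ * x * δ) τ)]
  · rw [slash, eis, mul_left_comm, eisPrime, ← tsum_mul_left]
    congr 1
    refine tsum_congr fun q => ?_
    rw [← tsum_mul_left]
    refine tsum_congr fun r => ?_
    have hq : (q.out : Sp n) ∈ Gam0 n N := q.out.2
    have hr : (r.out : Sp n) ∈ Gam0 n N := cosetStab_le_Gam0 _ γ r.out.2
    -- The character is evaluated at `δδ'` but the slash at `γδ'δ`; the order is immaterial since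
    -- `χ` is multiplicative on `Γ₀(N)`.
    rw [twist_of_mem χ (mul_mem hr hq), chi_mul χ hr, chi_mul χ hq, mul_comm (chi χ r.out.1),
      mul_left_comm]
    congr 1
    change slash k (slash k (eisStar N k) _) δ τ = _
    rw [slash_slash k _ _ _ (isUnit_det_denom δ hτ), slash_eisStar _ _ _ (isUnit_det_denom _ hτ),
      ← mul_assoc γ]
  · intro g hg x
    simp only [twist_mul_of_mem_Gam χ hg, cosetSum_conj_mul k γ δ hg]
  · intro x hx
    simp only [twist_of_notMem χ hx, zero_mul]

theorem slash_one (k : ℕ) (F : Matrix (Fin n) (Fin n) ℂ → ℂ) (τ : Matrix (Fin n) (Fin n) ℂ) :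
    slash k F 1 τ = F τ := by
  have hA : blkA (1 : Sp n) = 1 := by
    have := blkA_inv (1 : Sp n)
    rwa [inv_one, blkD_one, transpose_one] at this
  have hB : blkB (1 : Sp n) = 0 := by
    have h : blkB (1 : Sp n) = (1 : Matrix (Fin n ⊕ Fin n) (Fin n ⊕ Fin n) ℤ).toBlocks₁₂ := rfl
    rw [h, ← fromBlocks_one, toBlocks_fromBlocks₁₂]
  simp [slash, denom, num, blkC_one, blkD_one, hA, hB, toC_zero, toC_one]

/-- If `𝔼_γ` does not vanish identically, the character and the weight are compatible on the
stabiliser of the coset of `γ`. -/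
theorem conj_chi_mul_eq_one (hN : 0 < N) {k : ℕ} {γ : Sp n}
    (hE : ∃ τ ∈ halfSpace n, eis k χ γ τ ≠ 0) {b p g : Sp n} (hb : b ∈ Gam0 n N)
    (hp : p ∈ GamInf n) (hg : g ∈ Gam n N) (h : γ * b = p * g * γ) :
    starRingEnd ℂ (chi χ b) * ((blkD p).det : ℂ) ^ k = 1 := by
  have := finite_quotient_Gam (n := n) hN
  have := Fintype.ofFinite (Sp n ⧸ Gam n N)
  obtain ⟨τ, hτ, hne⟩ := hE
  have h1 := slash_eis χ hN k γ 1 hτ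
  rw [slash_one, tsum_fintype] at h1
  -- Left multiplication by `b` permutes the classes, and `γ b = p g γ` pulls `(det D_p)ᵏ` out of
  -- every coset sum. The sum therefore equals a multiple of itself, and it is non-zero.
  have h2 : ∑ c : Sp n ⧸ Gam n N, twist χ c.out * cosetSum N k (γ * c.out * 1) τ
      = starRingEnd ℂ (chi χ b) * ((blkD p).det : ℂ) ^ k *
        ∑ c : Sp n ⧸ Gam n N, twist χ c.out * cosetSum N k (γ * c.out * 1) τ := by
    rw [Finset.mul_sum, ← sum_out_mul_left (Gam n N)
      (φ := fun x => twist χ x * cosetSum N k (γ * x * 1) τ) _ b]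
    · refine Finset.sum_congr rfl fun c _ => ?_
      have e : γ * (b * c.out) * 1 = p * (g * (γ * c.out * 1)) := by
        rw [← mul_assoc γ, h]
        group
      rw [twist_mul_left χ hb, e, cosetSum_mul_left_of_mem k hp, cosetSum_mul_left k hg]
      ring
    · intro g hg x
      simp only [twist_mul_of_mem_Gam χ hg, cosetSum_conj_mul k γ 1 hg]
  have hne' : ∑ c : Sp n ⧸ Gam n N, twist χ c.out * cosetSum N k (γ * c.out * 1) τ ≠ 0 := by
    intro h0
    rw [h0, mul_zero] at h1
    exact hne h1
  exact (mul_right_cancel₀ hne' (h2.symm.trans (one_mul _).symm))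

/-- The constant term at infinity of a coset sum. -/
noncomputable def cosetLimit (N k : ℕ) (M : Sp n) : ℂ :=
  ∑' q : Cosets n, (cosetsIn N M).indicator (constTerm k) q

theorem cosetLimit_mul_left (k : ℕ) {g : Sp n} (hg : g ∈ Gam n N) (M : Sp n) :
    cosetLimit N k (g * M) = cosetLimit N k M := by
  unfold cosetLimit
  rw [cosetsIn_mul_left hg]

theorem tendsto_slash_eis (hN : 0 < N) {k : ℕ} (hk : n + 1 < k) (γ δ : Sp n) :
    Tendsto (slash k (eis k χ γ) δ) (atIInfty n)
      (𝓝 ((((Gam n N).relIndex (Stab N γ) : ℕ) : ℂ)⁻¹ *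
        ∑' c : Sp n ⧸ Gam n N, twist χ c.out * cosetLimit N k (γ * c.out * δ))) := by
  have := finite_quotient_Gam (n := n) hN
  have := Fintype.ofFinite (Sp n ⧸ Gam n N)
  have hev : ∀ᶠ τ in atIInfty n, (((Gam n N).relIndex (Stab N γ) : ℕ) : ℂ)⁻¹ *
      ∑ c : Sp n ⧸ Gam n N, twist χ c.out * cosetSum N k (γ * c.out * δ) τ
      = slash k (eis k χ γ) δ τ := by
    filter_upwards [mem_atIInfty 1] with τ hτ
    rw [slash_eis χ hN k γ δ hτ.1, tsum_fintype]
  refine Tendsto.congr' hev ?_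
  rw [tsum_fintype]
  exact (tendsto_finsetSum _ fun c _ => (tendsto_cosetSum hN hk _).const_mul _).const_mul _

theorem relIndex_Gam_Stab (γ : Sp n) [Fintype (Sp n ⧸ Gam n N)]
    [DecidablePred fun c : Sp n ⧸ Gam n N => c.out ∈ Stab N γ] :
    (Gam n N).relIndex (Stab N γ)
      = (Finset.univ.filter fun c : Sp n ⧸ Gam n N => c.out ∈ Stab N γ).card := by
  have h := Subgroup.relIndex_ker (Stab N γ) (QuotientGroup.mk' (Gam n N))
  rw [QuotientGroup.ker_mk'] at h
  rw [h]
  refine Nat.subtype_card _ fun c => ?_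
  rw [Finset.mem_filter, Subgroup.mem_map]
  refine ⟨fun hc => ⟨c.out, hc.2, QuotientGroup.out_eq' c⟩, ?_⟩
  rintro ⟨x, hx, rfl⟩
  refine ⟨Finset.mem_univ _, ?_⟩
  have h1 : x⁻¹ * ((x : Sp n ⧸ Gam n N)).out ∈ Gam n N :=
    QuotientGroup.eq.1 (QuotientGroup.out_eq' _).symm
  have h2 := mul_mem hx (Gam_le_cosetStab (GamInf n) γ h1)
  rwa [mul_inv_cancel_left] at h2

/-- The sign element `ε` lies in both `Γ_∞` and `Γ(N)`, so the compatibility relation with `b = 1`,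
`p = ε`, `g = ε⁻¹` reads `(-1)ᵏ = 1`. -/
theorem even_weight (hn : 0 < n) (hN : 0 < N) (hN2 : N ≤ 2) {k : ℕ} {γ : Sp n}
    (hE : ∃ τ ∈ halfSpace n, eis k χ γ τ ≠ 0) : Even k := by
  have hdvd : N ∣ 2 := by interval_cases N <;> decide
  have h := conj_chi_mul_eq_one χ hN hE (one_mem _) (signElt_mem ⟨0, hn⟩)
    (inv_mem (signElt_mem_Gam hdvd ⟨0, hn⟩)) (by group)
  rw [det_blkD_signElt, chi_of_mem_Gam χ (one_mem _), map_one, one_mul] at h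
  by_contra hk
  rw [Nat.not_even_iff_odd] at hk
  push_cast at h
  rw [hk.neg_one_pow] at h
  norm_num at h

/-- For `N > 2` the conjugate character and the `k`-th power of `det D` agree on `Γ_∞`. -/
theorem conj_chi_of_mem_GamInf (hn : 0 < n) (hN : 2 < N) {k : ℕ} {γ : Sp n}
    (hE : ∃ τ ∈ halfSpace n, eis k χ γ τ ≠ 0) {β : Sp n} (hβ : β ∈ GamInf n) :
    starRingEnd ℂ (chi χ β) = ((blkD β).det : ℂ) ^ k := by
  rcases det_blkD_eq hβ with h | h
  · rw [chi, h]
    simp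
  -- `χ(β)` depends only on `det D_β = -1`, so `β` may be replaced by the special `b`, to which the
  -- compatibility relation applies.
  · obtain ⟨b, hb, p, hp, g, hg, e, hbd, hpd⟩ := exists_det_neg_one_mul_eq hn hN γ
    have h1 := conj_chi_mul_eq_one χ (by omega) hE (GamInf_le_Gam0 hb) hp hg e
    have h2 : chi χ β = chi χ b := by rw [chi, chi, h, hbd]
    rw [hpd] at h1
    rw [h2, h]
    push_cast at h1 ⊢
    rcases Nat.even_or_odd k with h' | h' <;> rw [h'.neg_one_pow] at h1 ⊢
    · linear_combination h1
    · linear_combination -h1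

theorem chi_eq_one_of_le_two (hN : 0 < N) (hN2 : N ≤ 2) {δ : Sp n} (hδ : δ ∈ Gam0 n N) :
    chi χ δ = 1 := by
  have h := cast_det_blkD_mul (δ := δ⁻¹) hδ
  rw [mul_inv_cancel, blkD_one, det_one, Int.cast_one] at h
  have hu : ∀ x y : ZMod N, 1 = x * y → x = 1 := by
    interval_cases N <;> decide
  rw [chi, hu _ _ h, map_one]

/-- Put `c = xδ`. Then `γ c (βγδ)⁻¹ = γxγ⁻¹β⁻¹`, which for `x ∈ Γ₀(N)` lies in `Γ(N)Γ_∞` exactly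
when `x ∈ Γ_γ`. By `conj_chi_mul_eq_one` the twist of such an `x` cancels its `(det D_p)ᵏ`, so all
contribute equally and their number cancels the index. -/
theorem sum_twist_mul_cosetLimit (hn : 0 < n) (hN : 0 < N) {k : ℕ} {γ : Sp n}
    (hE : ∃ τ ∈ halfSpace n, eis k χ γ τ ≠ 0) {β δ : Sp n} (hβ : β ∈ GamInf n)
    (hδ : δ ∈ Gam0 n N) :
    (((Gam n N).relIndex (Stab N γ) : ℕ) : ℂ)⁻¹ *
        ∑' c : Sp n ⧸ Gam n N, twist χ c.out * cosetLimit N k (γ * c.out * (β * γ * δ)⁻¹)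
      = starRingEnd ℂ (chi χ δ) * ((if N ≤ 2 then 2 else 1) * ((blkD β).det : ℂ) ^ k) := by
  classical
  have := finite_quotient_Gam (n := n) hN
  have := Fintype.ofFinite (Sp n ⧸ Gam n N)
  have hinv : ∀ g ∈ Gam n N, ∀ x, twist χ (g * x) * cosetLimit N k (γ * (g * x) * (β * γ * δ)⁻¹)
      = twist χ x * cosetLimit N k (γ * x * (β * γ * δ)⁻¹) := by
    intro g hg x
    rw [twist_mul_of_mem_Gam χ hg,
      ← cosetLimit_mul_left k (Gam_normal.conj_mem g hg γ) (γ * x * (β * γ * δ)⁻¹)]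
    congr 2
    group
  have hβ' : ((blkD β⁻¹).det : ℂ) ^ k = ((blkD β).det : ℂ) ^ k := by
    have h1 := det_blkD_mul hβ β⁻¹
    rw [mul_inv_cancel, blkD_one, det_one] at h1
    congr 2
    rcases det_blkD_eq hβ with h | h <;> rw [h] at h1 ⊢ <;> omega
  have hterm : ∀ x : Sp n, twist χ (x * δ) * cosetLimit N k (γ * (x * δ) * (β * γ * δ)⁻¹)
      = if x ∈ Stab N γ then
        starRingEnd ℂ (chi χ δ) * ((if N ≤ 2 then 2 else 1) * ((blkD β).det : ℂ) ^ k) else 0 := by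
    intro x
    rw [twist_mul_right χ hδ, show γ * (x * δ) * (β * γ * δ)⁻¹ = γ * x * γ⁻¹ * β⁻¹ by group]
    by_cases hx : x ∈ Gam0 n N
    · by_cases hs : x ∈ Stab N γ
      · rw [if_pos hs]
        obtain ⟨-, p, hp, g, hg, e⟩ := mem_cosetStab_iff.1 hs
        have e' : γ * x * γ⁻¹ * β⁻¹ = (p * g * p⁻¹) * (p * β⁻¹) := by
          rw [e]
          group
        have h1 := conj_chi_mul_eq_one χ hN hE hx hp hg e
        rw [e', cosetLimit, tsum_constTerm_mul hn hN (fun h2 => even_weight χ hn hN h2 hE)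
          (Gam_normal.conj_mem g hg p) (mul_mem hp (inv_mem hβ)), det_blkD_mul hp,
          twist_of_mem χ hx, Int.cast_mul, mul_pow, hβ']
        generalize (if N ≤ 2 then (2 : ℂ) else 1) = m
        linear_combination (starRingEnd ℂ (chi χ δ) * (m * ((blkD β).det : ℂ) ^ k)) * h1
      · rw [if_neg hs, cosetLimit, tsum_constTerm_eq_zero, mul_zero]
        rintro ⟨g, hg, p, hp, e⟩
        refine hs (mem_cosetStab_iff.2 ⟨hx, p * β, mul_mem hp hβ, (p * β)⁻¹ * g * (p * β), ?_, ?_⟩)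
        · simpa using Gam_normal.conj_mem g hg (p * β)⁻¹
        · have e' : γ * x = (γ * x * γ⁻¹ * β⁻¹) * β * γ := by group
          rw [e', e]
          group
    · rw [twist_of_notMem χ hx, if_neg fun hs : x ∈ Stab N γ => hx (cosetStab_le_Gam0 _ γ hs), mul_zero,
        zero_mul]
  rw [tsum_fintype, ← sum_out_mul_right (Gam n N)
    (φ := fun x => twist χ x * cosetLimit N k (γ * x * (β * γ * δ)⁻¹)) hinv δ]
  simp only [hterm]
  rw [← Finset.sum_filter, Finset.sum_const, ← relIndex_Gam_Stab, nsmul_eq_mul,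
    inv_mul_cancel_left₀]
  rw [relIndex_Gam_Stab, Nat.cast_ne_zero, ← Nat.pos_iff_ne_zero, Finset.card_pos]
  refine ⟨((1 : Sp n) : Sp n ⧸ Gam n N), Finset.mem_filter.2 ⟨Finset.mem_univ _, ?_⟩⟩
  have h1 : (1 : Sp n)⁻¹ * ((1 : Sp n) : Sp n ⧸ Gam n N).out ∈ Gam n N :=
    QuotientGroup.eq.1 (QuotientGroup.out_eq' _).symm
  rw [inv_one, one_mul] at h1
  exact Gam_le_cosetStab (GamInf n) γ h1

/-- If `γxα⁻¹ = gp` with `g ∈ Γ(N)` and `p ∈ Γ_∞`, then `α = p⁻¹g⁻¹γx`. Moving `g⁻¹` past `γ` by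
normality places `α` in `Γ_∞γΓ₀(N)`. -/
theorem cosetLimit_eq_zero (k : ℕ) {α γ x : Sp n} (hx : x ∈ Gam0 n N)
    (hα : α ∉ DoubleCoset.doubleCoset γ (GamInf n : Set (Sp n)) (Gam0 n N : Set (Sp n))) :
    cosetLimit N k (γ * x * α⁻¹) = 0 := by
  refine tsum_constTerm_eq_zero ?_
  rintro ⟨g, hg, p, hp, e⟩
  refine hα (DoubleCoset.mem_doubleCoset.2 ⟨p⁻¹, inv_mem hp, γ⁻¹ * g⁻¹ * γ * x,
    mul_mem (Gam_le_Gam0 ?_) hx, ?_⟩)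
  · simpa using Gam_normal.conj_mem g⁻¹ (inv_mem hg) γ⁻¹
  · have h1 : α = (γ * x * α⁻¹)⁻¹ * γ * x := by group
    rw [h1, e]
    group

end Averages

end SiegelEisenstein

theorem proposition3p1 (n : ℕ) (hn : 0 < n) (N : ℕ) (hN : 0 < N) (k : ℕ) (hk : n + 1 < k)
    (χ : DirichletCharacter ℂ N) (α γ : SiegelEisenstein.Sp n)
    (hE : ∃ τ ∈ SiegelEisenstein.halfSpace n, SiegelEisenstein.eis k χ γ τ ≠ 0) :
    (α ∉ DoubleCoset.doubleCoset γ (SiegelEisenstein.GamInf n : Set (SiegelEisenstein.Sp n))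
        (SiegelEisenstein.Gam0 n N : Set (SiegelEisenstein.Sp n)) →
      Tendsto (SiegelEisenstein.slash k (SiegelEisenstein.eis k χ γ) α⁻¹)
        (SiegelEisenstein.atIInfty n) (𝓝 0)) ∧
    (∀ β ∈ SiegelEisenstein.GamInf n, ∀ δ' ∈ SiegelEisenstein.Gam0 n N, α = β * γ * δ' →
      Tendsto (SiegelEisenstein.slash k (SiegelEisenstein.eis k χ γ) α⁻¹)
        (SiegelEisenstein.atIInfty n)
        (𝓝 (if N ≤ 2 then 2 else (starRingEnd ℂ) (SiegelEisenstein.chi χ (δ' * β))))) := by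
  refine ⟨fun hα => ?_, ?_⟩
  · have h := SiegelEisenstein.tendsto_slash_eis χ hN hk γ α⁻¹
    have h0 : ∀ c : SiegelEisenstein.Sp n ⧸ SiegelEisenstein.Gam n N,
        SiegelEisenstein.twist χ c.out * SiegelEisenstein.cosetLimit N k (γ * c.out * α⁻¹) = 0 := by
      intro c
      by_cases hc : c.out ∈ SiegelEisenstein.Gam0 n N
      · rw [SiegelEisenstein.cosetLimit_eq_zero k hc hα, mul_zero]
      · rw [SiegelEisenstein.twist_of_notMem χ hc, zero_mul]
    simpa only [h0, tsum_zero, mul_zero] using h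
  · rintro β hβ δ' hδ' rfl
    have h := SiegelEisenstein.tendsto_slash_eis χ hN hk γ (β * γ * δ')⁻¹
    rw [SiegelEisenstein.sum_twist_mul_cosetLimit χ hn hN hE hβ hδ'] at h
    split_ifs at h ⊢ with h2
    · rw [SiegelEisenstein.chi_eq_one_of_le_two χ hN h2 hδ', map_one, one_mul] at h
      have hk2 := SiegelEisenstein.even_weight χ hn hN h2 hE
      have h3 : (((SiegelEisenstein.blkD β).det : ℤ) : ℂ) ^ k = 1 := by
        rcases SiegelEisenstein.det_blkD_eq hβ with h' | h' <;> rw [h'] <;> simp [hk2.neg_one_pow]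
      rwa [h3, mul_one] at h
    -- The remaining factor `(det D_β)ᵏ` is `χ̄(β)`, which merges with `χ̄(δ')`.
    · rw [one_mul, ← SiegelEisenstein.conj_chi_of_mem_GamInf χ hn (by omega) hE hβ, ← map_mul,
        ← SiegelEisenstein.chi_mul χ hδ'] at h
      exact h
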